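/- Let $K$ be a global field, $X$ a proper normal variety (geometrically integral, separated, of finite type) over $K$, and $D=\sum_{\alpha}(1-\frac1{m_\alpha})D_\alpha$ a $\mathbb Q$-Cartier divisor on $X$, where the $D_\alpha$ are distinct prime divisors, $m_\alpha\in\mathbb Z_{\ge1}\cup\{\infty\}$, $\frac1\infty=0$, and only finitely many $m_\alpha$ differ from $1$. Let $S$ be a finite non-empty set of places of $K$ containing all archimedean places, and let $\mathcal X$ be a flat proper $\mathcal O_S$-scheme with an identification of its generic fibre with $X$. Let $\mathcal D_\alpha$ be the Zariski closure of $D_\alpha$ in $\mathcal X$, let $D_{\mathrm{red}}=\bigcup_{m_\alpha\ne1}D_\alpha$ and $\mathcal D_{\mathrm{red}}=\bigcup_{m_\alpha\neq 1}\mathcal D_\alpha$. For a place $v\notin S$ with completion $K_v$, ring of integers $\mathcal O_v$ and uniformiser $\pi_v$, a closed subscheme $\mathcal Z\subset\mathcal X_{\mathcal O_v}$ and $P\in X(K_v)$, with extension $\mathcal P\in\mathcal X(\mathcal O_v)$, put $n_v(\mathcal Z,P)=\infty$ if $P\in\mathcal Z$, and otherwise let $n_v(\mathcal Z,P)$ be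 the integer $n\geq 0$ with $\mathcal P\times_{\mathcal X_{\mathcal O_v}}\mathcal Z\cong\operatorname{Spec}(\mathcal O_v/(\pi_v^n))$; write $n_v(\mathcal D_\alpha,P)=n_v((\mathcal D_\alpha)_{\mathcal O_v},P)$. Write $\beta_v\mid\alpha$ if $\mathcal D_{\beta_v}$ is an irreducible component (with reduced structure) of $(\mathcal D_{\mathrm{red}})_{\mathcal O_v}$ that is a component of $(\mathcal D_\alpha)_{\mathcal O_v}$, and $\gamma\mid\alpha$ if $D_\gamma$ is an irreducible component of $(D_{\mathrm{red}})_{\overline K}$ that is a component of $(D_\alpha)_{\overline K}$. Let $K_\gamma\subset\overline K$ be the minimal field of definition of $D_\gamma$ over $K$, and let $\mathcal D_\gamma$ be the Zariski closure of $D_\gamma\subset X_{K_\gamma}$ in the base change of $\mathcal X$ to the ring of $S$-integers of $K_\gamma$; for a place $w\mid v$ of $K_\gamma$ define $n_w(\mathcal D_\gamma,P)$ in the same way as above, regarding $P$ as a point of $X((K_\gamma)_w)$. Let $P\in X(K_v)$ satisfy $n_v(\mathcal D_\alpha,P)=0$ for all $\alpha$ with $m_\alpha=\infty$. Call $P$ a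 $v$-adic Campana point if $n_v(\mathcal D_\alpha,P)\in\mathbb Z_{\ge m_\alpha}\cup\{0,\infty\}$ for all $\alpha$ with $m_\alpha\neq\infty$; a strong Campana point if $n_v(\mathcal D_{\beta_v},P)\in\mathbb Z_{\ge m_\alpha}\cup\{0,\infty\}$ for all such $\alpha$ and all $\beta_v\mid\alpha$; and a geometric Campana point if $n_w(\mathcal D_\gamma,P)\in\mathbb Z_{\ge m_\alpha}\cup\{0,\infty\}$ for all such $\alpha$, all $\gamma\mid\alpha$ and all places $w\mid v$ of $K_\gamma$. Define $v$-adic Darmon, strong Darmon and geometric Darmon points in the same way, with the condition that $m_\alpha$ divides the multiplicity (where $m_\alpha\mid\infty$) in place of membership in $\mathbb Z_{\ge m_\alpha}\cup\{0,\infty\}$. For $*\in\{\mathbf c,\mathbf d\}$ (Campana, Darmon) denote the sets of geometric, strong and ordinary $v$-adic points by $(\mathcal X,\mathcal D)^*_{\mathbf g}(\mathcal O_v)$, $(\mathcal X,\mathcal D)^*_{\mathbf s}(\mathcal O_v)$ and $(\mathcal X,\mathcal D)^*(\mathcal O_v)$. If all $D_\alpha$ are smooth over $K$, then for all but finitely many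 places $v\notin S$ and both $*\in\{\mathbf c,\mathbf d\}$, $$(\mathcal X,\mathcal D)^*_{\mathbf g}(\mathcal O_v)=(\mathcal X,\mathcal D)^*_{\mathbf s}(\mathcal O_v)=(\mathcal X,\mathcal D)^*(\mathcal O_v).$$ -/

import Mathlib

open CategoryTheory CategoryTheory.Limits AlgebraicGeometry TopologicalSpace

universe u w

noncomputable section

namespace SemiIntegral

/-! ### Global fields, places and `S`-integers -/

/-- A global field: a number field, or a finite extension of `𝔽_p(t)` for some prime `p`. -/
def IsGlobalField (K : Type u) [Field K] : Prop :=
  NumberField K ∨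
    ∃ (p : ℕ) (_ : Fact p.Prime) (_ : Algebra (RatFunc (ZMod p)) K),
      FiniteDimensional (RatFunc (ZMod p)) K

/-- The non-archimedean places of a global field `K`, given by their valuation rings in `K`:
these are exactly the valuation subrings of `K` different from `K`. -/
abbrev Place (K : Type u) [Field K] : Type u := {A : ValuationSubring K // A ≠ ⊤}

section Places

variable {K : Type u} [Field K]

/-- The ring `𝒪_S` of elements of `K` that are integral at all non-archimedean places outside
`S`. Only the non-archimedean members of a set of places matter for this ring. -/
def sIntegers (S : Set (Place K)) : Subring K where
  carrier := {x | ∀ v : Place K, v ∉ S → x ∈ v.1}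
  mul_mem' ha hb v hv := mul_mem (ha v hv) (hb v hv)
  one_mem' v _ := one_mem v.1
  add_mem' ha hb v hv := add_mem (ha v hv) (hb v hv)
  zero_mem' v _ := zero_mem v.1
  neg_mem' ha v hv := neg_mem (ha v hv)

/-- The completion `K_v` of `K` at `v`. -/
abbrev Compl (v : Place K) : Type u := v.1.valuation.Completion

/-- The ring `𝒪_v` of integers of `K_v`. -/
abbrev complIntegers (v : Place K) : ValuationSubring (Compl v) :=
  (Valued.v : Valuation (Compl v) v.1.ValueGroup).valuationSubring

/-- The embedding `K → K_v`. -/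
def toCompl (v : Place K) : K →+* Compl v :=
  (UniformSpace.Completion.coeRingHom : WithVal v.1.valuation →+* Compl v).comp
    (WithVal.equiv v.1.valuation).symm.toRingHom

theorem valued_toCompl (v : Place K) (x : K) :
    (Valued.v (toCompl v x) : v.1.ValueGroup) = v.1.valuation x := by
  unfold toCompl
  exact Valued.valuedCompletion_apply _

/-- The embedding `𝒪_S → 𝒪_v` for `v ∉ S`. -/
def sIntegersToCompl {S : Set (Place K)} {v : Place K} (hv : v ∉ S) :
    sIntegers S →+* complIntegers v :=
  ((toCompl v).comp (sIntegers S).subtype).codRestrict (complIntegers v).toSubring (fun x => by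
    change Valued.v (toCompl v x.1) ≤ 1
    rw [valued_toCompl, ValuationSubring.valuation_le_one_iff]
    exact x.2 v hv)

section Extension

variable {L : Type u} [Field L] [Algebra K L]

/-- `w ∣ v`: the place `w` of `L` extends the place `v` of `K`. -/
def Place.LiesOver (w : Place L) (v : Place K) : Prop :=
  w.1.comap (algebraMap K L) = v.1

/-- The places of `L` lying over the places in `S`. -/
def placesOver (L : Type u) [Field L] [Algebra K L] (S : Set (Place K)) : Set (Place L) :=
  {w | ∃ v ∈ S, w.LiesOver v}

theorem notMem_placesOver {S : Set (Place K)} {v : Place K} (hv : v ∉ S) {w : Place L}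
    (h : w.LiesOver v) : w ∉ placesOver L S := by
  rintro ⟨v', hv', h'⟩
  exact hv ((Subtype.ext (h.symm.trans h') : v = v') ▸ hv')

variable (L) in
/-- The embedding `𝒪_{K,S} → 𝒪_{L,S_L}`, where `S_L` is the set of places over `S`. -/
def sIntegersMap (S : Set (Place K)) : sIntegers S →+* sIntegers (placesOver L S) :=
  ((algebraMap K L).comp (sIntegers S).subtype).codRestrict _ (fun x w hw => by
    change x.1 ∈ w.1.comap (algebraMap K L)
    by_cases h : w.1.comap (algebraMap K L) = ⊤
    · rw [h]; trivial
    · exact x.2 ⟨_, h⟩ (fun hS => hw ⟨_, hS, rfl⟩))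

theorem hasExtension_of_liesOver {w : Place L} {v : Place K} (h : w.LiesOver v) :
    v.1.valuation.HasExtension w.1.valuation := by
  apply Valuation.HasExtension.ofComapInteger
  rw [ValuationSubring.integer_valuation, ValuationSubring.integer_valuation, ← h]
  rfl

/-- The map `K → L`, with `K` and `L` carrying the `v`-adic and `w`-adic topologies. -/
def withValMap (w : Place L) (v : Place K) :
    WithVal v.1.valuation →+* WithVal w.1.valuation :=
  ((WithVal.equiv w.1.valuation).symm.toRingHom.comp (algebraMap K L)).comp
    (WithVal.equiv v.1.valuation).toRingHom

theorem valued_withValMap_lt_iff {w : Place L} {v : Place K} (h : w.LiesOver v)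
    (x y : WithVal v.1.valuation) :
    (Valued.v (withValMap w v x) : w.1.ValueGroup) < Valued.v (withValMap w v y) ↔
      (Valued.v x : v.1.ValueGroup) < Valued.v y := by
  have := hasExtension_of_liesOver h
  exact Valuation.HasExtension.val_map_lt_iff v.1.valuation w.1.valuation
    (WithVal.equiv _ x) (WithVal.equiv _ y)

theorem exists_valued_le [Algebra.IsAlgebraic K L] {w : Place L} {v : Place K}
    (h : w.LiesOver v) {a : L} (ha : a ≠ 0) :
    ∃ y : K, y ≠ 0 ∧ w.1.valuation (algebraMap K L y) ≤ w.1.valuation a := by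
  let : Algebra v.1 L := ((algebraMap K L).comp v.1.subtype).toAlgebra
  have : IsScalarTower v.1 K L := IsScalarTower.of_algebraMap_eq fun _ => rfl
  have hz : IsAlgebraic v.1 a⁻¹ :=
    (IsFractionRing.isAlgebraic_iff v.1 K L).mpr (Algebra.IsAlgebraic.isAlgebraic _)
  obtain ⟨y, hy, hint⟩ := hz.exists_integral_multiple
  refine ⟨y.1, fun hy0 => hy (Subtype.ext hy0), ?_⟩
  have hle : (algebraMap v.1 L).range ≤ w.1.toSubring := by
    rintro _ ⟨r, rfl⟩
    change r.1 ∈ w.1.comap (algebraMap K L)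
    rw [h]
    exact r.2
  have hmem : y • a⁻¹ ∈ w.1 := by
    let f : v.1 →+* w.1 := (algebraMap v.1 L).codRestrict w.1.toSubring
      (fun r => hle ⟨r, rfl⟩)
    have hint' : IsIntegral w.1 (y • a⁻¹) := by
      obtain ⟨p, hp, hp0⟩ := hint
      refine ⟨p.map f, hp.map f, ?_⟩
      rw [Polynomial.eval₂_map]
      exact hp0
    obtain ⟨t, ht⟩ := IsIntegrallyClosed.isIntegral_iff.mp hint'
    rw [← ht]
    exact t.2
  have h1 := (ValuationSubring.valuation_le_one_iff w.1 _).mpr hmem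
  rw [Algebra.smul_def, map_mul, map_inv₀] at h1
  rwa [← div_eq_mul_inv, div_le_one₀ ((Valuation.pos_iff _).mpr ha)] at h1

variable [Algebra.IsAlgebraic K L]

theorem continuous_withValMap {w : Place L} {v : Place K} (h : w.LiesOver v) :
    Continuous (withValMap w v) := by
  refine continuous_of_continuousAt_zero _ ?_
  simp_rw [ContinuousAt, map_zero, (Valued.hasBasis_nhds_zero _ _).tendsto_iff
    (Valued.hasBasis_nhds_zero _ _), true_and, forall_const]
  intro γ
  obtain ⟨a, ha⟩ := MonoidWithZeroHom.ValueGroup₀.restrict₀_surjective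
    (.ofClass (Valued.v : Valuation (WithVal w.1.valuation) w.1.ValueGroup)) γ.1
  have ha' : (Valued.v : Valuation (WithVal w.1.valuation) w.1.ValueGroup).restrict a = γ.1 := ha
  have ha0 : WithVal.equiv _ a ≠ 0 := by
    intro h0
    have : a = 0 := (WithVal.equiv _).injective (h0.trans (map_zero _).symm)
    rw [this, map_zero] at ha'
    exact γ.ne_zero ha'.symm
  obtain ⟨y, hy0, hy⟩ := exists_valued_le h ha0
  let y' : WithVal v.1.valuation := (WithVal.equiv v.1.valuation).symm y
  have hy' : (Valued.v : Valuation (WithVal v.1.valuation) v.1.ValueGroup).restrict y' ≠ 0 := by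
    rw [Valuation.ne_zero_iff]
    exact fun h0 => hy0 ((WithVal.equiv v.1.valuation).symm.injective (h0.trans (map_zero _).symm))
  refine ⟨Units.mk0 _ hy', fun x hx => ?_⟩
  change Valuation.restrict _ _ < γ.1
  rw [← ha', Valuation.restrict_lt_iff]
  have hx' : (Valued.v : Valuation (WithVal v.1.valuation) v.1.ValueGroup).restrict x <
      (Valued.v : Valuation (WithVal v.1.valuation) v.1.ValueGroup).restrict y' := hx
  rw [Valuation.restrict_lt_iff] at hx'
  exact ((valued_withValMap_lt_iff h x y').mpr hx').trans_le hy

/-- The embedding `K_v → L_w` for `w ∣ v`. -/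
def complMap {w : Place L} {v : Place K} (h : w.LiesOver v) : Compl v →+* Compl w :=
  UniformSpace.Completion.mapRingHom (withValMap w v) (continuous_withValMap h)

theorem complMap_toCompl {w : Place L} {v : Place K} (h : w.LiesOver v) (x : K) :
    complMap h (toCompl v x) = toCompl w (algebraMap K L x) :=
  UniformSpace.Completion.mapRingHom_coe (continuous_withValMap h) _

theorem isClopen_complIntegers (v : Place K) :
    IsClopen {x : Compl v | (Valued.v x : v.1.ValueGroup) ≤ 1} := by
  have := Valued.isClopen_closedBall (R := Compl v) (Γ₀ := v.1.ValueGroup) one_ne_zero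
  simpa only [Valuation.restrict_le_one_iff] using this

theorem complMap_mem {w : Place L} {v : Place K} (h : w.LiesOver v) (x : Compl v)
    (hx : x ∈ complIntegers v) : complMap h x ∈ complIntegers w := by
  revert hx
  have hcont : Continuous (complMap h) := UniformSpace.Completion.continuous_map
  induction x using UniformSpace.Completion.induction_on with
  | hp =>
    have h1 := (isClopen_complIntegers v).compl.isClosed
    have h2 := (isClopen_complIntegers w).isClosed.preimage hcont
    convert h1.union h2 using 1
    ext x
    exact imp_iff_not_or
  | ih a =>
    intro ha
    have ha' : v.1.valuation (WithVal.equiv _ a) ≤ 1 := by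
      have := Valued.valuedCompletion_apply a
      exact this ▸ ha
    have hext := hasExtension_of_liesOver h
    have h2 := (Valuation.HasExtension.val_map_le_one_iff v.1.valuation w.1.valuation _).mpr ha'
    have h3 := complMap_toCompl h (WithVal.equiv _ a)
    change Valued.v (complMap h (a : Compl v)) ≤ 1
    have h4 : complMap h (a : Compl v) = toCompl w (algebraMap K L (WithVal.equiv _ a)) := h3
    rw [h4, valued_toCompl]
    exact h2

/-- The embedding `𝒪_v → 𝒪_w` for `w ∣ v`. -/
def complIntegersMap {w : Place L} {v : Place K} (h : w.LiesOver v) :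
    complIntegers v →+* complIntegers w :=
  ((complMap h).comp (complIntegers v).toSubring.subtype).codRestrict
    (complIntegers w).toSubring (fun x => complMap_mem h x.1 x.2)

end Extension

end Places

/-! ### Components of closed sets, intersection multiplicities -/

/-- `T` is an irreducible component of the closed subset `Z`. -/
def IsComponent {T : Type u} [TopologicalSpace T] (C Z : Closeds T) : Prop :=
  Maximal (fun C' : Closeds T => IsIrreducible (C' : Set T) ∧ C' ≤ Z) C

open Classical in
/-- The intersection multiplicity of an `R`-point `y` of `Y` (where `R` is a discrete valuation
ring with fraction field `F`) with a closed subscheme `Z` of `Y`: it is `∞` if the generic point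
`Spec F ⟶ Y` of `y` lies on `Z`, and otherwise it is the `n` such that the fibre product of `y`
and `Z` over `Y` is isomorphic to `Spec (R / 𝔪 ^ n)`. -/
def intMult (R F : Type u) [CommRing R] [IsLocalRing R] [Field F] [Algebra R F] {Y : Scheme.{u}}
    (y : Spec (.of R) ⟶ Y) (Z : Y.IdealSheafData) : ℕ∞ :=
  if ∃ z : Spec (.of F) ⟶ Z.subscheme,
      z ≫ Z.subschemeι = Spec.map (CommRingCat.ofHom (algebraMap R F)) ≫ y then ⊤
  else sInf {n : ℕ∞ | ∃ k : ℕ, n = k ∧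
    Nonempty (pullback y Z.subschemeι ≅ Spec (.of (R ⧸ IsLocalRing.maximalIdeal R ^ k)))}

/-! ### Orbifolds -/

/-- A proper normal variety over `F`, a variety being a geometrically integral separated scheme of
finite type. -/
structure ProperNormalVariety (F : Type u) [Field F] where
  /-- The underlying scheme. -/
  X : Scheme.{u}
  /-- The structure morphism. -/
  str : X ⟶ Spec (.of F)
  isProper : IsProper str
  geometricallyIntegral : GeometricallyIntegral str
  normal : ∀ x : X, IsIntegrallyClosed (X.presheaf.stalk x)

attribute [instance] ProperNormalVariety.isProper ProperNormalVariety.geometricallyIntegral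

instance {F : Type u} [Field F] (V : ProperNormalVariety F) : IsIntegral V.X :=
  GeometricallyIntegral.isIntegral_of_subsingleton V.str

instance {F : Type u} [Field F] (V : ProperNormalVariety F) : IsLocallyNoetherian V.X :=
  LocallyOfFiniteType.isLocallyNoetherian V.str

/-- The Weil `ℚ`-divisor whose coefficient at the prime divisor with generic point `z` is `E z` is
`ℚ`-Cartier: some positive multiple of it is locally the divisor of a rational function. -/
def ProperNormalVariety.IsQCartier {F : Type u} [Field F] (V : ProperNormalVariety F)
    (E : V.X → ℚ) : Prop :=
  ∃ N : ℕ, 0 < N ∧ ∀ x : V.X, ∃ U : V.X.Opens, x ∈ U ∧ ∃ f : V.X.functionField, f ≠ 0 ∧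
    ∀ z ∈ U, Order.coheight z = 1 → (Scheme.ord f z : ℚ) = N * E z

/-- The coefficient `1 - 1 / m` of weight `m ∈ ℤ_{≥ 1} ∪ {∞}`, where `1 / ∞ = 0`. -/
def weightCoeff : ℕ∞ → ℚ
  | ⊤ => 1
  | (m : ℕ) => 1 - 1 / m

open Classical in
/-- A Campana orbifold `(X, D)` over `F`, where `D = ∑_α (1 - 1 / m_α) D_α`: here `X` is a
proper normal variety over `F`, the `D_α` are distinct prime divisors on `X`, the weights `m_α` lie
in `ℤ_{≥ 1} ∪ {∞}`, only finitely many of them differ from `1`, and `D` is `ℚ`-Cartier. -/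
structure CampanaOrbifold (F : Type u) [Field F] (ι : Type w) extends ProperNormalVariety F where
  /-- The prime divisors, as closed subsets (with the reduced scheme structure). -/
  D : ι → Closeds X
  D_injective : Function.Injective D
  irreducible : ∀ α, IsIrreducible (D α : Set X)
  codim_one : ∀ α (x : X), IsGenericPoint x (D α : Set X) → Order.coheight x = 1
  /-- The weights. -/
  m : ι → ℕ∞
  one_le_m : ∀ α, 1 ≤ m α
  finite_m : {α | m α ≠ 1}.Finite
  isQCartier : toProperNormalVariety.IsQCartier fun z =>
    ∑ᶠ α, if IsGenericPoint z (D α : Set X) then weightCoeff (m α) else 0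

namespace CampanaOrbifold

variable {K : Type u} [Field K] {ι : Type w} (X : CampanaOrbifold K ι)

/-- The prime divisor `D_α` as a reduced closed subscheme. -/
def ideal (α : ι) : X.X.IdealSheafData := .vanishingIdeal (X.D α)

/-- All the divisors `D_α` are smooth over the ground field. -/
def SmoothComponents : Prop :=
  ∀ α, Smooth ((X.ideal α).subschemeι ≫ X.str)

/-- The support `D_red` of `D`, the union of the `D_α` with `m_α ≠ 1`. -/
def red : Closeds X.X :=
  ⟨⋃ α ∈ {α | X.m α ≠ 1}, X.D α, X.finite_m.isClosed_biUnion fun α _ => (X.D α).isClosed⟩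

/-- The set `X(K_v)`. -/
def LocalPoint (v : Place K) : Type u :=
  {P : Spec (.of (Compl v)) ⟶ X.X // P ≫ X.str = Spec.map (CommRingCat.ofHom (toCompl v))}

/-! ### Geometric components and their fields of definition -/

/-- The base change `X_L`. -/
abbrev baseChange (L : Type u) [Field L] [Algebra K L] : Scheme.{u} :=
  pullback X.str (Spec.map (CommRingCat.ofHom (algebraMap K L)))

/-- The projection `X_L ⟶ X`. -/
abbrev overFst (L : Type u) [Field L] [Algebra K L] : X.baseChange L ⟶ X.X :=
  pullback.fst X.str (Spec.map (CommRingCat.ofHom (algebraMap K L)))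

/-- The projection `X_L' ⟶ X_L` for `K ⊆ L ⊆ L'`. -/
def overMap (L L' : Type u) [Field L] [Algebra K L] [Field L'] [Algebra K L'] [Algebra L L']
    [IsScalarTower K L L'] : X.baseChange L' ⟶ X.baseChange L :=
  pullback.lift (X.overFst L')
    (pullback.snd _ _ ≫ Spec.map (CommRingCat.ofHom (algebraMap L L'))) (by
      rw [pullback.condition, Category.assoc, ← Spec.map_comp, ← CommRingCat.ofHom_comp,
        ← IsScalarTower.algebraMap_eq])

/-- `γ ∣ α`: the closed subset `C` of `X_K̄` is an irreducible component `D_γ` of `(D_red)_K̄`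
and a component of `(D_α)_K̄`. -/
def IsGeomComponent (α : ι) (C : Closeds (X.baseChange (AlgebraicClosure K))) : Prop :=
  IsComponent C (X.red.preimage (X.overFst (AlgebraicClosure K)).continuous) ∧
    IsComponent C ((X.D α).preimage (X.overFst (AlgebraicClosure K)).continuous)

/-- The closed subset `C` of `X_K̄`, with its reduced scheme structure, is defined over the
intermediate field `L`: it is the base change of a closed subscheme of `X_L`. -/
def IsDefinedOver (C : Closeds (X.baseChange (AlgebraicClosure K)))
    (L : IntermediateField K (AlgebraicClosure K)) : Prop :=
  ∃ I : (X.baseChange L).IdealSheafData,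
    I.comap (X.overMap L (AlgebraicClosure K)) = .vanishingIdeal C

/-- The minimal field of definition `K_γ` of the closed subset `D_γ` of `X_K̄`. -/
def fieldOfDef (C : Closeds (X.baseChange (AlgebraicClosure K))) :
    IntermediateField K (AlgebraicClosure K) :=
  sInf {L | X.IsDefinedOver C L}

/-- The closed subscheme `D_γ` of `X_{K_γ}`: the image of the closed subscheme of `X_K̄`. -/
def geomIdeal (C : Closeds (X.baseChange (AlgebraicClosure K))) :
    (X.baseChange (X.fieldOfDef C)).IdealSheafData :=
  (Scheme.IdealSheafData.vanishingIdeal C).map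
    (X.overMap (X.fieldOfDef C) (AlgebraicClosure K))

end CampanaOrbifold

/-! ### Models -/

/-- A model of a Campana orbifold over `𝒪_S`: a flat proper `𝒪_S`-scheme with an identification of
its generic fibre with `X`. -/
structure Model {K : Type u} [Field K] {ι : Type w} (X : CampanaOrbifold K ι)
    (S : Set (Place K)) where
  /-- The underlying scheme. -/
  Y : Scheme.{u}
  /-- The structure morphism. -/
  str : Y ⟶ Spec (.of (sIntegers S))
  isProper : IsProper str
  flat : Flat str
  /-- The inclusion of the generic fibre. -/
  gen : X.X ⟶ Y
  isPullback : IsPullback gen X.str str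
    (Spec.map (CommRingCat.ofHom (sIntegers S).subtype))

namespace Model

variable {K : Type u} [Field K] {ι : Type w} {X : CampanaOrbifold K ι} {S : Set (Place K)}
  (M : Model X S)

/-- The Zariski closure `𝒟_α` of `D_α` in the model. -/
def ideal (α : ι) : M.Y.IdealSheafData := (X.ideal α).map M.gen

/-- The union `𝒟_red` of the `𝒟_α` with `m_α ≠ 1`. -/
def red : Closeds M.Y :=
  ⟨⋃ α ∈ {α | X.m α ≠ 1}, (M.ideal α).support,
    X.finite_m.isClosed_biUnion fun α _ => (M.ideal α).support.isClosed⟩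

section Local

variable {v : Place K} (hv : v ∉ S)

/-- The base change of the model to `𝒪_v`. -/
abbrev atPlace : Scheme.{u} :=
  pullback M.str (Spec.map (CommRingCat.ofHom (sIntegersToCompl hv)))

/-- The projection from the base change to the model. -/
abbrev atPlaceFst : M.atPlace hv ⟶ M.Y :=
  pullback.fst M.str (Spec.map (CommRingCat.ofHom (sIntegersToCompl hv)))

/-- `β_v ∣ α`: the closed subset `C` is an irreducible component `𝒟_{β_v}` of `(𝒟_red)_{𝒪_v}`
and a component of `(𝒟_α)_{𝒪_v}`. -/
def IsLocalComponent (α : ι) (C : Closeds (M.atPlace hv)) : Prop :=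
  IsComponent C (M.red.preimage (M.atPlaceFst hv).continuous) ∧
    IsComponent C ((M.ideal α).support.preimage (M.atPlaceFst hv).continuous)

theorem extension_commSq (P : X.LocalPoint v) :
    CommSq (P.1 ≫ M.gen)
      (Spec.map (CommRingCat.ofHom (algebraMap (complIntegers v) (Compl v)))) M.str
      (Spec.map (CommRingCat.ofHom (sIntegersToCompl hv))) := by
  constructor
  rw [Category.assoc, M.isPullback.w, ← Category.assoc, P.2, ← Spec.map_comp, ← Spec.map_comp,
    ← CommRingCat.ofHom_comp, ← CommRingCat.ofHom_comp]
  rfl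

theorem existsUnique_extension (P : X.LocalPoint v) :
    ∃! y : Spec (.of (complIntegers v)) ⟶ M.Y,
      Spec.map (CommRingCat.ofHom (algebraMap (complIntegers v) (Compl v))) ≫ y = P.1 ≫ M.gen ∧
      y ≫ M.str = Spec.map (CommRingCat.ofHom (sIntegersToCompl hv)) := by
  have hp := M.isProper
  have hval : ValuativeCriterion M.str := by
    have := IsProper.eq_valuativeCriterion ▸ hp
    exact this.1.1.1
  let sq : ValuativeCommSq M.str :=
    { R := complIntegers v
      K := Compl v
      i₁ := P.1 ≫ M.gen
      i₂ := Spec.map (CommRingCat.ofHom (sIntegersToCompl hv))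
      commSq := M.extension_commSq hv P }
  obtain ⟨⟨l⟩⟩ := hval.existence sq
  have huniq := hval.uniqueness sq
  refine ⟨l.l, ⟨l.fac_left, l.fac_right⟩, fun y hy => ?_⟩
  exact congrArg CommSq.LiftStruct.l (Subsingleton.elim (α := sq.commSq.LiftStruct)
    ⟨y, hy.1, hy.2⟩ l)

/-- The extension of `P ∈ X(K_v)` to a morphism `Spec 𝒪_v ⟶ 𝒳` over `𝒪_S`. -/
def extend (P : X.LocalPoint v) : Spec (.of (complIntegers v)) ⟶ M.Y :=
  (M.existsUnique_extension hv P).choose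

theorem extend_str (P : X.LocalPoint v) :
    M.extend hv P ≫ M.str = Spec.map (CommRingCat.ofHom (sIntegersToCompl hv)) :=
  (M.existsUnique_extension hv P).choose_spec.1.2

/-- The extension of `P ∈ X(K_v)` to an `𝒪_v`-point of `𝒳_{𝒪_v}`. -/
def integralPoint (P : X.LocalPoint v) : Spec (.of (complIntegers v)) ⟶ M.atPlace hv :=
  pullback.lift (M.extend hv P) (𝟙 _) (by rw [extend_str, Category.id_comp])

/-- The local intersection multiplicity `n_v(Z, P)` for a closed subscheme `Z` of `𝒳_{𝒪_v}`. -/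
def mult (P : X.LocalPoint v) (Z : (M.atPlace hv).IdealSheafData) : ℕ∞ :=
  intMult (complIntegers v) (Compl v) (M.integralPoint hv P) Z

/-- The multiplicity `n_v(𝒟_α, P)`. -/
def multDivisor (P : X.LocalPoint v) (α : ι) : ℕ∞ :=
  M.mult hv P ((M.ideal α).comap (M.atPlaceFst hv))

end Local

/-! ### Base change to a finite extension -/

section BaseChange

variable (L : Type u) [Field L] [Algebra K L]

/-- The base change of the model to the ring of `S`-integers of `L`. -/
abbrev baseChange : Scheme.{u} :=
  pullback M.str (Spec.map (CommRingCat.ofHom (sIntegersMap L S)))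

/-- The inclusion of the generic fibre `X_L` of `𝒳_{𝒪_{L,S}}`. -/
def overGen : X.baseChange L ⟶ M.baseChange L :=
  pullback.lift (X.overFst L ≫ M.gen)
    (pullback.snd _ _ ≫ Spec.map (CommRingCat.ofHom (sIntegers (placesOver L S)).subtype)) (by
      rw [Category.assoc, M.isPullback.w, ← Category.assoc, pullback.condition, Category.assoc,
        Category.assoc, ← Spec.map_comp, ← Spec.map_comp, ← CommRingCat.ofHom_comp,
        ← CommRingCat.ofHom_comp]
      rfl)

variable {L} [Algebra.IsAlgebraic K L] {v : Place K} (hv : v ∉ S) {w : Place L}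
  (h : w.LiesOver v)

/-- The base change of `𝒳_{𝒪_{L,S}}` to `𝒪_w`. -/
abbrev overAtPlace : Scheme.{u} :=
  pullback (pullback.snd M.str (Spec.map (CommRingCat.ofHom (sIntegersMap L S))))
    (Spec.map (CommRingCat.ofHom (sIntegersToCompl (notMem_placesOver hv h))))

/-- The `𝒪_w`-point of `𝒳_{𝒪_w}` that extends the image of `P ∈ X(K_v)` in `X(L_w)`. -/
def overIntegralPoint (P : X.LocalPoint v) :
    Spec (.of (complIntegers w)) ⟶ M.overAtPlace hv h :=
  pullback.lift
    (pullback.lift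
      (Spec.map (CommRingCat.ofHom (complIntegersMap h)) ≫ M.extend hv P)
      (Spec.map (CommRingCat.ofHom (sIntegersToCompl (notMem_placesOver hv h)))) (by
        rw [Category.assoc, extend_str, ← Spec.map_comp, ← Spec.map_comp,
          ← CommRingCat.ofHom_comp, ← CommRingCat.ofHom_comp]
        congr 2
        ext x
        exact complMap_toCompl h x.1))
    (𝟙 _) (by rw [pullback.lift_snd, Category.id_comp])

/-- The multiplicity `n_w(𝒵, P)` for a closed subscheme `𝒵` of `𝒳_{𝒪_{L,S}}` and `P ∈ X(K_v)`,
where `w` is a place of `L` over `v`. -/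
def overMult (P : X.LocalPoint v) (Z : (M.baseChange L).IdealSheafData) : ℕ∞ :=
  intMult (complIntegers w) (Compl w) (M.overIntegralPoint hv h P)
    (Z.comap (pullback.fst _ _))

end BaseChange

/-- The Zariski closure `𝒟_γ` of `D_γ` in the base change of the model to the ring of `S`-integers
of `K_γ`. -/
def geomIdeal (C : Closeds (X.baseChange (AlgebraicClosure K))) :
    (M.baseChange (X.fieldOfDef C)).IdealSheafData :=
  (X.geomIdeal C).map (M.overGen (X.fieldOfDef C))

end Model

/-! ### Semi-integral points -/

/-- The two kinds of semi-integral points. -/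
inductive Kind
  | campana
  | darmon

/-- The condition on a multiplicity `n ∈ ℤ_{≥ 0} ∪ {∞}` for the finite weight `m`: for Campana
points, `n ∈ ℤ_{≥ m} ∪ {0, ∞}`, and for Darmon points, `m ∣ n` (where `m ∣ ∞`). -/
def Kind.Admissible : Kind → ℕ → ℕ∞ → Prop
  | .campana, m, n => n = 0 ∨ n = ⊤ ∨ (m : ℕ∞) ≤ n
  | .darmon, m, n => n = ⊤ ∨ ∃ k : ℕ, n = k ∧ m ∣ k

namespace Model

variable {K : Type u} [Field K] {ι : Type w} {X : CampanaOrbifold K ι} {S : Set (Place K)}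
  (M : Model X S) {v : Place K} (hv : v ∉ S)

/-- The points `P ∈ X(K_v)` with `n_v(𝒟_α, P) = 0` whenever `m_α = ∞`. -/
def basePoints : Set (X.LocalPoint v) :=
  {P | ∀ α, X.m α = ⊤ → M.multDivisor hv P α = 0}

/-- The `v`-adic Campana (respectively Darmon) points. -/
def points (k : Kind) : Set (X.LocalPoint v) :=
  {P | P ∈ M.basePoints hv ∧ ∀ (α : ι) (m : ℕ), X.m α = m →
    k.Admissible m (M.multDivisor hv P α)}

/-- The `v`-adic strong Campana (respectively strong Darmon) points. -/
def strongPoints (k : Kind) : Set (X.LocalPoint v) :=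
  {P | P ∈ M.basePoints hv ∧ ∀ (α : ι) (m : ℕ), X.m α = m →
    ∀ C : Closeds (M.atPlace hv), M.IsLocalComponent hv α C →
      k.Admissible m (M.mult hv P (.vanishingIdeal C))}

/-- The `v`-adic geometric Campana (respectively geometric Darmon) points. -/
def geometricPoints (k : Kind) : Set (X.LocalPoint v) :=
  {P | P ∈ M.basePoints hv ∧ ∀ (α : ι) (m : ℕ), X.m α = m →
    ∀ C : Closeds (X.baseChange (AlgebraicClosure K)), X.IsGeomComponent α C →
      ∀ (w : Place (X.fieldOfDef C)) (h : w.LiesOver v),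
        k.Admissible m (M.overMult hv h P (M.geomIdeal C))}

end Model

end SemiIntegral

end

/-! At almost every place a single component carries the whole multiplicity n_v(𝒟_α, P). The three
conditions then test the same number, apart from zeros, which are always admissible.

Cover the model by finitely many affine charts Spec A and let I be the ideal of 𝒟_α in A. Since D_α
is smooth over K, A/I becomes smooth over the valuation ring of v for almost all v
(`IsGlobalField.eventually_smooth`), hence over the discrete valuation ring 𝒪_v. Local rings of an
algebra smooth over such a ring are domains (`IsLocallyDomain.of_smooth`), so the components of
(𝒟_α)_{𝒪_v} are disjoint. If the closed point of the 𝒪_v-point P lies on a component, that component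
agrees with 𝒟_α near it and has the same multiplicity (`IsLocallyDomain.map_eq_map`); every other
component has multiplicity 0. The component through the closed point dominates 𝒟_α by flatness, and
lies on no other 𝒟_β because all D_β have codimension one (`Model.Chart.eq_of_ideal_le`), so it is a
component of 𝒟_red as well. Hence strong and ordinary points agree.

For geometric points, smoothness makes D_γ open and closed in (D_α)_K̄, cut out by an idempotent e.
A p-power of e has separable coefficients, so K_γ is finite and separable over K
(`Model.fieldOfDef_finite`). It is therefore unramified over almost all v, and passing from 𝒪_v to
𝒪_w does not change exponents of ideals. The image of D_γ over K_γ is again cut out by an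
idempotent; its denominator is a unit at almost all v, and the idempotent takes the value 0 or 1 at
the closed point of P. So n_w(𝒟_γ, P) is 0 or n_v(𝒟_α, P) (`IsGlobalField.eventually_map_eq`).
Conversely, if n_v(𝒟_α, P) > 0, then any γ ∣ α meeting the chart has n_w(𝒟_γ, P) > 0 for some w ∣ v:
a valuation ring of the residue field at the generic point of D_γ, centred at the reduction of P,
restricts to such a w (`exists_liesOver_map_le`).

The arithmetic input is that 𝒪_S has fraction field K, that an element of K is integral at almost
all places, and that almost all places are discrete with valuation ring a localization of 𝒪_S. For
function fields the first fact needs a nonconstant function with its only pole at a given place of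
S, which comes from a dimension count in the style of Riemann (`exists_transcendental_mem_of_ne`).
-/

noncomputable section

namespace SemiIntegral

/-! ### Places centred on a Dedekind domain -/

section DedekindPlaces

open IsDedekindDomain

variable {K : Type u} [Field K]

/-- The centre of v on C is nonzero: otherwise all nonzero elements of C are units at v, and v
contains K. The localization at the centre lies in v, and it is a discrete valuation ring, so no
proper subring of K is strictly larger. -/
theorem Place.exists_eq_valuationSubringAtPrime (C : Type*) [CommRing C] [IsDedekindDomain C]
    [Algebra C K] [IsFractionRing C K] (v : Place K) (hC : ∀ c : C, algebraMap C K c ∈ v.1) :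
    ∃ P : HeightOneSpectrum C, v.1 = HeightOneSpectrum.valuationSubringAtPrime K P ∧
      ∀ c : C, c ∈ P.asIdeal ↔ v.1.valuation (algebraMap C K c) < 1 := by
  let f : C →+* v.1 := (algebraMap C K).codRestrict v.1.toSubring hC
  let p : Ideal C := (IsLocalRing.maximalIdeal v.1).comap f
  have hp : p.IsPrime := inferInstance
  have hmem : ∀ c : C, c ∈ p ↔ v.1.valuation (algebraMap C K c) < 1 := fun c =>
    (ValuationSubring.valuation_lt_one_iff v.1 (f c))
  have hbot : p ≠ ⊥ := by
    intro h
    apply v.2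
    rw [eq_top_iff]
    intro x _
    obtain ⟨a, b, hb, rfl⟩ := IsFractionRing.div_surjective (A := C) x
    have hb0 : b ≠ 0 := nonZeroDivisors.ne_zero hb
    have : v.1.valuation (algebraMap C K b) = 1 := by
      refine le_antisymm ((ValuationSubring.valuation_le_one_iff _ _).mpr (hC b)) (not_lt.mp ?_)
      rw [← hmem, h]
      exact hb0
    rw [← ValuationSubring.valuation_le_one_iff, map_div₀, this, div_one,
      ValuationSubring.valuation_le_one_iff]
    exact hC a
  let P : HeightOneSpectrum C := ⟨p, hp, hbot⟩
  refine ⟨P, ?_, hmem⟩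
  symm
  refine ValuationSubring.eq_of_le_of_ne_top _ ?_ v.2
  rintro x ⟨a, s, hs, rfl⟩
  have h1 : v.1.valuation (algebraMap C K s) = 1 :=
    le_antisymm ((ValuationSubring.valuation_le_one_iff _ _).mpr (hC s))
      (not_lt.mp fun h => hs ((hmem s).mpr h))
  rw [← ValuationSubring.valuation_le_one_iff, map_mul, map_inv₀, h1, inv_one, mul_one,
    ValuationSubring.valuation_le_one_iff]
  exact hC a

theorem Place.exists_frac (C : Type*) [CommRing C] [IsDedekindDomain C]
    [Algebra C K] [IsFractionRing C K] (v : Place K) (hC : ∀ c : C, algebraMap C K c ∈ v.1)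
    {x : K} (hx : x ∈ v.1) :
    ∃ a b : C, v.1.valuation (algebraMap C K b) = 1 ∧ x = algebraMap C K a / algebraMap C K b := by
  obtain ⟨P, hP, hmem⟩ := Place.exists_eq_valuationSubringAtPrime C v hC
  rw [hP] at hx
  obtain ⟨a, s, hs, rfl⟩ := hx
  refine ⟨a, s, ?_, by rw [div_eq_mul_inv]⟩
  exact le_antisymm ((ValuationSubring.valuation_le_one_iff _ _).mpr (hC s))
      (not_lt.mp fun h => hs ((hmem s).mpr h))

theorem Place.isDiscreteValuationRing (C : Type*) [CommRing C] [IsDedekindDomain C]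
    [Algebra C K] [IsFractionRing C K] (v : Place K) (hC : ∀ c : C, algebraMap C K c ∈ v.1) :
    IsDiscreteValuationRing v.1 := by
  obtain ⟨P, hP, -⟩ := Place.exists_eq_valuationSubringAtPrime C v hC
  rw [hP]
  exact IsLocalization.AtPrime.isDiscreteValuationRing_of_dedekind_domain C P.ne_bot _

/-- Only finitely many places containing a Dedekind domain contain a given nonzero element of it
in their maximal ideal. -/
theorem finite_places_valuation_lt_one (C : Type*) [CommRing C] [IsDedekindDomain C]
    [Algebra C K] [IsFractionRing C K] {c : C} (hc : c ≠ 0) :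
    {v : Place K | (∀ c : C, algebraMap C K c ∈ v.1) ∧
      v.1.valuation (algebraMap C K c) < 1}.Finite := by
  have hfin : {P : HeightOneSpectrum C | P.asIdeal ∣ Ideal.span {c}}.Finite :=
    Ideal.finite_factors (by simpa using hc)
  refine (hfin.image fun P => (⟨HeightOneSpectrum.valuationSubringAtPrime K P, ?_⟩ : Place K)).subset
    ?_
  · rw [HeightOneSpectrum.valuationSubringAtPrime_eq_valuationSubring]
    simp only [ne_eq, Valuation.valuationSubring_eq_top_iff, not_not]
    infer_instance
  · rintro v ⟨hv, hvc⟩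
    obtain ⟨P, hP, hmem⟩ := Place.exists_eq_valuationSubringAtPrime C v hv
    refine ⟨P, ?_, Subtype.ext hP.symm⟩
    rw [Set.mem_ofPred_eq, Ideal.dvd_span_singleton, hmem]
    exact hvc

open Filter in
-- At a place containing C, a pole of a/b is a zero of b, and a nonzero b lies in only finitely many
-- primes.
theorem eventually_mem_of_eventually_subset (C : Type*) [CommRing C] [IsDedekindDomain C]
    [Algebra C K] [IsFractionRing C K]
    (h : ∀ᶠ v : Place K in cofinite, ∀ c : C, algebraMap C K c ∈ v.1) (x : K) :
    ∀ᶠ v : Place K in cofinite, x ∈ v.1 := by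
  obtain ⟨a, b, hb, rfl⟩ := IsFractionRing.div_surjective (A := C) x
  have h2 := (finite_places_valuation_lt_one (K := K) C
    (nonZeroDivisors.ne_zero hb)).eventually_cofinite_notMem
  filter_upwards [h, h2] with v hv hv2
  have h1 : v.1.valuation (algebraMap C K b) = 1 :=
    le_antisymm ((ValuationSubring.valuation_le_one_iff _ _).mpr (hv b))
      (not_lt.mp fun h => hv2 ⟨hv, h⟩)
  rw [← ValuationSubring.valuation_le_one_iff, map_div₀, h1, div_one,
    ValuationSubring.valuation_le_one_iff]
  exact hv a

end DedekindPlaces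

end SemiIntegral

end

/-! ### Global function fields and rings of finite type over ℤ -/

noncomputable section

namespace SemiIntegral

theorem mem_valuationSubring_of_isIntegralElem {K : Type*} [Field K] {B : Type*} [CommRing B]
    (A : ValuationSubring K) (φ : B →+* K) (hφ : ∀ b, φ b ∈ A) {x : K} (hx : φ.IsIntegralElem x) :
    x ∈ A := by
  let f : B →+* A := φ.codRestrict A.toSubring hφ
  have hint : IsIntegral A x := by
    obtain ⟨p, hp, hp0⟩ := hx
    refine ⟨p.map f, hp.map f, ?_⟩
    rw [Polynomial.eval₂_map]
    exact hp0
  obtain ⟨t, ht⟩ := IsIntegrallyClosed.isIntegral_iff.mp hint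
  rw [← ht]
  exact t.2

section FunctionField

open Polynomial IntermediateField
open scoped IntermediateField.algebraAdjoinAdjoin

variable {k : Type*} [Field k] {K : Type u} [Field K] [Algebra k K]

/-- As a quotient of k[X] the ring k[t] is principal whether or not t is transcendental, so it can
serve as the base of an integral closure. -/
instance isPrincipalIdealRing_adjoin_singleton (t : K) :
    IsPrincipalIdealRing (Algebra.adjoin k {t}) := by
  let f : k[X] →ₐ[k] Algebra.adjoin k {t} :=
    (aeval t).codRestrict _ (fun p => aeval_mem_adjoin_singleton k t)
  refine IsPrincipalIdealRing.of_surjective (f : k[X] →+* Algebra.adjoin k {t}) ?_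
  rintro ⟨x, hx⟩
  obtain ⟨p, rfl⟩ := Algebra.adjoin_mem_exists_aeval k t hx
  exact ⟨p, rfl⟩

theorem isDedekindDomain_integralClosure_adjoin (t : K) [FiniteDimensional k⟮t⟯ K]
    [Algebra.IsSeparable k⟮t⟯ K] :
    IsDedekindDomain (integralClosure (Algebra.adjoin k {t}) K) ∧
    IsFractionRing (integralClosure (Algebra.adjoin k {t}) K) K ∧
    Module.Finite (Algebra.adjoin k {t}) (integralClosure (Algebra.adjoin k {t}) K) :=
  ⟨integralClosure.isDedekindDomain (Algebra.adjoin k {t}) k⟮t⟯ K,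
    integralClosure.isFractionRing_of_finite_extension k⟮t⟯ K,
    IsIntegralClosure.finite (Algebra.adjoin k {t}) k⟮t⟯ K _⟩

/-- Nonzero elements of a finite field are roots of unity, hence integral over ℤ. -/
theorem algebraMap_mem_valuationSubring [Finite k] (A : ValuationSubring K) (c : k) :
    algebraMap k K c ∈ A := by
  by_cases hc : c = 0
  · rw [hc, map_zero]
    exact A.zero_mem
  refine mem_valuationSubring_of_isIntegralElem A (Int.castRingHom K) (fun b => intCast_mem A b) ?_
  have : Fintype k := Fintype.ofFinite k
  refine ⟨X ^ (Fintype.card k - 1) - 1, ?_, ?_⟩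
  · exact monic_X_pow_sub_C 1 (Nat.sub_ne_zero_of_lt Fintype.one_lt_card)
  · simp [← map_pow, FiniteField.pow_card_sub_one_eq_one c hc]

theorem mem_valuationSubring_of_isAlgebraic [Finite k] (A : ValuationSubring K) {x : K}
    (hx : IsAlgebraic k x) : x ∈ A :=
  mem_valuationSubring_of_isIntegralElem A (algebraMap k K) (algebraMap_mem_valuationSubring A)
    hx.isIntegral

theorem adjoin_le_valuationSubring [Finite k] (A : ValuationSubring K) {t : K} (ht : t ∈ A) {x : K}
    (hx : x ∈ Algebra.adjoin k {t}) : x ∈ A := by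
  obtain ⟨p, rfl⟩ := Algebra.adjoin_mem_exists_aeval k t hx
  rw [aeval_eq_sum_range]
  refine sum_mem fun i _ => ?_
  rw [Algebra.smul_def]
  exact mul_mem (algebraMap_mem_valuationSubring A _) (pow_mem ht i)

theorem integralClosure_adjoin_le_valuationSubring [Finite k] (A : ValuationSubring K) {t : K}
    (ht : t ∈ A) (x : integralClosure (Algebra.adjoin k {t}) K) : x.1 ∈ A :=
  mem_valuationSubring_of_isIntegralElem A (algebraMap (Algebra.adjoin k {t}) K)
    (fun b => adjoin_le_valuationSubring A ht b.2) x.2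

/-- A finitely generated extension of a perfect field has a separating transcendence basis. Here it
consists of exactly one element, because the transcendence degree is 1. Separability makes integral
closures finite over k[t]. -/
theorem exists_separating_transcendental (k : Type*) [Field k] [PerfectField k]
    [Algebra (RatFunc k) K]
    [Algebra k K] [IsScalarTower k (RatFunc k) K] [FiniteDimensional (RatFunc k) K] :
    ∃ t : K, Transcendental k t ∧ FiniteDimensional k⟮t⟯ K ∧ Algebra.IsSeparable k⟮t⟯ K := by
  have : FunctionField k K := ‹_›
  have : Algebra.EssFiniteType k[X] (RatFunc k) := .of_isLocalization _ (nonZeroDivisors k[X])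
  have : Algebra.EssFiniteType k (RatFunc k) := .comp k k[X] (RatFunc k)
  have : Algebra.EssFiniteType k K := .comp k (RatFunc k) K
  obtain ⟨s, hs, hsep⟩ := exists_isTranscendenceBasis_and_isSeparable_of_perfectField k K
  have hX : Transcendental k (algebraMap (RatFunc k) K RatFunc.X) := by
    rw [transcendental_algebraMap_iff (algebraMap (RatFunc k) K).injective]
    exact RatFunc.transcendental_X
  have hne : Nonempty s := by
    by_contra h
    rw [not_nonempty_iff] at h
    exact hX ((hs.isEmpty_iff_isAlgebraic.mp h).isAlgebraic _)
  obtain ⟨⟨t, ht⟩⟩ := hne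
  have htr : Transcendental k t := hs.1.transcendental ⟨t, ht⟩
  have hfin := FunctionField.finiteDimensional_of_adjoin_transcendental (F := k) htr
  refine ⟨t, htr, hfin, ?_⟩
  -- A second basis element would be transcendental over k(t), but K is finite over k(t).
  have hst : (s : Set K) = {t} := by
    refine Set.eq_singleton_iff_unique_mem.mpr ⟨ht, fun t' ht' => ?_⟩
    by_contra hne
    have h1 := hs.1.transcendental_adjoin (s := {⟨t, ht⟩}) (i := ⟨t', ht'⟩)
      (by simpa using hne)
    apply h1
    have h2 : IsAlgebraic k⟮t⟯ t' := Algebra.IsAlgebraic.isAlgebraic t'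
    rw [Set.image_singleton]
    exact isAlgebraic_adjoin_iff.mp h2
  rwa [hst] at hsep

end FunctionField
end SemiIntegral

end

noncomputable section

namespace SemiIntegral

section FunctionField

open Polynomial IntermediateField Filter
open scoped IntermediateField.algebraAdjoinAdjoin

variable {k : Type*} [Field k] {K : Type u} [Field K] [Algebra k K]

theorem adjoin_inv_eq (t : K) : k⟮t⁻¹⟯ = k⟮t⟯ := by
  apply le_antisymm
  · rw [adjoin_simple_le_iff]
    exact inv_mem (mem_adjoin_simple_self k t)
  · rw [adjoin_simple_le_iff]
    simpa using inv_mem (mem_adjoin_simple_self k t⁻¹)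

/-- A pole of t is a zero of t⁻¹, at a place containing the integral closure of k[t⁻¹]; that
Dedekind domain has only finitely many such places. -/
theorem eventually_mem_of_separating [Finite k] {t : K} (hfin : FiniteDimensional k⟮t⟯ K)
    (hsep : Algebra.IsSeparable k⟮t⟯ K) : ∀ᶠ v : Place K in cofinite, t ∈ v.1 := by
  by_cases ht0 : t = 0
  · exact .of_forall fun v => ht0 ▸ v.1.zero_mem
  have hfin' : FiniteDimensional k⟮t⁻¹⟯ K := by rwa [adjoin_inv_eq]
  have hsep' : Algebra.IsSeparable k⟮t⁻¹⟯ K := by rwa [adjoin_inv_eq]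
  obtain ⟨h1, h2, -⟩ := isDedekindDomain_integralClosure_adjoin (k := k) t⁻¹
  let c : integralClosure (Algebra.adjoin k {t⁻¹}) K :=
    algebraMap (Algebra.adjoin k {t⁻¹}) _ ⟨t⁻¹, Algebra.self_mem_adjoin_singleton k t⁻¹⟩
  have hc : c ≠ 0 := fun h => ht0 (inv_eq_zero.mp (congrArg Subtype.val h))
  refine (finite_places_valuation_lt_one (K := K) _ hc).eventually_cofinite_notMem.mono
    fun v hv => ?_
  by_contra ht
  have hinv : t⁻¹ ∈ v.1 := (v.1.mem_or_inv_mem t).resolve_left ht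
  refine hv ⟨fun c => integralClosure_adjoin_le_valuationSubring v.1 hinv c, ?_⟩
  change v.1.valuation t⁻¹ < 1
  rw [map_inv₀]
  exact inv_lt_one_of_one_lt₀
    (lt_of_not_ge fun h => ht ((ValuationSubring.valuation_le_one_iff _ _).mp h))

theorem finiteType_int_integralClosure_adjoin [Finite k] (t : K) [FiniteDimensional k⟮t⟯ K]
    [Algebra.IsSeparable k⟮t⟯ K] :
    Algebra.FiniteType ℤ (integralClosure (Algebra.adjoin k {t}) K) := by
  obtain ⟨-, -, h⟩ := isDedekindDomain_integralClosure_adjoin (k := k) t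
  have h1 : Algebra.FiniteType ℤ k := ⟨⟨Set.univ.toFinite.toFinset, by simp⟩⟩
  have h2 : Algebra.FiniteType k (Algebra.adjoin k {t}) :=
    (Subalgebra.fg_iff_finiteType _).mp ⟨{t}, by simp⟩
  have h3 : Algebra.FiniteType (Algebra.adjoin k {t})
    (integralClosure (Algebra.adjoin k {t}) K) := inferInstance
  have h4 : Algebra.FiniteType ℤ (Algebra.adjoin k {t}) := h1.trans h2
  exact h4.trans h3

end FunctionField

open Filter in
-- A common substitute for the ring of integers: the integral closure of 𝔽_p[t] for a separating t
-- in the function field case. Finite generation over ℤ reduces statements about all of C to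
-- finitely many elements of K.
theorem IsGlobalField.exists_dedekindDomain {K : Type u} [Field K] (hK : IsGlobalField K) :
    ∃ (C : Type u) (_ : CommRing C) (_ : Algebra C K), IsDedekindDomain C ∧ IsFractionRing C K ∧
      Algebra.FiniteType ℤ C ∧ ∀ᶠ v : Place K in cofinite, ∀ c : C, algebraMap C K c ∈ v.1 := by
  obtain h | ⟨p, hp, h, hfin⟩ := hK
  · refine ⟨NumberField.RingOfIntegers K, inferInstance, inferInstance, inferInstance,
      inferInstance, inferInstance, .of_forall fun v c => ?_⟩
    exact mem_valuationSubring_of_isIntegralElem v.1 (Int.castRingHom K)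
      (fun b => intCast_mem v.1 b) c.2
  · let : Algebra (ZMod p) K :=
      ((algebraMap (RatFunc (ZMod p)) K).comp (algebraMap (ZMod p) (RatFunc (ZMod p)))).toAlgebra
    have : IsScalarTower (ZMod p) (RatFunc (ZMod p)) K := .of_algebraMap_eq fun _ => rfl
    obtain ⟨t, -, hft, hst⟩ := exists_separating_transcendental (K := K) (ZMod p)
    obtain ⟨h1, h2, -⟩ := isDedekindDomain_integralClosure_adjoin (k := ZMod p) t
    refine ⟨integralClosure (Algebra.adjoin (ZMod p) {t}) K, inferInstance, inferInstance, h1, h2,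
      finiteType_int_integralClosure_adjoin t, ?_⟩
    exact (eventually_mem_of_separating hft hst).mono fun v hv c =>
      integralClosure_adjoin_le_valuationSubring v.1 hv c

open Filter in
theorem IsGlobalField.eventually_mem {K : Type u} [Field K] (hK : IsGlobalField K) (x : K) :
    ∀ᶠ v : Place K in cofinite, x ∈ v.1 := by
  obtain ⟨C, _, _, h1, h2, -, h⟩ := hK.exists_dedekindDomain
  exact eventually_mem_of_eventually_subset C h x

end SemiIntegral

end

/-! ### A dimension count giving a function with a single pole -/

noncomputable section

namespace SemiIntegral

section Dimension

variable {k V : Type*} [Field k] [AddCommGroup V] [Module k V]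

/-- The hypothesis says that no n elements of E are independent modulo M, so the image of E in V/M
has dimension at most n - 1. -/
theorem finrank_succ_le_of_exists_combination {n : ℕ} (E M : Submodule k V) [FiniteDimensional k E]
    (h : ∀ x : Fin n → V, (∀ i, x i ∈ E) → ∃ l : Fin n → k, l ≠ 0 ∧ ∑ i, l i • x i ∈ M) :
    Module.finrank k E + 1 ≤ Module.finrank k (E ⊓ M : Submodule k V) + n := by
  let f : E →ₗ[k] V ⧸ M := M.mkQ.comp E.subtype
  have hker : Module.finrank k (LinearMap.ker f) = Module.finrank k (E ⊓ M : Submodule k V) := by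
    have : (LinearMap.ker f).map E.subtype = E ⊓ M := by
      rw [LinearMap.ker_comp, Submodule.ker_mkQ, Submodule.map_comap_subtype]
    rw [← this]
    exact (Submodule.finrank_map_subtype_eq E _).symm
  have hrange : Module.finrank k (LinearMap.range f) < n := by
    by_contra! hn
    obtain ⟨g, hg⟩ := exists_linearIndependent_of_le_finrank hn
    choose e he using fun i => (g i).2
    obtain ⟨l, hl, hlM⟩ := h (fun i => (e i : V)) (fun i => (e i).2)
    apply hl
    funext i
    refine Fintype.linearIndependent_iff.mp hg l ?_ i
    apply Subtype.ext
    have h2 : f (∑ i, l i • e i) = 0 := by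
      rw [← LinearMap.mem_ker]
      change M.mkQ (E.subtype _) = 0
      rw [Submodule.mkQ_apply, Submodule.Quotient.mk_eq_zero]
      simpa using hlM
    rw [map_sum] at h2
    simpa [he] using h2
  have := LinearMap.finrank_range_add_finrank_ker f
  omega

end Dimension

section Relations

open Polynomial IntermediateField
open scoped IntermediateField.algebraAdjoinAdjoin

variable {k : Type*} [Field k] {K : Type u} [Field K] [Algebra k K]

/-- If all constant coefficients vanish, the relation can be divided by s, which lowers the degree
of the nonzero polynomial p i₀. This must stop. -/
theorem exists_polynomial_relation_coeff_zero_ne {ι : Type*} [Fintype ι] {s : K} (hs : s ≠ 0)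
    (c : ι → K) (i₀ : ι) (d : ℕ) (p : ι → k[X]) (hp : p i₀ ≠ 0) (hd : (p i₀).natDegree ≤ d)
    (hrel : ∑ i, aeval s (p i) * c i = 0) :
    ∃ q : ι → k[X], (∃ i, (q i).coeff 0 ≠ 0) ∧ ∑ i, aeval s (q i) * c i = 0 := by
  induction d generalizing p with
  | zero =>
    refine ⟨p, ⟨i₀, fun h => hp ?_⟩, hrel⟩
    rw [eq_C_of_natDegree_le_zero hd, h, C_0]
  | succ d ih =>
    by_cases hall : ∀ i, (p i).coeff 0 = 0
    · have hX : ∀ i, p i = divX (p i) * X := fun i => by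
        conv_lhs => rw [← divX_mul_X_add (p i), hall i, C_0, add_zero]
      refine ih (fun i => divX (p i)) (fun h => hp ?_) ?_ ?_
      · rw [hX, h, zero_mul]
      · rw [natDegree_divX_eq_natDegree_tsub_one]
        omega
      · refine mul_left_cancel₀ hs ?_
        rw [mul_zero, ← hrel, Finset.mul_sum]
        refine Finset.sum_congr rfl fun i _ => ?_
        conv_rhs => rw [hX i, map_mul, aeval_X]
        ring
    · push Not at hall
      exact ⟨p, hall, hrel⟩

/-- In other words, N/sN has dimension at most [K : k(s)] over k. More elements than this satisfy a
k[s]-linear relation, which may be assumed to have a nonzero constant coefficient; its reduction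
modulo s is the required combination. -/
theorem exists_combination_eq_mul {s : K} (hs : Transcendental k s) [FiniteDimensional k⟮s⟯ K]
    (N : Submodule k K) (hN : ∀ x ∈ N, s * x ∈ N) {ι : Type*} [Fintype ι]
    (hι : Module.finrank k⟮s⟯ K < Fintype.card ι)
    (c : ι → K) (hc : ∀ i, c i ∈ N) :
    ∃ l : ι → k, l ≠ 0 ∧ ∃ z ∈ N, ∑ i, l i • c i = s * z := by
  have hs0 : s ≠ 0 := fun h => hs (h ▸ isAlgebraic_zero)
  have hdep : ¬ LinearIndependent (Algebra.adjoin k {s}) c := by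
    intro h
    rw [LinearIndependent.iff_fractionRing (Algebra.adjoin k {s}) k⟮s⟯] at h
    exact absurd h.fintype_card_le_finrank (not_le.mpr hι)
  rw [Fintype.not_linearIndependent_iff] at hdep
  obtain ⟨g, hg, i₀, hi₀⟩ := hdep
  choose p hp using fun i => Algebra.adjoin_mem_exists_aeval k s (g i).2
  obtain ⟨q, ⟨i, hi⟩, hq⟩ := exists_polynomial_relation_coeff_zero_ne hs0 c i₀ _ p
    (fun h => hi₀ (Subtype.ext (by rw [← hp, h, map_zero]; rfl))) le_rfl (by
      rw [← hg]
      refine Finset.sum_congr rfl fun i _ => ?_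
      rw [hp, Algebra.smul_def]
      rfl)
  refine ⟨fun i => (q i).coeff 0, fun h => hi (congrFun h i),
    -∑ i, aeval s (divX (q i)) * c i, neg_mem (sum_mem fun i _ => ?_), ?_⟩
  · have hmul : ∀ r : k[X], ∀ x ∈ N, aeval s r * x ∈ N := by
      intro r x hx
      induction r using Polynomial.induction_on' with
      | add a b ha hb => rw [map_add, add_mul]; exact add_mem ha hb
      | monomial m a =>
        rw [aeval_monomial, mul_assoc, ← Algebra.smul_def]
        refine N.smul_mem a ?_
        induction m with
        | zero => simpa
        | succ m ihm => rw [pow_succ', mul_assoc]; exact hN _ ihm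
    exact hmul _ _ (hc i)
  · rw [mul_neg, ← sub_eq_zero, sub_neg_eq_add, Finset.mul_sum, ← Finset.sum_add_distrib, ← hq]
    refine Finset.sum_congr rfl fun i _ => ?_
    conv_rhs => rw [← divX_mul_X_add (q i), map_add, map_mul, aeval_X, aeval_C]
    rw [Algebra.smul_def]
    ring

end Relations

end SemiIntegral

end

noncomputable section

namespace SemiIntegral

section LocalParameter

open Polynomial IntermediateField IsDedekindDomain
open scoped IntermediateField.algebraAdjoinAdjoin

variable {k : Type*} [Field k] {K : Type u} [Field K] [Algebra k K]

theorem inv_notMem_of_valuation_lt_one {A : ValuationSubring K} {x : K} (hx : x ≠ 0)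
    (h : A.valuation x < 1) : x⁻¹ ∉ A := by
  rw [← ValuationSubring.valuation_le_one_iff, map_inv₀, not_le]
  exact (one_lt_inv₀ ((Valuation.pos_iff _).mpr hx)).mpr h

theorem transcendental_of_valuation_lt_one [Finite k] {A : ValuationSubring K} {x : K} (hx : x ≠ 0)
    (h : A.valuation x < 1) : Transcendental k x := fun hal =>
  inv_notMem_of_valuation_lt_one hx h (mem_valuationSubring_of_isAlgebraic A hal.inv)

/-- A function `s` vanishing at a place `v₀`, and a function `u` not vanishing at `v₀` such that
`u / s` is regular at the other zeros of `s`. -/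
theorem exists_local_parameter [Finite k] {t : K} (hfin : FiniteDimensional k⟮t⟯ K)
    (hsep : Algebra.IsSeparable k⟮t⟯ K) (v₀ : Place K) (ht : t ∈ v₀.1) :
    ∃ s u : K, s ≠ 0 ∧ v₀.1.valuation s < 1 ∧ v₀.1.valuation u = 1 ∧
      ∀ v : Place K, v ≠ v₀ → v.1.valuation s < 1 → u / s ∈ v.1 := by
  obtain ⟨h1, h2, -⟩ := isDedekindDomain_integralClosure_adjoin (k := k) t
  set C := integralClosure (Algebra.adjoin k {t}) K with hCdef
  obtain ⟨P₀, hP₀, hmem₀⟩ := Place.exists_eq_valuationSubringAtPrime C v₀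
    (fun c => integralClosure_adjoin_le_valuationSubring v₀.1 ht c)
  -- a monic polynomial `g` with `g(t) ∈ P₀`
  obtain ⟨g, hg, hg0, hgP⟩ : ∃ g : k[X], g.Monic ∧ 0 < g.natDegree ∧ ∃ h : _root_.IsIntegral _ _,
      (⟨aeval t g, h⟩ : C) ∈ P₀.asIdeal ∧ aeval t g ≠ 0 := by
    have hne : P₀.asIdeal.comap (algebraMap (Algebra.adjoin k {t}) C) ≠ ⊥ := by
      obtain ⟨x, hx, hx0⟩ := Submodule.exists_mem_ne_zero_of_ne_bot P₀.ne_bot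
      exact Ideal.comap_ne_bot_of_integral_mem hx0 hx
        (Algebra.IsIntegral.isIntegral (R := Algebra.adjoin k {t}) x)
    obtain ⟨⟨x, hxt⟩, hx, hx0⟩ := Submodule.exists_mem_ne_zero_of_ne_bot hne
    obtain ⟨g, rfl⟩ := Algebra.adjoin_mem_exists_aeval k t hxt
    have hx0' : aeval t g ≠ 0 := fun h => hx0 (Subtype.ext h)
    have hg0 : g ≠ 0 := fun h => hx0' (by rw [h, map_zero])
    have hlc : g.leadingCoeff⁻¹ ≠ 0 := inv_ne_zero (leadingCoeff_ne_zero.mpr hg0)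
    have hint : _root_.IsIntegral (Algebra.adjoin k {t}) (aeval t (g * Polynomial.C g.leadingCoeff⁻¹)) :=
      (algebraMap (Algebra.adjoin k {t}) C
        ⟨_, aeval_mem_adjoin_singleton k t (p := g * Polynomial.C g.leadingCoeff⁻¹)⟩).2
    have hmemP : (⟨_, hint⟩ : C) ∈ P₀.asIdeal := by
      have : (⟨_, hint⟩ : C) = algebraMap (Algebra.adjoin k {t}) C ⟨_, hxt⟩ *
          algebraMap (Algebra.adjoin k {t}) C (algebraMap k _ g.leadingCoeff⁻¹) := by
        apply Subtype.ext
        change aeval t _ = aeval t g * algebraMap k K _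
        rw [map_mul, aeval_C]
      rw [this]
      exact Ideal.mul_mem_right _ _ hx
    refine ⟨g * Polynomial.C g.leadingCoeff⁻¹, monic_mul_leadingCoeff_inv hg0, ?_, hint, hmemP, ?_⟩
    · rw [Nat.pos_iff_ne_zero]
      intro h0
      rw [(monic_mul_leadingCoeff_inv hg0).natDegree_eq_zero] at h0
      apply P₀.isPrime.ne_top
      rw [Ideal.eq_top_iff_one]
      have h3 : (1 : C) = ⟨_, hint⟩ := Subtype.ext (by
        change (1 : K) = aeval t (g * Polynomial.C g.leadingCoeff⁻¹)
        rw [h0, map_one])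
      rw [h3]
      exact hmemP
    · rw [map_mul, aeval_C]
      exact mul_ne_zero hx0' ((_root_.map_ne_zero _).mpr hlc)
  obtain ⟨hint, hsP, hs0⟩ := hgP
  set s : C := ⟨aeval t g, hint⟩ with hs
  have hs0' : s ≠ 0 := fun h => hs0 (congrArg Subtype.val h)
  have hspan : Ideal.span {s} ≠ 0 := by
    rw [Ne, Ideal.zero_eq_bot, Ideal.span_singleton_eq_bot]
    exact hs0'
  -- Write (s) as P₀ⁿ · Q with P₀ not dividing Q, and take u in Q outside P₀. At another prime P
  -- some c in P₀ⁿ is a unit, and cu is a multiple of s, so u/s is regular there.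
  obtain ⟨Q, hQ, hPQ⟩ := (FiniteMultiplicity.of_prime_left P₀.prime hspan).exists_eq_pow_mul_and_not_dvd
  rw [Ideal.dvd_iff_le] at hPQ
  obtain ⟨u, huQ, huP⟩ := SetLike.not_le_iff_exists.mp hPQ
  refine ⟨s, u, hs0, (hmem₀ s).mp hsP, ?_, fun v hv hvs => ?_⟩
  · refine le_antisymm ((ValuationSubring.valuation_le_one_iff _ _).mpr
      (integralClosure_adjoin_le_valuationSubring v₀.1 ht u)) (not_lt.mp fun h => huP ?_)
    exact (hmem₀ u).mpr h
  -- Since g is monic and nonconstant, t is integral over k[g(t)]. Hence every zero of s = g(t) is a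
  -- place containing t, and so is visible on C.
  · have htv : t ∈ v.1 := by
      have hsv : aeval t g ∈ v.1 := (ValuationSubring.valuation_le_one_iff _ _).mp hvs.le
      let φ : Algebra.adjoin k {aeval t g} →+* K := algebraMap _ K
      refine mem_valuationSubring_of_isIntegralElem v.1 φ
        (fun b => adjoin_le_valuationSubring v.1 hsv b.2) ?_
      refine ⟨g.map (algebraMap k _) -
        Polynomial.C ⟨aeval t g, Algebra.self_mem_adjoin_singleton k _⟩, ?_, ?_⟩
      · refine (hg.map _).sub_of_left (lt_of_le_of_lt degree_C_le ?_)
        rw [hg.degree_map]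
        exact natDegree_pos_iff_degree_pos.mp hg0
      · rw [eval₂_sub, eval₂_map, eval₂_C, sub_eq_zero]
        rfl
    have hCv : ∀ c : C, algebraMap C K c ∈ v.1 :=
      fun c => integralClosure_adjoin_le_valuationSubring v.1 htv c
    obtain ⟨P, hP, hmem⟩ := Place.exists_eq_valuationSubringAtPrime C v hCv
    have hPP₀ : P ≠ P₀ := by
      rintro rfl
      exact hv (Subtype.ext (hP.trans hP₀.symm))
    have hnle : ¬ P₀.asIdeal ^ multiplicity P₀.asIdeal (Ideal.span {s}) ≤ P.asIdeal := by
      intro hle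
      have := P.isPrime.le_of_pow_le hle
      exact hPP₀ (HeightOneSpectrum.ext
        (P₀.isMaximal.eq_of_le P.isPrime.ne_top this).symm)
    obtain ⟨c, hcP₀, hcP⟩ := SetLike.not_le_iff_exists.mp hnle
    obtain ⟨d, hd⟩ := Ideal.mem_span_singleton'.mp
      (hQ ▸ Ideal.mul_mem_mul hcP₀ huQ : c * u ∈ Ideal.span {s})
    have hc1 : v.1.valuation (algebraMap C K c) = 1 :=
      le_antisymm ((ValuationSubring.valuation_le_one_iff _ _).mpr (hCv c))
        (not_lt.mp fun h => hcP ((hmem c).mpr h))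
    have hc0 : (c : K) ≠ 0 := by
      intro h0
      apply hcP
      rw [show c = 0 from Subtype.ext h0]
      exact P.asIdeal.zero_mem
    have : (u : K) / s = (d : K) / c := by
      rw [div_eq_div_iff hs0 hc0]
      have := congrArg Subtype.val hd
      rw [mul_comm (u : K)]
      exact this.symm
    rw [this, ← ValuationSubring.valuation_le_one_iff, map_div₀, show v.1.valuation (c : K) = 1 from hc1,
      div_one, ValuationSubring.valuation_le_one_iff]
    exact hCv d

end LocalParameter

end SemiIntegral

end

noncomputable section

namespace SemiIntegral

section SinglePole

open Polynomial IntermediateField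
open scoped IntermediateField.algebraAdjoinAdjoin

variable {k : Type*} [Field k] {K : Type u} [Field K] [Algebra k K]

/-- The functions that are regular at all places in a set. -/
def regularAt (k : Type*) [Field k] [Finite k] {K : Type u} [Field K] [Algebra k K]
    (T : Set (Place K)) : Submodule k K where
  carrier := {x | ∀ v ∈ T, x ∈ v.1}
  add_mem' ha hb v hv := add_mem (ha v hv) (hb v hv)
  zero_mem' v _ := zero_mem v.1
  smul_mem' c x hx v hv := by
    rw [Algebra.smul_def]
    exact mul_mem (algebraMap_mem_valuationSubring v.1 c) (hx v hv)

variable [Finite k]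

theorem mul_mem_regularAt {T : Set (Place K)} {x y : K} (hx : x ∈ regularAt k T)
    (hy : y ∈ regularAt k T) : x * y ∈ regularAt k T :=
  fun v hv => mul_mem (hx v hv) (hy v hv)

theorem pow_mem_regularAt {T : Set (Place K)} {x : K} (hx : x ∈ regularAt k T) (n : ℕ) :
    x ^ n ∈ regularAt k T :=
  fun v hv => pow_mem (hx v hv) n

/-- The zeros of a function. -/
def zeros (s : K) : Set (Place K) := {v | v.1.valuation s < 1}

theorem self_mem_regularAt_zeros (s : K) : s ∈ regularAt k (zeros s) :=
  fun _ hv => (ValuationSubring.valuation_le_one_iff _ _).mp (le_of_lt hv)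

/-- The functions whose poles at the zeros of `s` other than `v₀`, and up to order `j` times that
of `s⁻¹` at `v₀`, are bounded. -/
def poleFiltration (k : Type*) [Field k] [Finite k] {K : Type u} [Field K] [Algebra k K]
    (s : K) (v₀ : Place K) (j : ℕ) : Submodule k K :=
  (regularAt k (zeros s)).map (LinearMap.mulLeft k (s⁻¹ ^ j)) ⊔ regularAt k (zeros s \ {v₀})

theorem regularAt_anti {T T' : Set (Place K)} (h : T ⊆ T') : regularAt k T' ≤ regularAt k T :=
  fun _ hx v hv => hx v (h hv)

theorem poleFiltration_zero (s : K) (v₀ : Place K) :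
    poleFiltration k s v₀ 0 = regularAt k (zeros s \ {v₀}) := by
  rw [poleFiltration, pow_zero, LinearMap.mulLeft_one, Submodule.map_id, sup_eq_right]
  exact regularAt_anti Set.sdiff_subset

/-- Write x i as s^{-(j+1)} c i + w i and add u^{j+1} to the c i, which gives one element more than
[K : k(s)]. A combination of these is divisible by s. Divided by s^{j+1}, the term in u becomes a
multiple of (u/s)^{j+1}, which is harmless away from v₀. Thus each step of the filtration costs at
most [K : k(s)] - 1 dimensions, and the saved 1 produces the desired function. -/
theorem exists_combination_mem_poleFiltration {s u : K} {v₀ : Place K} (hs0 : s ≠ 0)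
    (hsv : v₀.1.valuation s < 1) (huv : v₀.1.valuation u = 1)
    (hus : ∀ v : Place K, v ≠ v₀ → v.1.valuation s < 1 → u / s ∈ v.1)
    [FiniteDimensional k⟮s⟯ K] (j : ℕ) (x : Fin (Module.finrank k⟮s⟯ K) → K)
    (hx : ∀ i, x i ∈ poleFiltration k s v₀ (j + 1)) :
    ∃ l : Fin (Module.finrank k⟮s⟯ K) → k, l ≠ 0 ∧ ∑ i, l i • x i ∈ poleFiltration k s v₀ j := by
  have hs := transcendental_of_valuation_lt_one (k := k) hs0 hsv
  have hsC : s ∈ regularAt k (zeros s) := self_mem_regularAt_zeros s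
  have hw : u / s ∈ regularAt k (zeros s \ {v₀}) := fun v hv => hus v hv.2 hv.1
  have huC : u ∈ regularAt k (zeros s) := by
    intro v hv
    by_cases h : v = v₀
    · rw [h]
      exact (ValuationSubring.valuation_le_one_iff _ _).mp huv.le
    · have := mul_mem (hus v h hv) (hsC v hv)
      rwa [div_mul_cancel₀ _ hs0] at this
  have hdec : ∀ i, ∃ c ∈ regularAt k (zeros s), ∃ w ∈ regularAt k (zeros s \ {v₀}),
      s⁻¹ ^ (j + 1) * c + w = x i := by
    intro i
    obtain ⟨_, ⟨c, hc, rfl⟩, w, hw, h⟩ := Submodule.mem_sup.mp (hx i)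
    exact ⟨c, hc, w, hw, h⟩
  choose c hc w hw' hcw using hdec
  obtain ⟨l, hl, z, hz, hlz⟩ := exists_combination_eq_mul hs (regularAt k (zeros s))
    (fun x hx => mul_mem_regularAt hsC hx) (ι := Fin (Module.finrank k⟮s⟯ K + 1)) (by simp)
    (Fin.cons (u ^ (j + 1)) c) (fun i => by
      refine Fin.cases ?_ (fun i => ?_) i
      · exact pow_mem_regularAt huC _
      · exact hc i)
  rw [Fin.sum_univ_succ] at hlz
  simp only [Fin.cons_zero, Fin.cons_succ] at hlz
  refine ⟨fun i => l i.succ, fun h => ?_, ?_⟩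
  · have hl' : ∀ i : Fin (Module.finrank k⟮s⟯ K), l i.succ = 0 := fun i => congrFun h i
    -- If only the coefficient of u^{j+1} survived, then u would vanish at v₀.
    simp only [hl', zero_smul, Finset.sum_const_zero, add_zero] at hlz
    have hl0 : l 0 ≠ 0 := fun h0 => hl (funext fun i => Fin.cases h0 hl' i)
    have h1 : v₀.1.valuation (s * z) < 1 := by
      rw [map_mul]
      exact mul_lt_one_of_nonneg_of_lt_one_left zero_le hsv ((ValuationSubring.valuation_le_one_iff _ _).mpr (hz v₀ hsv))
    have h2 : u ^ (j + 1) = algebraMap k K (l 0)⁻¹ * (s * z) := by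
      rw [← hlz, Algebra.smul_def, ← mul_assoc, ← map_mul, inv_mul_cancel₀ hl0, map_one, one_mul]
    have h3 : v₀.1.valuation (u ^ (j + 1)) < 1 := by
      rw [h2, map_mul]
      exact mul_lt_one_of_nonneg_of_lt_one_right ((ValuationSubring.valuation_le_one_iff _ _).mpr
        (algebraMap_mem_valuationSubring _ _)) zero_le h1
    rw [map_pow, huv, one_pow] at h3
    exact lt_irrefl _ h3
  · have hsum : ∑ i, l i.succ • x i = s⁻¹ ^ j * z + (∑ i, l i.succ • w i -
        l 0 • (u / s) ^ (j + 1)) := by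
      have h1 : ∑ i, l i.succ • x i = s⁻¹ ^ (j + 1) * ∑ i, l i.succ • c i + ∑ i, l i.succ • w i := by
        rw [Finset.mul_sum, ← Finset.sum_add_distrib]
        refine Finset.sum_congr rfl fun i _ => ?_
        rw [← hcw i, smul_add, mul_smul_comm]
      have h2 : ∑ i : Fin (Module.finrank k⟮s⟯ K), l i.succ • c i =
          s * z - l 0 • u ^ (j + 1) := by rw [← hlz]; ring
      rw [h1, h2, mul_sub, mul_smul_comm, div_eq_mul_inv, mul_pow, mul_comm (u ^ (j + 1)), pow_succ,
        mul_assoc (s⁻¹ ^ j) s⁻¹ (s * z), inv_mul_cancel_left₀ hs0]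
      ring
    rw [hsum]
    refine Submodule.add_mem_sup ⟨z, hz, rfl⟩ (sub_mem (sum_mem fun i _ => ?_) ?_)
    · exact Submodule.smul_mem _ _ (hw' i)
    · exact Submodule.smul_mem _ _ (pow_mem_regularAt hw _)

/-- The bound for one step, summed over the j steps of the filtration. -/
theorem finrank_le_of_le_poleFiltration {s u : K} {v₀ : Place K} (hs0 : s ≠ 0)
    (hsv : v₀.1.valuation s < 1) (huv : v₀.1.valuation u = 1)
    (hus : ∀ v : Place K, v ≠ v₀ → v.1.valuation s < 1 → u / s ∈ v.1)
    [FiniteDimensional k⟮s⟯ K] (j : ℕ) (E : Submodule k K) [FiniteDimensional k E]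
    (hE : E ≤ poleFiltration k s v₀ j) :
    Module.finrank k E + j ≤ Module.finrank k (E ⊓ regularAt k (zeros s \ {v₀}) : Submodule k K) +
      Module.finrank k⟮s⟯ K * j := by
  induction j generalizing E with
  | zero =>
    rw [poleFiltration_zero] at hE
    rw [inf_eq_left.mpr hE]
    simp
  | succ j ih =>
    have h1 := finrank_succ_le_of_exists_combination E (poleFiltration k s v₀ j)
      (n := Module.finrank k⟮s⟯ K) fun x hx =>
        exists_combination_mem_poleFiltration hs0 hsv huv hus j x fun i => hE (hx i)
    have : FiniteDimensional k (E ⊓ poleFiltration k s v₀ j : Submodule k K) :=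
      Submodule.finiteDimensional_inf_left _ _
    have h2 := ih (E ⊓ poleFiltration k s v₀ j) inf_le_right
    have h3 : regularAt k (zeros s \ {v₀}) ≤ poleFiltration k s v₀ j := le_sup_right
    rw [inf_assoc, inf_eq_right.mpr h3] at h2
    rw [mul_add]
    omega

end SinglePole

end SemiIntegral

end

noncomputable section

namespace SemiIntegral

section SinglePole

open Polynomial IntermediateField
open scoped IntermediateField.algebraAdjoinAdjoin

variable {k : Type*} [Field k] {K : Type u} [Field K] [Algebra k K] [Finite k]

/-- Some g(s)b is integral over k[s]. Split off the power of s from g: the cofactor has nonzero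
constant term, so it is a unit at every zero of s. -/
theorem exists_pow_mul_mem_regularAt_zeros {s : K} (hs : Transcendental k s)
    [FiniteDimensional k⟮s⟯ K] (b : K) : ∃ c : ℕ, s ^ c * b ∈ regularAt k (zeros s) := by
  obtain ⟨⟨y, hy⟩, hy0, hyb⟩ := exists_integral_multiples (Algebra.adjoin k {s}) k⟮s⟯ {b}
  specialize hyb b (Finset.mem_singleton_self b)
  obtain ⟨g, rfl⟩ := Algebra.adjoin_mem_exists_aeval k s hy
  have hg0 : g ≠ 0 := by
    rintro rfl
    exact hy0 (Subtype.ext (map_zero _))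
  obtain ⟨q, hq, hq0⟩ := exists_eq_pow_rootMultiplicity_mul_and_not_dvd g hg0 0
  rw [C_0, sub_zero] at hq hq0
  refine ⟨g.rootMultiplicity 0, fun v hv => ?_⟩
  have hsv : s ∈ v.1 := (ValuationSubring.valuation_le_one_iff _ _).mp (le_of_lt hv)
  have hs0 : s ≠ 0 := fun h => hs (h ▸ isAlgebraic_zero)
  have hq1 : v.1.valuation (aeval s q) = 1 := by
    have hc0 : q.coeff 0 ≠ 0 := fun h => hq0 (X_dvd_iff.mpr h)
    have h1 : v.1.valuation (algebraMap k K (q.coeff 0)) = 1 := by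
      refine le_antisymm ((ValuationSubring.valuation_le_one_iff _ _).mpr
        (algebraMap_mem_valuationSubring _ _)) (not_lt.mp fun h => ?_)
      refine inv_notMem_of_valuation_lt_one ((_root_.map_ne_zero _).mpr hc0) h ?_
      rw [← map_inv₀]
      exact algebraMap_mem_valuationSubring _ _
    have h2 : v.1.valuation (s * aeval s (divX q)) < 1 := by
      rw [map_mul]
      exact mul_lt_one_of_nonneg_of_lt_one_left zero_le hv
        ((ValuationSubring.valuation_le_one_iff _ _).mpr
          (adjoin_le_valuationSubring v.1 hsv (aeval_mem_adjoin_singleton k s)))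
    have h3 : aeval s q = s * aeval s (divX q) + algebraMap k K (q.coeff 0) := by
      conv_lhs => rw [← divX_mul_X_add q, map_add, map_mul, aeval_X, aeval_C, mul_comm]
    rw [h3, Valuation.map_add_eq_of_lt_right _ (by rwa [h1]), h1]
  have hgb : aeval s g * b ∈ v.1 := integralClosure_adjoin_le_valuationSubring v.1 hsv
    ⟨aeval s g * b, hyb⟩
  rw [hq, map_mul, map_pow, aeval_X, mul_right_comm] at hgb
  rw [← ValuationSubring.valuation_le_one_iff] at hgb ⊢
  rwa [map_mul, hq1, mul_one] at hgb

/-- Too many independent constants would have a nontrivial combination divisible by s in the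
valuation ring of v₀. It would be nonzero and vanish at v₀, which makes it transcendental. -/
theorem finrank_le_of_isAlgebraic {s : K} {v₀ : Place K} (hs0 : s ≠ 0)
    (hsv : v₀.1.valuation s < 1) [FiniteDimensional k⟮s⟯ K] (E : Submodule k K)
    [FiniteDimensional k E] (hE : ∀ x ∈ E, IsAlgebraic k x) :
    Module.finrank k E ≤ Module.finrank k⟮s⟯ K := by
  have hs := transcendental_of_valuation_lt_one (k := k) hs0 hsv
  by_contra! hlt
  let b := Module.finBasis k E
  obtain ⟨l, hl, z, hz, hlz⟩ := exists_combination_eq_mul hs (regularAt k {v₀})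
    (fun x hx v hv => mul_mem (by
      rw [Set.mem_singleton_iff.mp hv]
      exact (ValuationSubring.valuation_le_one_iff _ _).mp hsv.le) (hx v hv))
    (ι := Fin (Module.finrank k E)) (by simpa using hlt)
    (fun i => (b i : K)) (fun i v _ => mem_valuationSubring_of_isAlgebraic v.1 (hE _ (b i).2))
  have hmem : ∑ i, l i • (b i : K) ∈ E := sum_mem fun i _ => E.smul_mem _ (b i).2
  have hne : ∑ i, l i • (b i : K) ≠ 0 := by
    intro h0
    apply hl
    funext i
    refine Fintype.linearIndependent_iff.mp b.linearIndependent l ?_ i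
    apply Subtype.ext
    simpa using h0
  refine transcendental_of_valuation_lt_one (k := k) (A := v₀.1) hne ?_ (hE _ hmem)
  rw [hlz, map_mul]
  exact mul_lt_one_of_nonneg_of_lt_one_left zero_le hsv
    ((ValuationSubring.valuation_le_one_iff _ _).mpr (hz v₀ rfl))

/-- Take the span E of the products s^{-l} b i with l < N, where b is a basis of K integral over
k[s⁻¹]. Elements of E have poles only at zeros of s. The count shows that those without poles at
zeros other than v₀ form a space of dimension growing like N, too large to consist of constants. -/
theorem exists_transcendental_mem_of_ne {s u : K} {v₀ : Place K} (hs0 : s ≠ 0)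
    (hsv : v₀.1.valuation s < 1) (huv : v₀.1.valuation u = 1)
    (hus : ∀ v : Place K, v ≠ v₀ → v.1.valuation s < 1 → u / s ∈ v.1)
    [FiniteDimensional k⟮s⟯ K] :
    ∃ f : K, Transcendental k f ∧ ∀ v : Place K, v ≠ v₀ → f ∈ v.1 := by
  have hs := transcendental_of_valuation_lt_one (k := k) hs0 hsv
  have hs' : Transcendental k s⁻¹ := fun h => hs (by simpa using h.inv)
  have : FiniteDimensional k⟮s⁻¹⟯ K := by rwa [adjoin_inv_eq]
  set n := Module.finrank k⟮s⟯ K with hn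
  obtain ⟨ι, b, hb⟩ := FiniteDimensional.exists_is_basis_integral (Algebra.adjoin k {s⁻¹}) k⟮s⁻¹⟯ K
  have hι : Fintype.card ι = n := by
    rw [hn, ← adjoin_inv_eq s]
    exact (Module.finrank_eq_card_basis b).symm
  choose c hc using fun i => exists_pow_mul_mem_regularAt_zeros hs (b i)
  obtain ⟨d, hd⟩ : ∃ d, ∀ i, c i ≤ d := ⟨Finset.univ.sup c, fun i => Finset.le_sup (Finset.mem_univ i)⟩
  -- The count gives dim E' ≥ nN + (N + d) - n(N + d) = N + d - nd. This must exceed n, the bound on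
  -- the dimension of a space of constants.
  obtain ⟨N, hN⟩ : ∃ N, N = n * d + n + 1 := ⟨_, rfl⟩
  let e : ι × Fin N → K := fun p => (s⁻¹) ^ (p.2 : ℕ) * b p.1
  have he : LinearIndependent k e := by
    let y : k⟮s⁻¹⟯ := AdjoinSimple.gen k s⁻¹
    have hy : Transcendental k y := by
      rw [← transcendental_algebraMap_iff (algebraMap k⟮s⁻¹⟯ K).injective]
      exact hs'
    have h1 : LinearIndependent k fun i : Fin N => y ^ (i : ℕ) :=
by
      have := ((basisMonomials k).linearIndependent.map' (aeval y).toLinearMap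
        (LinearMap.ker_eq_bot.mpr (transcendental_iff_injective.mp hy))).comp _
        (Fin.val_injective (n := N))
      have he : (fun i : Fin N => y ^ (i : ℕ)) =
          ((aeval (R := k) y).toLinearMap ∘ basisMonomials k) ∘ Fin.val := by
        funext i
        simp
      rw [he]
      exact this
    have h2 := (linearIndependent_smul h1 b.linearIndependent).comp
      (Equiv.prodComm ι (Fin N)) (Equiv.injective _)
    have he : e = (fun p : Fin N × ι => y ^ (p.1 : ℕ) • b p.2) ∘ Equiv.prodComm ι (Fin N) := by
      funext i
      simp [e, y, Algebra.smul_def]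
    rw [he]
    exact h2
  let E : Submodule k K := Submodule.span k (Set.range e)
  have hEfin : FiniteDimensional k E := FiniteDimensional.span_of_finite k (Set.finite_range e)
  have hErank : Module.finrank k E = n * N := by
    rw [finrank_span_eq_card he, Fintype.card_prod, hι, Fintype.card_fin]
  have hEle : E ≤ poleFiltration k s v₀ (N + d) := by
    rw [Submodule.span_le]
    rintro _ ⟨⟨i, l⟩, rfl⟩
    refine Submodule.mem_sup_left ⟨s ^ (N - l) * (s ^ (d - c i) * (s ^ c i * b i)), ?_, ?_⟩
    · have hsC := self_mem_regularAt_zeros (k := k) s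
      exact mul_mem_regularAt (pow_mem_regularAt hsC _)
        (mul_mem_regularAt (pow_mem_regularAt hsC _) (hc i))
    · change s⁻¹ ^ (N + d) * _ = s⁻¹ ^ (l : ℕ) * b i
      have h1 : s ^ N = s ^ (N - l) * s ^ (l : ℕ) := by rw [← pow_add, Nat.sub_add_cancel l.2.le]
      have h2 : s ^ d = s ^ (d - c i) * s ^ (c i) := by rw [← pow_add, Nat.sub_add_cancel (hd i)]
      rw [pow_add, inv_pow, inv_pow, inv_pow]
      field_simp
      rw [h1, h2]
      ring
  have hEint : ∀ x ∈ E, x ∈ integralClosure (Algebra.adjoin k {s⁻¹}) K := by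
    intro x hx
    induction hx using Submodule.span_induction with
    | mem x hx =>
      obtain ⟨⟨i, l⟩, rfl⟩ := hx
      exact mul_mem (pow_mem (algebraMap_mem (integralClosure (Algebra.adjoin k {s⁻¹}) K)
        (⟨s⁻¹, Algebra.self_mem_adjoin_singleton k s⁻¹⟩ : Algebra.adjoin k {s⁻¹})) _) (hb i)
    | zero => exact zero_mem _
    | add x y _ _ hx hy => exact add_mem hx hy
    | smul a x _ hx =>
      rw [Algebra.smul_def]
      exact mul_mem (algebraMap_mem (integralClosure (Algebra.adjoin k {s⁻¹}) K)
        (algebraMap k (Algebra.adjoin k {s⁻¹}) a)) hx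
  have hrank := finrank_le_of_le_poleFiltration hs0 hsv huv hus (N + d) E hEle
  set E' : Submodule k K := E ⊓ regularAt k (zeros s \ {v₀}) with hE'
  have : FiniteDimensional k E' := Submodule.finiteDimensional_inf_left _ _
  obtain ⟨f, hfE, hf⟩ : ∃ f ∈ E', Transcendental k f := by
    by_contra! hall
    have := finrank_le_of_isAlgebraic hs0 hsv E' fun x hx => not_not.mp (hall x hx)
    rw [hErank, ← hn, mul_add] at hrank
    rw [← hn] at this
    omega
  refine ⟨f, hf, fun v hv => ?_⟩
  by_cases hsv' : v.1.valuation s < 1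
  · exact hfE.2 v ⟨hsv', hv⟩
  · refine integralClosure_adjoin_le_valuationSubring v.1 ?_ ⟨f, hEint f hfE.1⟩
    rw [← ValuationSubring.valuation_le_one_iff, map_inv₀]
    exact inv_le_one_of_one_le₀ (not_lt.mp hsv')

end SinglePole

end SemiIntegral

end

/-! ### The field of fractions of the S-integers -/

noncomputable section

namespace SemiIntegral

section SIntegers

open Polynomial IntermediateField Filter
open scoped IntermediateField.algebraAdjoinAdjoin

variable {K : Type u} [Field K]

/-- For a number field the ring of integers lies in 𝒪_S and supplies the denominators; as places
here are non-archimedean, S may then be empty. For a function field take f with its only pole at a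
place of S: then k[f] lies in 𝒪_S, and x becomes integral over k[f] after multiplication by a
nonzero element of it. -/
theorem IsGlobalField.exists_mem_sIntegers_mul (hK : IsGlobalField K) {S : Set (Place K)}
    (hS' : CharZero K ∨ S.Nonempty) (x : K) :
    ∃ b ∈ sIntegers S, b ≠ 0 ∧ b * x ∈ sIntegers S := by
  obtain h | ⟨p, hp, h, hfin⟩ := hK
  · have hmem : ∀ y : NumberField.RingOfIntegers K, (y : K) ∈ sIntegers S := fun y v _ =>
      mem_valuationSubring_of_isIntegralElem v.1 (Int.castRingHom K)
        (fun b => intCast_mem v.1 b) y.2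
    obtain ⟨a, b, hb, rfl⟩ := IsFractionRing.div_surjective (A := NumberField.RingOfIntegers K) x
    have hb0 : (b : K) ≠ 0 := by simpa using nonZeroDivisors.ne_zero hb
    exact ⟨b, hmem b, hb0, by rw [mul_div_cancel₀ _ hb0]; exact hmem a⟩
  · let : Algebra (ZMod p) K :=
      ((algebraMap (RatFunc (ZMod p)) K).comp (algebraMap (ZMod p) (RatFunc (ZMod p)))).toAlgebra
    have : IsScalarTower (ZMod p) (RatFunc (ZMod p)) K := .of_algebraMap_eq fun _ => rfl
    have : FunctionField (ZMod p) K := ‹_›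
    obtain ⟨v₀, hv₀⟩ : S.Nonempty := hS'.resolve_left fun h0 => by
      have : CharP K p := charP_of_injective_algebraMap (algebraMap (ZMod p) K).injective p
      exact hp.out.ne_zero (CharP.eq K ‹CharP K p› (CharP.ofCharZero K))
    obtain ⟨t, ht, hft, hst⟩ := exists_separating_transcendental (K := K) (ZMod p)
    obtain ⟨s, u, hs0, hsv, huv, hus⟩ : ∃ s u : K, s ≠ 0 ∧ v₀.1.valuation s < 1 ∧
        v₀.1.valuation u = 1 ∧ ∀ v : Place K, v ≠ v₀ → v.1.valuation s < 1 → u / s ∈ v.1 := by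
      obtain htv | htv := v₀.1.mem_or_inv_mem t
      · exact exists_local_parameter hft hst v₀ htv
      · exact exists_local_parameter (k := ZMod p) (by rwa [adjoin_inv_eq]) (by rwa [adjoin_inv_eq])
          v₀ htv
    have hs : Transcendental (ZMod p) s := transcendental_of_valuation_lt_one hs0 hsv
    have : FiniteDimensional (ZMod p)⟮s⟯ K :=
      FunctionField.finiteDimensional_of_adjoin_transcendental (F := ZMod p) hs
    obtain ⟨f, hf, hfv⟩ := exists_transcendental_mem_of_ne (k := ZMod p) hs0 hsv huv hus
    have : FiniteDimensional (ZMod p)⟮f⟯ K :=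
      FunctionField.finiteDimensional_of_adjoin_transcendental (F := ZMod p) hf
    obtain ⟨⟨y, hy⟩, hy0, hyx⟩ :=
      exists_integral_multiples (Algebra.adjoin (ZMod p) {f}) (ZMod p)⟮f⟯ {x}
    have hfS : ∀ v ∉ S, f ∈ v.1 := fun v hv => hfv v fun h => hv (h ▸ hv₀)
    exact ⟨y, fun v hv => adjoin_le_valuationSubring v.1 (hfS v hv) hy,
      fun h => hy0 (Subtype.ext h), fun v hv =>
      integralClosure_adjoin_le_valuationSubring v.1 (hfS v hv)
        ⟨y * x, hyx x (Finset.mem_singleton_self x)⟩⟩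

theorem IsGlobalField.isFractionRing_sIntegers (hK : IsGlobalField K) {S : Set (Place K)}
    (hS' : CharZero K ∨ S.Nonempty) : IsFractionRing (sIntegers S) K := by
  refine IsFractionRing.of_field _ _ fun x => ?_
  obtain ⟨b, hb, hb0, hbx⟩ := hK.exists_mem_sIntegers_mul hS' x
  exact ⟨⟨_, hbx⟩, ⟨b, hb⟩, by
    change x = b * x / b
    field_simp⟩

theorem IsGlobalField.eventually_isDiscreteValuationRing (hK : IsGlobalField K) :
    ∀ᶠ v : Place K in cofinite, IsDiscreteValuationRing v.1 := by
  obtain ⟨C, _, _, h1, h2, -, h⟩ := hK.exists_dedekindDomain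
  exact h.mono fun v hv => v.isDiscreteValuationRing C hv

/-- For almost all `v`, the valuation ring of `v` is a localization of the ring of `S`-integers. -/
theorem IsGlobalField.eventually_exists_frac (hK : IsGlobalField K) (S : Set (Place K))
    [IsFractionRing (sIntegers S) K] :
    ∀ᶠ v : Place K in cofinite, v ∉ S → ∀ x ∈ v.1,
      ∃ a b : sIntegers S, v.1.valuation (b : K) = 1 ∧ x * b = a := by
  obtain ⟨C, _, _, h1, h2, ⟨G, hG⟩, h⟩ := hK.exists_dedekindDomain
  choose a b hb hab using fun x : K => IsFractionRing.div_surjective (A := sIntegers S) x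
  have hb0 : ∀ x, (b x : K) ≠ 0 := fun x h => nonZeroDivisors.ne_zero (hb x) (Subtype.ext h)
  -- Write each of the finitely many generators of C as a fraction over 𝒪_S, and discard the places
  -- where one of the denominators is not a unit. Fractions with unit denominators are stable under
  -- sums and products, so all of C is covered.
  have hb' : ∀ᶠ v : Place K in cofinite, ∀ c ∈ G, (b (algebraMap C K c) : K)⁻¹ ∈ v.1 := by
    rw [eventually_all_finset]
    exact fun c _ => hK.eventually_mem _
  filter_upwards [h, hb'] with v hv hbv hvS
  have hle : ∀ y : sIntegers S, v.1.valuation (y : K) ≤ 1 := fun y =>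
    (ValuationSubring.valuation_le_one_iff _ _).mpr (y.2 v hvS)
  have key : ∀ c : C, ∃ a b : sIntegers S, v.1.valuation (b : K) = 1 ∧
      algebraMap C K c * b = a := by
    intro c
    have hc : c ∈ Algebra.adjoin ℤ (G : Set C) := hG ▸ trivial
    induction hc using Algebra.adjoin_induction with
    | mem c hc =>
      refine ⟨a (algebraMap C K c), b (algebraMap C K c), le_antisymm (hle _) ?_, ?_⟩
      · have := (ValuationSubring.valuation_le_one_iff _ _).mpr (hbv c hc)
        rw [map_inv₀] at this
        exact (inv_le_one₀ ((Valuation.pos_iff _).mpr (hb0 _))).mp this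
      · have := hab (algebraMap C K c)
        change (a (algebraMap C K c) : K) / (b (algebraMap C K c) : K) = _ at this
        exact ((div_eq_iff (hb0 _)).mp this).symm
    | algebraMap n => exact ⟨n, 1, by simp, by simp⟩
    | add x y _ _ hx hy =>
      obtain ⟨a, b, h1, h2⟩ := hx
      obtain ⟨a', b', h1', h2'⟩ := hy
      refine ⟨a * b' + a' * b, b * b', by simp [h1, h1'], ?_⟩
      simp only [map_add, Subring.coe_add, Subring.coe_mul]
      rw [← h2, ← h2']
      ring
    | mul x y _ _ hx hy =>
      obtain ⟨a, b, h1, h2⟩ := hx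
      obtain ⟨a', b', h1', h2'⟩ := hy
      refine ⟨a * a', b * b', by simp [h1, h1'], ?_⟩
      simp only [map_mul, Subring.coe_mul]
      rw [← h2, ← h2']
      ring
  intro x hx
  obtain ⟨c, d, hd, rfl⟩ := Place.exists_frac C v hv hx
  obtain ⟨a, b, h1, h2⟩ := key c
  obtain ⟨a', b', h1', h2'⟩ := key d
  have hd0 : algebraMap C K d ≠ 0 := fun h0 => by simp [h0] at hd
  refine ⟨a * b', b * a', ?_, ?_⟩
  · rw [Subring.coe_mul, ← h2', map_mul, map_mul, h1, h1', hd]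
    simp
  · rw [Subring.coe_mul, Subring.coe_mul, ← h2, ← h2']
    field_simp

end SIntegers

end SemiIntegral

end

/-! ### Unramified places in a finite separable extension -/

noncomputable section

namespace SemiIntegral

section Extensions

attribute [local instance] FractionRing.liftAlgebra FractionRing.isScalarTower_liftAlgebra

open Filter

variable {K : Type u} [Field K] {L : Type u} [Field L] [Algebra K L]

theorem Place.LiesOver.mem_iff {w : Place L} {v : Place K} (h : w.LiesOver v) (x : K) :
    algebraMap K L x ∈ w.1 ↔ x ∈ v.1 := by
  rw [← h]; rfl

theorem Place.LiesOver.valuation_le_iff {w : Place L} {v : Place K} (h : w.LiesOver v) (x y : K) :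
    w.1.valuation (algebraMap K L x) ≤ w.1.valuation (algebraMap K L y) ↔
      v.1.valuation x ≤ v.1.valuation y := by
  have := hasExtension_of_liesOver h
  exact Valuation.HasExtension.val_map_le_iff v.1.valuation w.1.valuation x y

theorem Place.LiesOver.valuation_lt_one_iff {w : Place L} {v : Place K} (h : w.LiesOver v) (x : K) :
    w.1.valuation (algebraMap K L x) < 1 ↔ v.1.valuation x < 1 := by
  have := hasExtension_of_liesOver h
  exact Valuation.HasExtension.val_map_lt_one_iff v.1.valuation w.1.valuation x

/-- Almost all places are unramified in a finite separable extension. -/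
theorem IsGlobalField.eventually_exists_uniformizer (hK : IsGlobalField K)
    [FiniteDimensional K L] [Algebra.IsSeparable K L] :
    ∀ᶠ v : Place K in cofinite, ∃ π : K, π ≠ 0 ∧ v.1.valuation π < 1 ∧
      (∀ a : K, v.1.valuation a < 1 → v.1.valuation a ≤ v.1.valuation π) ∧
      ∀ w : Place L, w.LiesOver v → IsDiscreteValuationRing w.1 ∧ ∀ x : L, w.1.valuation x < 1 →
        w.1.valuation x ≤ w.1.valuation (algebraMap K L π) := by
  obtain ⟨C, _, _, h1, h2, -, h⟩ := hK.exists_dedekindDomain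
  let : Algebra C L := ((algebraMap K L).comp (algebraMap C K)).toAlgebra
  have : IsScalarTower C K L := .of_algebraMap_eq fun _ => rfl
  have : FaithfulSMul C L := (faithfulSMul_iff_algebraMap_injective C L).mpr
    ((algebraMap K L).injective.comp (IsFractionRing.injective C K))
  let D := integralClosure C L
  have hD : IsDedekindDomain D := integralClosure.isDedekindDomain C K L
  have hDL : IsFractionRing D L := integralClosure.isFractionRing_of_finite_extension K L
  have : Module.Finite C D := IsIntegralClosure.finite C K L D
  have : FaithfulSMul C D := (faithfulSMul_iff_algebraMap_injective C D).mpr fun x y hxy =>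
    FaithfulSMul.algebraMap_injective C L (congrArg (algebraMap D L) hxy)
  have : Algebra.IsSeparable (FractionRing C) (FractionRing D) := by
    refine Algebra.IsSeparable.of_equiv_equiv (FractionRing.algEquiv C K).symm.toRingEquiv
      (FractionRing.algEquiv D L).symm.toRingEquiv ?_
    ext x
    exact IsFractionRing.algEquiv_commutes (FractionRing.algEquiv C K).symm
      (FractionRing.algEquiv D L).symm _
  have hdiff := differentIdeal_ne_bot (A := C) (B := D)
  -- The different is nonzero by separability, so it contains a nonzero c from the base. Places at
  -- which c is a unit are unramified.
  obtain ⟨c, hcd, hc0⟩ : ∃ c : C, algebraMap C D c ∈ differentIdeal C D ∧ c ≠ 0 := by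
    by_contra! hall
    apply hdiff
    refine Ideal.eq_bot_of_comap_eq_bot (R := C) ((Submodule.eq_bot_iff _).mpr hall)
  filter_upwards [h, hK.eventually_mem (algebraMap C K c)⁻¹] with v hv hcv
  have hdvr := v.isDiscreteValuationRing C hv
  obtain ⟨ϖ, hϖ⟩ := IsDiscreteValuationRing.exists_irreducible v.1
  have hϖ' : ∀ a : K, v.1.valuation a < 1 → v.1.valuation a ≤ v.1.valuation (ϖ : K) := by
    intro a ha
    have ham : (⟨a, (ValuationSubring.valuation_le_one_iff _ _).mp ha.le⟩ : v.1) ∈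
        IsLocalRing.maximalIdeal v.1 := (ValuationSubring.valuation_lt_one_iff v.1 _).mpr ha
    rw [hϖ.maximalIdeal_eq, Ideal.mem_span_singleton] at ham
    obtain ⟨b, hb⟩ := ham
    have hb' : a = ϖ * b := congrArg Subtype.val hb
    rw [hb', map_mul]
    exact mul_le_of_le_one_right' (ValuationSubring.valuation_le_one _ b)
  refine ⟨ϖ, fun h0 => hϖ.ne_zero (Subtype.ext h0),
    (ValuationSubring.valuation_lt_one_iff v.1 _).mp
      ((IsLocalRing.mem_maximalIdeal _).mpr hϖ.not_isUnit), hϖ', fun w hw => ?_⟩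
  have hDw : ∀ d : D, algebraMap D L d ∈ w.1 := fun d =>
    mem_valuationSubring_of_isIntegralElem w.1 (algebraMap C L)
      (fun b => (hw.mem_iff _).mpr (hv b)) d.2
  obtain ⟨Q, hQ, hQmem⟩ := Place.exists_eq_valuationSubringAtPrime D w hDw
  have hQc : algebraMap C D c ∉ Q.asIdeal := by
    rw [hQmem]
    change ¬ w.1.valuation (algebraMap K L (algebraMap C K c)) < 1
    rw [hw.valuation_lt_one_iff]
    exact fun hlt => inv_notMem_of_valuation_lt_one
      ((map_ne_zero_iff _ (IsFractionRing.injective C K)).mpr hc0) hlt hcv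
  have hunr : Algebra.IsUnramifiedAt C Q.asIdeal := not_dvd_differentIdeal_iff.mp fun hdvd =>
    hQc (Ideal.dvd_iff_le.mp hdvd hcd)
  let P : Ideal C := Q.asIdeal.under C
  let := Localization.AtPrime.algebraOfLiesOver P Q.asIdeal
  have hmap := ((Algebra.isUnramifiedAt_iff_map_eq C P Q.asIdeal).mp hunr).2
  let g : Localization.AtPrime Q.asIdeal →+* w.1 :=
    IsLocalization.lift (M := Q.asIdeal.primeCompl)
      (g := (algebraMap D L).codRestrict w.1.toSubring hDw) (fun y => by
        by_contra hy
        exact y.2 ((hQmem _).mpr ((ValuationSubring.valuation_lt_one_iff w.1 _).mp hy)))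
  have hg : ∀ d : D, (g (algebraMap D _ d) : L) = algebraMap D L d := fun d =>
    congrArg Subtype.val (IsLocalization.lift_eq _ _)
  -- Unramifiedness says that the maximal ideal of the local ring at Q is generated by P, whose
  -- elements have valuation at most that of ϖ.
  have key : ∀ y ∈ IsLocalRing.maximalIdeal (Localization.AtPrime Q.asIdeal),
      w.1.valuation (g y : L) ≤ w.1.valuation (algebraMap K L ϖ) := by
    intro y hy
    rw [← hmap] at hy
    induction hy using Submodule.span_induction with
    | mem y hy =>
      obtain ⟨a, ha, rfl⟩ := hy
      rw [IsScalarTower.algebraMap_apply C D, hg]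
      change w.1.valuation (algebraMap K L (algebraMap C K a)) ≤ _
      rw [hw.valuation_le_iff]
      refine hϖ' _ ?_
      rw [← hw.valuation_lt_one_iff]
      exact (hQmem _).mp ha
    | zero => simp
    | add x y _ _ hx hy =>
      rw [map_add]
      exact (Valuation.map_add _ _ _).trans (max_le hx hy)
    | smul a x _ hx =>
      rw [smul_eq_mul, map_mul]
      change w.1.valuation ((g a : L) * g x) ≤ _
      rw [map_mul]
      exact (mul_le_of_le_one_left' (ValuationSubring.valuation_le_one _ _)).trans hx
  refine ⟨w.isDiscreteValuationRing D hDw, fun x hx => ?_⟩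
  obtain ⟨a, b, hb, rfl⟩ := Place.exists_frac D w hDw
    ((ValuationSubring.valuation_le_one_iff _ _).mp hx.le)
  rw [map_div₀, hb, div_one] at hx ⊢
  rw [← hg]
  exact key _ ((IsLocalization.AtPrime.to_map_mem_maximal_iff _ Q.asIdeal _).mpr ((hQmem _).mpr hx))

end Extensions

end SemiIntegral

end

/-! ### Completions -/

noncomputable section

namespace SemiIntegral

section Completion

variable {K : Type u} [Field K] (v : Place K)

theorem denseRange_toCompl : DenseRange (toCompl v) := by
  have h : DenseRange (UniformSpace.Completion.coeRingHom :
      WithVal v.1.valuation →+* Compl v) := UniformSpace.Completion.denseRange_coe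
  exact h.comp (WithVal.equiv v.1.valuation).symm.surjective.denseRange
    (UniformSpace.Completion.continuous_coe _)

theorem exists_valued_sub_toCompl_lt_one (x : Compl v) :
    ∃ a : K, (Valued.v (toCompl v a - x) : v.1.ValueGroup) < 1 := by
  have h : IsOpen {y : Compl v | (Valued.v y : v.1.ValueGroup) < 1} := by
    have := Valued.isOpen_ball (R := Compl v) (Γ₀ := v.1.ValueGroup) 1
    simpa only [Valuation.restrict_lt_one_iff] using this
  have h2 : IsOpen {y : Compl v | (Valued.v (y - x) : v.1.ValueGroup) < 1} :=
    h.preimage (continuous_sub_right x)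
  obtain ⟨_, hy, a, rfl⟩ := (denseRange_toCompl v).inter_open_nonempty _ h2 ⟨x, by simp⟩
  exact ⟨a, hy⟩

/-- Spheres are open and K is dense, so completion adds no new values. -/
theorem exists_valued_eq (x : Compl v) :
    ∃ a : K, (Valued.v x : v.1.ValueGroup) = v.1.valuation a := by
  by_cases hx : x = 0
  · exact ⟨0, by simp [hx]⟩
  · have hx' : (Valued.v : Valuation (Compl v) v.1.ValueGroup).restrict x ≠ 0 := by
      rwa [Valuation.ne_zero_iff]
    obtain ⟨_, hy, a, rfl⟩ := (denseRange_toCompl v).inter_open_nonempty _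
      (Valued.isOpen_sphere (R := Compl v) hx') ⟨x, rfl⟩
    refine ⟨a, ?_⟩
    rw [← valued_toCompl]
    have hy' : (Valued.v : Valuation (Compl v) v.1.ValueGroup).restrict (toCompl v a) =
      (Valued.v : Valuation (Compl v) v.1.ValueGroup).restrict x := hy
    exact ((Valuation.restrict_inj _).mp hy').symm

theorem complIntegers_mem_maximalIdeal {x : complIntegers v} :
    x ∈ IsLocalRing.maximalIdeal (complIntegers v) ↔
      (Valued.v (x : Compl v) : v.1.ValueGroup) < 1 :=
  Valuation.mem_maximalIdeal_iff _ _

theorem complIntegers_dvd_iff {x y : complIntegers v} :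
    x ∣ y ↔ (Valued.v (y : Compl v) : v.1.ValueGroup) ≤ Valued.v (x : Compl v) :=
  (Valuation.integer.integers (Valued.v : Valuation (Compl v) v.1.ValueGroup)).dvd_iff_le

/-- The embedding of the valuation ring of `v` into the ring of integers of the completion. -/
def toComplIntegers : v.1 →+* complIntegers v :=
  ((toCompl v).comp v.1.subtype).codRestrict (complIntegers v).toSubring fun x => by
    change Valued.v (toCompl v x.1) ≤ 1
    rw [valued_toCompl, ValuationSubring.valuation_le_one_iff]
    exact x.2

theorem exists_sub_toComplIntegers_mem_maximalIdeal (x : complIntegers v) :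
    ∃ a : v.1, x - toComplIntegers v a ∈ IsLocalRing.maximalIdeal (complIntegers v) := by
  obtain ⟨a, ha⟩ := exists_valued_sub_toCompl_lt_one v x
  have hx : (Valued.v (x : Compl v) : v.1.ValueGroup) ≤ 1 := x.2
  have ha' : a ∈ v.1 := by
    rw [← ValuationSubring.valuation_le_one_iff, ← valued_toCompl, ← sub_add_cancel (toCompl v a) x]
    exact (Valuation.map_add _ _ _).trans (max_le ha.le hx)
  refine ⟨⟨a, ha'⟩, ?_⟩
  rw [complIntegers_mem_maximalIdeal, ← Valuation.map_neg]
  convert ha using 2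
  exact neg_sub _ _

/-- The values on 𝒪_v are those on the valuation ring of v, namely 0 and the powers of the value of
ϖ; divisibility in 𝒪_v is comparison of values. -/
theorem isDiscreteValuationRing_complIntegers [IsDiscreteValuationRing v.1] :
    IsDiscreteValuationRing (complIntegers v) := by
  obtain ⟨ϖ, hϖ⟩ := IsDiscreteValuationRing.exists_irreducible v.1
  have hlt : v.1.valuation (ϖ : K) < 1 := (ValuationSubring.valuation_lt_one_iff v.1 _).mp
      ((IsLocalRing.mem_maximalIdeal _).mpr hϖ.not_isUnit)
  have hval : ∀ x : complIntegers v, x ≠ 0 → ∃ n : ℕ,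
      (Valued.v (x : Compl v) : v.1.ValueGroup) = v.1.valuation (ϖ : K) ^ n := by
    intro x hx
    obtain ⟨a, ha⟩ := exists_valued_eq v x
    have ham : a ∈ v.1 := by
      rw [← ValuationSubring.valuation_le_one_iff, ← ha]
      exact x.2
    have ha0 : (⟨a, ham⟩ : v.1) ≠ 0 := by
      intro h
      have h0 : a = 0 := congrArg Subtype.val h
      rw [h0, map_zero, Valuation.zero_iff] at ha
      exact hx (Subtype.ext ha)
    obtain ⟨n, u, hu⟩ := IsDiscreteValuationRing.eq_unit_mul_pow_irreducible ha0 hϖ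
    have hu' : a = u * (ϖ : K) ^ n := congrArg Subtype.val hu
    refine ⟨n, ?_⟩
    rw [ha, hu', map_mul, map_pow, (ValuationSubring.valuation_eq_one_iff v.1 _).mp u.isUnit,
      one_mul]
  have hϖv : (Valued.v (toComplIntegers v ϖ : Compl v) : v.1.ValueGroup) =
    v.1.valuation (ϖ : K) := valued_toCompl v _
  have hϖm := (complIntegers_mem_maximalIdeal v).mpr (hϖv.trans_lt hlt)
  have hϖ0 : v.1.valuation (ϖ : K) ≠ 0 := by
    rw [Valuation.ne_zero_iff]
    exact fun h => hϖ.ne_zero (Subtype.ext h)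
  refine IsDiscreteValuationRing.ofHasUnitMulPowIrreducibleFactorization
    ⟨toComplIntegers v ϖ, ⟨(IsLocalRing.mem_maximalIdeal _).mp hϖm, ?_⟩, ?_⟩
  · intro a b hab
    by_contra! hcon
    have key : ∀ a : complIntegers v, ¬ IsUnit a →
        (Valued.v (a : Compl v) : v.1.ValueGroup) ≤ v.1.valuation (ϖ : K) := by
      intro a ha
      by_cases ha0 : a = 0
      · simp [ha0]
      obtain ⟨n, hn⟩ := hval a ha0
      have hlt1 := (complIntegers_mem_maximalIdeal v).mp ((IsLocalRing.mem_maximalIdeal _).mpr ha)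
      have hn0 : n ≠ 0 := by
        rintro rfl
        rw [hn, pow_zero] at hlt1
        exact lt_irrefl _ hlt1
      rw [hn]
      exact pow_le_of_le_one zero_le hlt.le hn0
    have h1 : (Valued.v (toComplIntegers v ϖ : Compl v) : v.1.ValueGroup) =
        Valued.v (a : Compl v) * Valued.v (b : Compl v) := by
      rw [hab, ← map_mul]
      rfl
    rw [hϖv] at h1
    have h2 := mul_le_mul' (key a hcon.1) (key b hcon.2)
    rw [← h1] at h2
    exact absurd h2 (not_le.mpr (mul_lt_of_lt_one_left (zero_lt_iff.mpr hϖ0) hlt))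
  · intro x hx
    obtain ⟨n, hn⟩ := hval x hx
    refine ⟨n, associated_of_dvd_dvd ?_ ?_⟩ <;> rw [complIntegers_dvd_iff]
    · rw [hn, ← hϖv]
      exact (map_pow Valued.v (toComplIntegers v ϖ : Compl v) n).ge
    · rw [hn, ← hϖv]
      exact (map_pow Valued.v (toComplIntegers v ϖ : Compl v) n).le

variable {v}

theorem maximalIdeal_complIntegers_eq_span {π : v.1} (hlt : v.1.valuation (π : K) < 1)
    (hmax : ∀ a : K, v.1.valuation a < 1 → v.1.valuation a ≤ v.1.valuation (π : K)) :
    IsLocalRing.maximalIdeal (complIntegers v) = Ideal.span {toComplIntegers v π} := by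
  have hv : (Valued.v (toComplIntegers v π : Compl v) : v.1.ValueGroup) =
    v.1.valuation (π : K) := valued_toCompl v _
  ext x
  rw [Ideal.mem_span_singleton, complIntegers_dvd_iff, complIntegers_mem_maximalIdeal, hv]
  obtain ⟨a, ha⟩ := exists_valued_eq v x
  rw [ha]
  exact ⟨hmax a, fun h => h.trans_lt hlt⟩

/-- One element π generates both maximal ideals. This is the form in which unramifiedness is used:
multiplicities over 𝒪_v and 𝒪_w agree. -/
theorem map_maximalIdeal_complIntegersMap {L : Type u} [Field L] [Algebra K L]
    [Algebra.IsAlgebraic K L] {w : Place L} (h : w.LiesOver v) {π : K}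
    (hlt : v.1.valuation π < 1)
    (hmax : ∀ a : K, v.1.valuation a < 1 → v.1.valuation a ≤ v.1.valuation π)
    (hmax' : ∀ a : L, w.1.valuation a < 1 →
      w.1.valuation a ≤ w.1.valuation (algebraMap K L π)) :
    (IsLocalRing.maximalIdeal (complIntegers v)).map (complIntegersMap h) =
      IsLocalRing.maximalIdeal (complIntegers w) := by
  have hπ : π ∈ v.1 := (ValuationSubring.valuation_le_one_iff _ _).mp hlt.le
  have hπ' : algebraMap K L π ∈ w.1 := (h.mem_iff π).mpr hπ
  rw [maximalIdeal_complIntegers_eq_span (π := ⟨π, hπ⟩) hlt hmax,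
    maximalIdeal_complIntegers_eq_span (π := ⟨algebraMap K L π, hπ'⟩)
      ((h.valuation_lt_one_iff π).mpr hlt) hmax', Ideal.map_span, Set.image_singleton]
  congr 2
  exact Subtype.ext (complMap_toCompl h π)

end Completion
end SemiIntegral

end

/-! ### Ideal sheaves on affine schemes -/

noncomputable section

namespace SemiIntegral

section SpecIdeal

open Scheme

/-- Ideal sheaves on `Spec A` are the ideals of `A`. -/
def specIdeal (A : CommRingCat.{u}) : (Spec A).IdealSheafData ≃o Ideal A where
  toFun Z := (Z.ideal ⟨⊤, isAffineOpen_top _⟩).comap (Scheme.ΓSpecIso A).inv.hom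
  invFun J := IdealSheafData.ofIdealTop (J.comap (Scheme.ΓSpecIso A).hom.hom)
  left_inv Z := IdealSheafData.ext_of_isAffine (by
    simp [Ideal.comap_comap, ← CommRingCat.hom_comp])
  right_inv J := by
    simp [Ideal.comap_comap, ← CommRingCat.hom_comp]
  map_rel_iff' {Z Z'} := by
    refine ⟨fun h => IdealSheafData.le_of_isAffine fun x hx => ?_, fun h => Ideal.comap_mono (h _)⟩
    have h1 : (Scheme.ΓSpecIso A).hom.hom x ∈
        (Z.ideal ⟨⊤, isAffineOpen_top _⟩).comap (Scheme.ΓSpecIso A).inv.hom := by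
      rw [Ideal.mem_comap]
      simpa [← CommRingCat.comp_apply] using hx
    simpa [← CommRingCat.comp_apply] using h h1

theorem specIdeal_map {A B : CommRingCat.{u}} (φ : A ⟶ B) (Z : (Spec B).IdealSheafData) :
    specIdeal A (Z.map (Spec.map φ)) = (specIdeal B Z).comap φ.hom := by
  change Ideal.comap _ ((Z.map (Spec.map φ)).ideal ⟨⊤, isAffineOpen_top _⟩) = _
  rw [IdealSheafData.ideal_map_of_isAffineHom]
  ext a
  change (Spec.map φ).appTop.hom ((Scheme.ΓSpecIso A).inv.hom a) ∈ Z.ideal ⟨⊤, _⟩ ↔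
    (Scheme.ΓSpecIso B).inv.hom (φ.hom a) ∈ Z.ideal ⟨⊤, _⟩
  rw [← CommRingCat.comp_apply, ← CommRingCat.comp_apply, Scheme.ΓSpecIso_inv_naturality]

/-- Pullback is left adjoint to pushforward for ideal sheaves, as extension is to contraction for
ideals, so this follows from `specIdeal_map`. -/
theorem specIdeal_comap {A B : CommRingCat.{u}} (φ : A ⟶ B) (Z : (Spec A).IdealSheafData) :
    specIdeal B (Z.comap (Spec.map φ)) = (specIdeal A Z).map φ.hom := by
  refine eq_of_forall_ge_iff fun J => ?_
  rw [Ideal.map_le_iff_le_comap, ← (specIdeal B).apply_symm_apply J, ← specIdeal_map,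
    OrderIso.le_iff_le, OrderIso.le_iff_le, IdealSheafData.le_map_iff_comap_le]

theorem coe_support_eq_zeroLocus_specIdeal {A : CommRingCat.{u}} (Z : (Spec A).IdealSheafData) :
    (Z.support : Set (Spec A)) = PrimeSpectrum.zeroLocus (specIdeal A Z : Set A) := by
  have h := Z.coe_support_inter ⟨⊤, isAffineOpen_top _⟩
  simp only [Opens.coe_top, Set.inter_univ] at h
  rw [h]
  ext x
  rw [Scheme.mem_zeroLocus_iff]
  change _ ↔ (specIdeal A Z : Set A) ⊆ PrimeSpectrum.asIdeal x
  constructor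
  · intro hx a ha
    have := hx _ ha
    rw [basicOpen_eq_of_affine] at this
    exact not_not.mp this
  · intro hx f hf
    obtain ⟨a, rfl⟩ : ∃ a, (Scheme.ΓSpecIso A).inv.hom a = f :=
      ⟨(Scheme.ΓSpecIso A).hom.hom f, by simp⟩
    rw [basicOpen_eq_of_affine]
    exact not_not.mpr (hx hf)

theorem specIdeal_vanishingIdeal {A : CommRingCat.{u}} (T : Closeds (Spec A)) :
    specIdeal A (.vanishingIdeal T) = PrimeSpectrum.vanishingIdeal (T : Set (Spec A)) := by
  have h1 : (specIdeal A (.vanishingIdeal T)).IsRadical := by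
    refine Ideal.IsRadical.comap _ ?_
    rw [IdealSheafData.vanishingIdeal_ideal]
    exact PrimeSpectrum.isRadical_vanishingIdeal _
  rw [← h1.radical, ← PrimeSpectrum.vanishingIdeal_zeroLocus_eq_radical,
    ← coe_support_eq_zeroLocus_specIdeal, IdealSheafData.coe_support_vanishingIdeal]

/-- Contraction along an isomorphism of sections keeps an ideal radical. A general pullback of a
reduced subscheme need not be reduced, hence the restriction to open immersions. -/
theorem comap_vanishingIdeal_of_isOpenImmersion {X Y : Scheme.{u}} (j : X ⟶ Y)
    [IsOpenImmersion j] (T : Closeds Y) :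
    (IdealSheafData.vanishingIdeal T).comap j = .vanishingIdeal (T.preimage j.continuous) := by
  have h : ((IdealSheafData.vanishingIdeal T).comap j).support = T.preimage j.continuous := by
    rw [IdealSheafData.support_comap]
    congr 1
  rw [← h, IdealSheafData.vanishingIdeal_support]
  ext U : 2
  rw [IdealSheafData.radical_ideal, Ideal.IsRadical.radical]
  rw [IdealSheafData.ideal_comap_of_isOpenImmersion, IdealSheafData.vanishingIdeal_ideal]
  exact Ideal.IsRadical.comap _ (PrimeSpectrum.isRadical_vanishingIdeal _)

/-- The ideal of `A` defining the pullback to `Spec A` of a closed subscheme. -/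
def pullIdeal {A : CommRingCat.{u}} {Y : Scheme.{u}} (f : Spec A ⟶ Y) (Z : Y.IdealSheafData) :
    Ideal A :=
  specIdeal A (Z.comap f)

theorem pullIdeal_comp {A B : CommRingCat.{u}} {Y : Scheme.{u}} (φ : A ⟶ B) (f : Spec A ⟶ Y)
    (Z : Y.IdealSheafData) : pullIdeal (Spec.map φ ≫ f) Z = (pullIdeal f Z).map φ.hom := by
  rw [pullIdeal, IdealSheafData.comap_comp, specIdeal_comap, pullIdeal]

theorem pullIdeal_comap {A : CommRingCat.{u}} {Y Y' : Scheme.{u}} (f : Spec A ⟶ Y) (g : Y ⟶ Y')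
    (Z : Y'.IdealSheafData) : pullIdeal f (Z.comap g) = pullIdeal (f ≫ g) Z := by
  rw [pullIdeal, pullIdeal, IdealSheafData.comap_comp]

theorem pullIdeal_vanishingIdeal {A : CommRingCat.{u}} {Y : Scheme.{u}} (j : Spec A ⟶ Y)
    [IsOpenImmersion j] (T : Closeds Y) :
    pullIdeal j (.vanishingIdeal T) = PrimeSpectrum.vanishingIdeal (j ⁻¹' (T : Set Y)) := by
  rw [pullIdeal, comap_vanishingIdeal_of_isOpenImmersion, specIdeal_vanishingIdeal]
  rfl

end SpecIdeal

end SemiIntegral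

end

/-! ### Multiplicities as exponents of ideals in a discrete valuation ring -/

noncomputable section

namespace SemiIntegral

section IdealMult

open IsLocalRing

variable {R : Type u} [CommRing R]

open Classical in
/-- The exponent of an ideal in a discrete valuation ring, which is `∞` for the zero ideal. -/
def idealMult [IsLocalRing R] (J : Ideal R) : ℕ∞ :=
  if J = ⊥ then ⊤ else sInf {n : ℕ∞ | ∃ k : ℕ, n = k ∧ J = maximalIdeal R ^ k}

variable [IsDomain R] [IsDiscreteValuationRing R]

theorem pow_maximalIdeal_injective : Function.Injective fun n : ℕ => maximalIdeal R ^ n := by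
  intro n k h
  obtain ⟨ϖ, hϖ⟩ := IsDiscreteValuationRing.exists_irreducible R
  simp only [hϖ.maximalIdeal_eq, Ideal.span_singleton_pow] at h
  rw [Ideal.span_singleton_eq_span_singleton] at h
  exact le_antisymm ((pow_dvd_pow_iff hϖ.ne_zero hϖ.not_isUnit).mp h.dvd)
    ((pow_dvd_pow_iff hϖ.ne_zero hϖ.not_isUnit).mp h.symm.dvd)

theorem exists_eq_maximalIdeal_pow {J : Ideal R} (hJ : J ≠ ⊥) :
    ∃ n : ℕ, J = maximalIdeal R ^ n := by
  obtain ⟨ϖ, hϖ⟩ := IsDiscreteValuationRing.exists_irreducible R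
  obtain ⟨n, hn⟩ := IsDiscreteValuationRing.ideal_eq_span_pow_irreducible hJ hϖ
  exact ⟨n, by rw [hn, hϖ.maximalIdeal_eq, Ideal.span_singleton_pow]⟩

theorem maximalIdeal_pow_ne_bot (n : ℕ) : maximalIdeal R ^ n ≠ ⊥ :=
  pow_ne_zero _ (IsDiscreteValuationRing.not_a_field R)

theorem idealMult_pow (n : ℕ) : idealMult (maximalIdeal R ^ n) = n := by
  rw [idealMult, if_neg (maximalIdeal_pow_ne_bot n)]
  have : {m : ℕ∞ | ∃ k : ℕ, m = k ∧ maximalIdeal R ^ n = maximalIdeal R ^ k} = {(n : ℕ∞)} := by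
    ext m
    constructor
    · rintro ⟨k, rfl, h⟩
      rw [pow_maximalIdeal_injective h]
      rfl
    · rintro rfl
      exact ⟨n, rfl, rfl⟩
  rw [this, sInf_singleton]

theorem idealMult_bot : idealMult (⊥ : Ideal R) = ⊤ := if_pos rfl

theorem idealMult_top : idealMult (⊤ : Ideal R) = 0 := by
  rw [← Ideal.one_eq_top, ← pow_zero (maximalIdeal R), idealMult_pow, Nat.cast_zero]

theorem idealMult_eq_zero_iff {J : Ideal R} : idealMult J = 0 ↔ J = ⊤ := by
  constructor
  · intro h
    by_cases hJ : J = ⊥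
    · rw [hJ, idealMult_bot] at h
      exact absurd h ENat.top_ne_zero
    · obtain ⟨n, rfl⟩ := exists_eq_maximalIdeal_pow hJ
      rw [idealMult_pow, Nat.cast_eq_zero] at h
      rw [h, pow_zero, Ideal.one_eq_top]
  · rintro rfl
    exact idealMult_top

/-- Exponents are insensitive to unramified extensions. -/
theorem idealMult_map {R' : Type u} [CommRing R'] [IsDomain R'] [IsDiscreteValuationRing R']
    (f : R →+* R') (hf : (maximalIdeal R).map f = maximalIdeal R') (J : Ideal R) :
    idealMult (J.map f) = idealMult J := by
  by_cases hJ : J = ⊥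
  · rw [hJ, Ideal.map_bot, idealMult_bot, idealMult_bot]
  · obtain ⟨n, rfl⟩ := exists_eq_maximalIdeal_pow hJ
    rw [Ideal.map_pow, hf, idealMult_pow, idealMult_pow]

/-- The multiplicity is defined by an isomorphism of schemes, hence of abstract rings that need not
respect the R-algebra structure. The comparison therefore uses nilpotency: the element matching ϖ is
nilpotent, so it lifts into the maximal ideal and its n-th power vanishes. -/
theorem eq_of_ringEquiv_quotient_pow {n k : ℕ}
    (e : R ⧸ maximalIdeal R ^ n ≃+* R ⧸ maximalIdeal R ^ k) : k ≤ n := by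
  obtain ⟨ϖ, hϖ⟩ := IsDiscreteValuationRing.exists_irreducible R
  obtain ⟨r, hr⟩ := Ideal.Quotient.mk_surjective (e.symm (Ideal.Quotient.mk _ ϖ))
  have hmem : ϖ ∈ maximalIdeal R := (mem_maximalIdeal _).mpr hϖ.not_isUnit
  have hnil : r ^ k ∈ maximalIdeal R ^ n := by
    rw [← Ideal.Quotient.eq_zero_iff_mem, map_pow, hr, ← map_pow, ← map_pow,
      Ideal.Quotient.eq_zero_iff_mem.mpr (Ideal.pow_mem_pow hmem k), map_zero]
  have hrn : r ^ n ∈ maximalIdeal R ^ n := by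
    obtain rfl | hn := eq_or_ne n 0
    · simp
    · exact Ideal.pow_mem_pow ((maximalIdeal.isMaximal R).isPrime.mem_of_pow_mem k
        (Ideal.pow_le_self hn hnil)) n
  have h : ϖ ^ n ∈ maximalIdeal R ^ k := by
    rw [← Ideal.Quotient.eq_zero_iff_mem, map_pow, ← e.apply_symm_apply (Ideal.Quotient.mk _ ϖ),
      ← hr, ← map_pow, ← map_pow, Ideal.Quotient.eq_zero_iff_mem.mpr hrn, map_zero]
  rw [hϖ.maximalIdeal_eq, Ideal.span_singleton_pow, Ideal.mem_span_singleton] at h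
  exact (pow_dvd_pow_iff hϖ.ne_zero hϖ.not_isUnit).mp h

theorem quotient_ringEquiv_iff {J : Ideal R} (hJ : J ≠ ⊥) (k : ℕ) :
    Nonempty (R ⧸ J ≃+* R ⧸ maximalIdeal R ^ k) ↔ J = maximalIdeal R ^ k := by
  obtain ⟨n, rfl⟩ := exists_eq_maximalIdeal_pow hJ
  constructor
  · rintro ⟨e⟩
    rw [le_antisymm (eq_of_ringEquiv_quotient_pow e.symm) (eq_of_ringEquiv_quotient_pow e)]
  · intro h
    exact ⟨Ideal.quotEquivOfEq h⟩

end IdealMult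

section IntMult

open Scheme IsLocalRing

theorem specIdeal_ker {A B : CommRingCat.{u}} (φ : A ⟶ B) :
    specIdeal A (Spec.map φ).ker = RingHom.ker φ.hom := by
  rw [← IdealSheafData.map_bot, specIdeal_map, (specIdeal B).map_bot]
  rfl

theorem exists_comp_subschemeι_iff {T Y : Scheme.{u}} (f : T ⟶ Y) (Z : Y.IdealSheafData) :
    (∃ z : T ⟶ Z.subscheme, z ≫ Z.subschemeι = f) ↔ Z.comap f = ⊥ := by
  rw [← le_bot_iff, ← IdealSheafData.le_map_iff_comap_le, IdealSheafData.map_bot]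
  constructor
  · rintro ⟨z, rfl⟩
    conv_lhs => rw [← Z.ker_subschemeι]
    exact Hom.le_ker_comp _ _
  · intro h
    exact ⟨f.toImage ≫ IdealSheafData.inclusion h, by simp⟩

theorem nonempty_subscheme_iso {A : CommRingCat.{u}} (Z : (Spec A).IdealSheafData) :
    Nonempty (Z.subscheme ≅ Spec (.of (A ⧸ specIdeal A Z))) := by
  let f : Spec (.of (A ⧸ specIdeal A Z)) ⟶ Spec A :=
    Spec.map (CommRingCat.ofHom (Ideal.Quotient.mk (specIdeal A Z)))
  have hf : IsClosedImmersion f :=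
    IsClosedImmersion.spec_of_surjective _ Ideal.Quotient.mk_surjective
  have hker : f.ker = Z := by
    apply (specIdeal A).injective
    rw [specIdeal_ker]
    exact Ideal.mk_ker
  have h : Z.subschemeι.ker = f.ker := by rw [IdealSheafData.ker_subschemeι, hker]
  have := IsClosedImmersion.isIso_lift Z.subschemeι f h
  exact ⟨(asIso (IsClosedImmersion.lift Z.subschemeι f h.le)).symm⟩

/-- The generic point lies on Z exactly when the pulled back ideal is zero, because R embeds in F.
From here on, multiplicities are questions about ideals of R. -/
theorem intMult_eq_idealMult {R F : Type u} [CommRing R] [IsDomain R] [IsDiscreteValuationRing R]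
    [Field F] [Algebra R F] [FaithfulSMul R F] {Y : Scheme.{u}} (y : Spec (.of R) ⟶ Y)
    (Z : Y.IdealSheafData) : intMult R F y Z = idealMult (pullIdeal y Z) := by
  have h1 : (∃ z : Spec (.of F) ⟶ Z.subscheme,
      z ≫ Z.subschemeι = Spec.map (CommRingCat.ofHom (algebraMap R F)) ≫ y) ↔
      pullIdeal y Z = ⊥ := by
    rw [exists_comp_subschemeι_iff, ← (specIdeal _).injective.eq_iff, OrderIso.map_bot]
    change pullIdeal _ Z = ⊥ ↔ _
    rw [pullIdeal_comp, Ideal.map_eq_bot_iff_of_injective]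
    exact FaithfulSMul.algebraMap_injective R F
  rw [intMult, idealMult]
  by_cases hJ : pullIdeal y Z = ⊥
  · rw [if_pos (h1.mpr hJ), if_pos hJ]
  · rw [if_neg (h1.not.mpr hJ), if_neg hJ]
    congr 1
    ext n
    refine exists_congr fun k => and_congr_right fun _ => ?_
    rw [← quotient_ringEquiv_iff hJ]
    obtain ⟨e⟩ := nonempty_subscheme_iso (Z.comap y)
    let e' := (Z.comapIso y).symm ≪≫ e
    constructor
    · rintro ⟨g⟩
      exact ⟨((Scheme.Spec.preimageIso (e'.symm ≪≫ g)).unop).symm.commRingCatIsoToRingEquiv⟩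
    · rintro ⟨g⟩
      exact ⟨e' ≪≫ Scheme.Spec.mapIso g.toCommRingCatIso.symm.op⟩

end IntMult

end SemiIntegral

end

/-! ### Rings all of whose local rings are domains -/

noncomputable section

namespace SemiIntegral

section LocallyDomain

open scoped TensorProduct

/-- All local rings of `T` are domains. -/
def IsLocallyDomain (T : Type*) [CommRing T] : Prop :=
  ∀ (p : Ideal T) [p.IsPrime] (a b : T), a * b = 0 → ∃ s ∉ p, s * a = 0 ∨ s * b = 0

/-- The powers of x generate a stationary chain, so xⁿ(1 - xy) = 0 for some y. Then x(1 - xy) is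
nilpotent, hence zero. -/
theorem exists_eq_sq_mul_of_isReduced {E : Type*} [CommRing E] [IsArtinianRing E] [IsReduced E]
    (x : E) : ∃ y, x = x ^ 2 * y := by
  obtain ⟨n, y, hy⟩ := IsArtinian.exists_pow_succ_smul_dvd x (1 : E)
  refine ⟨y, ?_⟩
  have h : (x * (1 - x * y)) ^ (n + 1) = 0 := by
    have h1 : x ^ n * (1 - x * y) = 0 := by
      rw [mul_sub, mul_one, ← mul_assoc, ← pow_succ, sub_eq_zero]
      simpa [mul_comm] using hy.symm
    rw [mul_pow, pow_succ, pow_succ' (1 - x * y)]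
    linear_combination (x * (1 - x * y) ^ n) * h1
  have := eq_zero_of_pow_eq_zero h
  linear_combination this

/-- T embeds in E = T ⊗ Frac P, which is reduced and Artinian, so a = a²y for some y in E and ay is
idempotent. It is integral over T, and integral closure commutes with étale base change; as P is
integrally closed, ay comes from some e in T. Then ea = a and eb = 0, and one of e, 1 - e lies
outside p. -/
theorem IsLocallyDomain.of_etale {P T : Type u} [CommRing P] [IsDomain P] [IsIntegrallyClosed P]
    [CommRing T] [Algebra P T] [Algebra.Etale P T] : IsLocallyDomain T := by
  intro p _ a b hab
  let F := FractionRing P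
  let E := T ⊗[P] F
  have : Algebra.Etale F (F ⊗[P] T) := inferInstance
  have : Module.Finite F (F ⊗[P] T) := Algebra.FormallyUnramified.finite_of_free F _
  have : IsArtinianRing (F ⊗[P] T) := IsArtinianRing.of_finite F _
  have : IsReduced (F ⊗[P] T) := Algebra.FormallyUnramified.isReduced_of_field F _
  let ε : (F ⊗[P] T) ≃ₐ[P] E := Algebra.TensorProduct.comm P F T
  have hinj : Function.Injective (algebraMap T E) :=
    Algebra.TensorProduct.includeLeft_injective (S := P) (IsFractionRing.injective P F)
  obtain ⟨y, hy⟩ : ∃ y : E, algebraMap T E a = algebraMap T E a ^ 2 * y := by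
    obtain ⟨y, hy⟩ := exists_eq_sq_mul_of_isReduced (ε.symm (algebraMap T E a))
    exact ⟨ε y, ε.symm.injective (by simpa using hy)⟩
  set x := algebraMap T E a
  have hid : (x * y) * (x * y) = x * y := by linear_combination (-y) * hy
  have hint : x * y ∈ integralClosure T E := by
    refine ⟨Polynomial.X ^ 2 - Polynomial.X, ?_, ?_⟩
    · monicity!
    · simp [pow_two, hid]
  obtain ⟨z, hz⟩ := (TensorProduct.toIntegralClosure_bijective_of_smooth
    (R := P) (S := T) (B := F)).2 ⟨x * y, hint⟩
  obtain ⟨e, he⟩ : ∃ e : T, algebraMap T E e = x * y := by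
    have hz' : (TensorProduct.toIntegralClosure P T F z : E) = x * y := congrArg Subtype.val hz
    rw [← hz']
    clear hz hz'
    induction z with
    | zero => exact ⟨0, by simp⟩
    | add z z' h h' =>
      obtain ⟨e, he⟩ := h
      obtain ⟨e', he'⟩ := h'
      exact ⟨e + e', by simp [he, he']⟩
    | tmul t c =>
      obtain ⟨r, hr⟩ := IsIntegrallyClosed.isIntegral_iff.mp c.2
      refine ⟨r • t, ?_⟩
      change (r • t) ⊗ₜ[P] (1 : F) = t ⊗ₜ[P] (c : F)
      rw [← hr, TensorProduct.smul_tmul, Algebra.algebraMap_eq_smul_one]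
  have h1 : (1 - e) * a = 0 := hinj (by
    rw [map_mul, map_sub, he, map_one, map_zero]
    linear_combination hy)
  have h2 : e * b = 0 := hinj (by
    rw [map_mul, he, map_zero, mul_right_comm, ← map_mul, hab, map_zero, zero_mul])
  by_cases hep : e ∈ p
  · exact ⟨1 - e, fun h => (Ideal.ne_top_iff_one p).mp (Ideal.IsPrime.ne_top ‹_›)
      (by simpa using p.add_mem h hep), .inl h1⟩
  · exact ⟨e, hep, .inr h2⟩

/-- Near p a smooth algebra is étale over a polynomial ring over R, and this ring is integrally
closed because R is factorial. The property is local, so it descends from the localization at f. -/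
theorem IsLocallyDomain.of_smooth {R T : Type u} [CommRing R] [IsDomain R]
    [UniqueFactorizationMonoid R] [CommRing T] [Algebra R T] [Algebra.Smooth R T] :
    IsLocallyDomain T := by
  intro p _ a b hab
  obtain ⟨f, hf, n, _, _, _⟩ :=
    Algebra.IsSmoothAt.exists_isStandardEtale_mvPolynomial (R := R) (p := p)
  have h := IsLocallyDomain.of_etale (P := MvPolynomial (Fin n) R) (T := Localization.Away f)
  have hdisj := (Ideal.disjoint_powers_iff_notMem_of_isPrime (I := p) f).mpr hf
  have hp' : (p.map (algebraMap T (Localization.Away f))).IsPrime :=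
    IsLocalization.isPrime_of_isPrime_disjoint (.powers f) _ _ ‹_› hdisj
  obtain ⟨s, hs, hsab⟩ := h (p.map (algebraMap T (Localization.Away f)))
    (algebraMap _ _ a) (algebraMap _ _ b) (by rw [← map_mul, hab, map_zero])
  obtain ⟨⟨t, ⟨_, m, rfl⟩⟩, hst⟩ := IsLocalization.surj (Submonoid.powers f) s
  have hst' : algebraMap T (Localization.Away f) t = s * algebraMap T _ (f ^ m) := hst.symm
  have htp : t ∉ p := by
    intro ht
    apply hs
    have h1 : s * algebraMap T _ (f ^ m) ∈ p.map (algebraMap T (Localization.Away f)) := by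
      rw [← hst']
      exact Ideal.mem_map_of_mem _ ht
    exact (Ideal.mul_unit_mem_iff_mem _ (IsLocalization.map_units _
      (⟨f ^ m, m, rfl⟩ : Submonoid.powers f))).mp h1
  have key : ∀ a : T, s * algebraMap T _ a = 0 → ∃ k : ℕ, f ^ k * t * a = 0 := by
    intro a ha
    have h1 : algebraMap T (Localization.Away f) (t * a) = 0 := by
      rw [map_mul, hst', mul_right_comm, ha, zero_mul]
    obtain ⟨⟨_, k, rfl⟩, hk⟩ := (IsLocalization.map_eq_zero_iff (Submonoid.powers f) _ _).mp h1
    exact ⟨k, by rw [mul_assoc]; exact hk⟩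
  have hfk : ∀ k : ℕ, f ^ k * t ∉ p := fun k hk =>
    (Ideal.IsPrime.mem_or_mem ‹_› hk).elim (fun h => hf (Ideal.IsPrime.mem_of_pow_mem ‹_› _ h)) htp
  obtain h | h := hsab
  · obtain ⟨k, hk⟩ := key a h
    exact ⟨_, hfk k, .inl hk⟩
  · obtain ⟨k, hk⟩ := key b h
    exact ⟨_, hfk k, .inr hk⟩

/-- The kernel of the map from T to its localization at p is prime and lies in c, so it equals the
minimal prime c. -/
theorem IsLocallyDomain.exists_mul_eq_zero {T : Type*} [CommRing T] (hT : IsLocallyDomain T)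
    {c : Ideal T} (hc : c ∈ minimalPrimes T) {p : Ideal T} [p.IsPrime] (hcp : c ≤ p) {a : T}
    (ha : a ∈ c) : ∃ s ∉ p, s * a = 0 := by
  have hcprime : c.IsPrime := hc.1.1
  let J := RingHom.ker (algebraMap T (Localization.AtPrime p))
  have hJ : ∀ x, x ∈ J ↔ ∃ s ∉ p, s * x = 0 := by
    intro x
    rw [RingHom.mem_ker, IsLocalization.map_eq_zero_iff p.primeCompl]
    exact ⟨fun ⟨s, hs⟩ => ⟨s, s.2, hs⟩, fun ⟨s, hs, h⟩ => ⟨⟨s, hs⟩, h⟩⟩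
  have hJprime : J.IsPrime := by
    refine ⟨fun h => ?_, fun {x y} hxy => ?_⟩
    · obtain ⟨s, hs, h1⟩ := (hJ 1).mp (h ▸ Submodule.mem_top)
      rw [mul_one] at h1
      exact hs (h1 ▸ p.zero_mem)
    · obtain ⟨s, hs, h1⟩ := (hJ _).mp hxy
      rw [← mul_assoc] at h1
      obtain ⟨t, ht, h2 | h2⟩ := hT p _ _ h1
      · exact .inl ((hJ _).mpr ⟨t * s, fun h => (Ideal.IsPrime.mem_or_mem ‹_› h).elim ht hs,
          by rw [mul_assoc, h2]⟩)
      · exact .inr ((hJ _).mpr ⟨t, ht, h2⟩)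
  have hJc : J ≤ c := fun x hx => by
    obtain ⟨s, hs, h⟩ := (hJ x).mp hx
    exact (hcprime.mem_or_mem (h ▸ c.zero_mem : s * x ∈ c)).resolve_left fun h => hs (hcp h)
  exact (hJ a).mp (hc.2 ⟨hJprime, bot_le⟩ hJc ha)

/-- Irreducible components are open and closed. Locally c is zero or the unit ideal, so c = c², and
a finitely generated idempotent ideal is generated by an idempotent. -/
theorem IsLocallyDomain.exists_idempotent {T : Type*} [CommRing T] (hT : IsLocallyDomain T)
    {c : Ideal T} (hc : c ∈ minimalPrimes T) (hfg : c.FG) :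
    ∃ e : T, IsIdempotentElem e ∧ c = Ideal.span {e} := by
  refine (Ideal.isIdempotentElem_iff_of_fg _ hfg).mp (le_antisymm Ideal.mul_le_right fun a ha => ?_)
  by_contra hcon
  let N : Ideal T := Submodule.comap (LinearMap.toSpanSingleton T T a) (c * c)
  have hN : N ≠ ⊤ := fun h => hcon (by
    have h1 : (1 : T) ∈ N := h ▸ Submodule.mem_top
    simpa [N] using h1)
  obtain ⟨p, hp, hNp⟩ := Ideal.exists_le_maximal N hN
  obtain ⟨s, hs, hsa⟩ : ∃ s ∉ p, s * a ∈ c * c := by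
    by_cases hcp : c ≤ p
    · obtain ⟨s, hs, h⟩ := hT.exists_mul_eq_zero hc hcp ha
      exact ⟨s, hs, h ▸ zero_mem _⟩
    · obtain ⟨s, hs, hsp⟩ := Set.not_subset.mp hcp
      exact ⟨s, hsp, Ideal.mul_mem_mul hs ha⟩
  exact hs (hNp hsa)

end LocallyDomain

end SemiIntegral

end

/-! ### Spreading out from the generic fibre -/

noncomputable section

namespace SemiIntegral

section Spreading

open scoped TensorProduct

/-- The map `V ⊗ N → K ⊗ N` induced by `V → K`. -/
abbrev baseChangeMap (R V K N : Type*) [CommRing R] [CommRing V] [CommRing K] [CommRing N]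
    [Algebra R V] [Algebra R K] [Algebra V K] [IsScalarTower R V K] [Algebra R N] :
    V ⊗[R] N →ₐ[V] K ⊗[R] N :=
  Algebra.TensorProduct.map (Algebra.ofId V K) (AlgHom.id R N)

variable {R V K N : Type u} [CommRing R] [CommRing V] [CommRing K] [CommRing N]
    [Algebra R V] [Algebra R K] [Algebra V K] [IsScalarTower R V K] [Algebra R N]

/-- A tensor involves only finitely many scalars of K. -/
theorem exists_finset_mem_range_baseChangeMap (R : Type u) {K N : Type u} [CommRing R]
    [CommRing K] [CommRing N] [Algebra R K] [Algebra R N] (z : K ⊗[R] N) :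
    ∃ F : Finset K, ∀ (V : Type u) [CommRing V] [Algebra R V] [Algebra V K] [IsScalarTower R V K],
      (∀ x ∈ F, x ∈ (algebraMap V K).range) → z ∈ (baseChangeMap R V K N).range := by
  classical
  induction z with
  | zero => exact ⟨∅, fun V _ _ _ _ _ => zero_mem _⟩
  | add z z' h h' =>
    obtain ⟨F, hF⟩ := h
    obtain ⟨F', hF'⟩ := h'
    exact ⟨F ∪ F', fun V _ _ _ _ hV => add_mem
      (hF V fun x hx => hV x (Finset.mem_union_left _ hx))
      (hF' V fun x hx => hV x (Finset.mem_union_right _ hx))⟩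
  | tmul x n =>
    refine ⟨{x}, fun V _ _ _ _ hV => ?_⟩
    obtain ⟨y, rfl⟩ := hV x (Finset.mem_singleton_self x)
    exact ⟨y ⊗ₜ n, by simp [baseChangeMap]⟩

theorem range_baseChangeMap_le {B : Type*} [CommRing B] [Algebra K B] [Algebra V B]
    [IsScalarTower V K B] (e : K ⊗[R] N →ₐ[K] B) (T : Subalgebra V B) {s : Set N}
    (hs : Algebra.adjoin R s = ⊤) (h : ∀ n ∈ s, e (1 ⊗ₜ n) ∈ T) :
    ((e.restrictScalars V).comp (baseChangeMap R V K N)).range ≤ T := by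
  rintro _ ⟨z, rfl⟩
  induction z with
  | zero => simp
  | add z z' h h' =>
    rw [map_add]
    exact add_mem h h'
  | tmul x n =>
    have hn : e (1 ⊗ₜ n) ∈ T := by
      have hn : n ∈ Algebra.adjoin R s := hs ▸ trivial
      induction hn using Algebra.adjoin_induction with
      | mem n hn => exact h n hn
      | algebraMap r =>
        have : (1 : K) ⊗ₜ[R] (algebraMap R N r) = algebraMap V (K ⊗[R] N) (algebraMap R V r) := by
          rw [Algebra.TensorProduct.algebraMap_apply, ← IsScalarTower.algebraMap_apply,
            Algebra.algebraMap_eq_smul_one, Algebra.algebraMap_eq_smul_one, TensorProduct.tmul_smul,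
            TensorProduct.smul_tmul']
        rw [this]
        have h2 := (e.restrictScalars V).commutes (algebraMap R V r)
        change e _ = _ at h2
        rw [h2]
        exact T.algebraMap_mem _
      | add a b _ _ ha hb =>
        rw [TensorProduct.tmul_add, map_add]
        exact add_mem ha hb
      | mul a b _ _ ha hb =>
        rw [← mul_one (1 : K), ← Algebra.TensorProduct.tmul_mul_tmul, map_mul]
        exact mul_mem ha hb
    have h2 : ((e.restrictScalars V).comp (baseChangeMap R V K N)) (x ⊗ₜ n) = x • e (1 ⊗ₜ n) := by
      have : (baseChangeMap R V K N) (x ⊗ₜ n) = x • ((1 : K) ⊗ₜ[R] n) := by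
        simp [baseChangeMap, Algebra.ofId_apply, Algebra.smul_def]
      rw [AlgHom.comp_apply, this, map_smul]
      rfl
    change ((e.restrictScalars V).comp (baseChangeMap R V K N)) (x ⊗ₜ n) ∈ T
    rw [h2]
    exact T.smul_mem hn x

/-- Two algebras of finite type with the same generic fibre are isomorphic as soon as the
isomorphism and its inverse are defined on generators. -/
theorem smooth_of_baseChange_equiv {K₀ B₀ : Type u} [CommRing K₀] [Algebra K₀ V] [Algebra K₀ K]
    [IsScalarTower K₀ V K] [CommRing B₀] [Algebra K₀ B₀] [Algebra.Smooth K₀ B₀]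
    (e : K ⊗[R] N ≃ₐ[K] K ⊗[K₀] B₀) {s : Set N} (hs : Algebra.adjoin R s = ⊤) {t : Set B₀}
    (ht : Algebra.adjoin K₀ t = ⊤)
    (h1 : Function.Injective (baseChangeMap R V K N))
    (h2 : Function.Injective (baseChangeMap K₀ V K B₀))
    (hst : ∀ n ∈ s, e (1 ⊗ₜ n) ∈ (baseChangeMap K₀ V K B₀).range)
    (hts : ∀ b ∈ t, e.symm (1 ⊗ₜ b) ∈ (baseChangeMap R V K N).range) :
    Algebra.Smooth V (V ⊗[R] N) := by
  let f : V ⊗[R] N →ₐ[V] K ⊗[K₀] B₀ :=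
    ((e : K ⊗[R] N →ₐ[K] K ⊗[K₀] B₀).restrictScalars V).comp (baseChangeMap R V K N)
  have hf : Function.Injective f := e.injective.comp h1
  have hrange : f.range = (baseChangeMap K₀ V K B₀).range := by
    refine le_antisymm (range_baseChangeMap_le _ _ hs hst) ?_
    have := range_baseChangeMap_le (R := K₀) (V := V) (e.symm : K ⊗[K₀] B₀ →ₐ[K] K ⊗[R] N) _ ht hts
    rintro _ ⟨z, rfl⟩
    obtain ⟨y, hy⟩ := this ⟨z, rfl⟩
    refine ⟨y, ?_⟩
    change e (baseChangeMap R V K N y) = _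
    have hy' : baseChangeMap R V K N y = e.symm (baseChangeMap K₀ V K B₀ z) := hy
    rw [hy', e.apply_symm_apply]
    rfl
  let e' : V ⊗[K₀] B₀ ≃ₐ[V] V ⊗[R] N :=
    (AlgEquiv.ofInjective _ h2).trans ((Subalgebra.equivOfEq _ _ hrange.symm).trans
      (AlgEquiv.ofInjective f hf).symm)
  exact Algebra.Smooth.of_equiv e'

theorem injective_baseChangeMap_of_flat [Module.Flat R N]
    (h : Function.Injective (algebraMap V K)) : Function.Injective (baseChangeMap R V K N) :=
  Module.Flat.rTensor_preserves_injective_linearMap (M := N)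
    ((IsScalarTower.toAlgHom R V K).toLinearMap) h

theorem exists_smul_eq_one_tmul {M : Submonoid R}
    (hM : ∀ x : V, ∃ b ∈ M, ∃ a : R, algebraMap R V b * x = algebraMap R V a) (z : V ⊗[R] N) :
    ∃ b ∈ M, ∃ n : N, b • z = 1 ⊗ₜ n := by
  induction z with
  | zero => exact ⟨1, M.one_mem, 0, by simp⟩
  | add z z' h h' =>
    obtain ⟨b, hb, n, h⟩ := h
    obtain ⟨b', hb', n', h'⟩ := h'
    refine ⟨b * b', M.mul_mem hb hb', b' • n + b • n', ?_⟩
    rw [smul_add, mul_comm b b', mul_smul, h, mul_comm b' b, mul_smul, h', TensorProduct.tmul_add,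
      TensorProduct.tmul_smul, TensorProduct.tmul_smul]
  | tmul x n =>
    obtain ⟨b, hb, a, h⟩ := hM x
    refine ⟨b, hb, a • n, ?_⟩
    rw [TensorProduct.smul_tmul', Algebra.smul_def, h, Algebra.algebraMap_eq_smul_one,
      TensorProduct.smul_tmul]

/-- V behaves as a localization of R, so a kernel element is, up to a unit, of the form 1 ⊗ n. It
then suffices that N embeds in its generic fibre; flatness of N is not required. -/
theorem injective_baseChangeMap_of_isUnit {M : Submonoid R}
    (hM : ∀ x : V, ∃ b ∈ M, ∃ a : R, algebraMap R V b * x = algebraMap R V a)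
    (hu : ∀ b ∈ M, IsUnit (algebraMap R V b))
    (hN : Function.Injective fun n : N => (1 : K) ⊗ₜ[R] n) :
    Function.Injective (baseChangeMap R V K N) := by
  rw [injective_iff_map_eq_zero]
  intro z hz
  obtain ⟨b, hb, n, h⟩ := exists_smul_eq_one_tmul hM z
  have hn : n = 0 := hN (by
    have h1 : baseChangeMap R V K N (b • z) = 1 ⊗ₜ n := by rw [h]; simp [baseChangeMap]
    have h2 : baseChangeMap R V K N (b • z) = 0 := by
      rw [← algebraMap_smul V b z, map_smul, hz, smul_zero]
    change (1 : K) ⊗ₜ[R] n = 1 ⊗ₜ 0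
    rw [← h1, h2, TensorProduct.tmul_zero])
  rw [hn, TensorProduct.tmul_zero, ← algebraMap_smul V b z] at h
  exact (hu b hb).smul_eq_zero.mp h

end Spreading

end SemiIntegral

end

/-! ### Smoothness over almost all valuation rings -/

noncomputable section

namespace SemiIntegral

section SmoothPlaces

open scoped TensorProduct
open Filter

variable {K : Type u} [Field K] {S : Set (Place K)}

/-- The embedding of the ring of `S`-integers into the valuation ring of a place outside `S`. -/
def sIntegersToValuation {v : Place K} (hv : v ∉ S) : sIntegers S →+* v.1 :=
  (sIntegers S).subtype.codRestrict v.1.toSubring fun x => x.2 v hv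

/-- The valuation ring of a place outside `S` as an algebra over the `S`-integers. -/
abbrev valuationAlgebra {v : Place K} (hv : v ∉ S) : Algebra (sIntegers S) v.1 :=
  (sIntegersToValuation hv).toAlgebra

/-- The completed local ring of a place outside `S` as an algebra over the `S`-integers. -/
abbrev complAlgebra {v : Place K} (hv : v ∉ S) : Algebra (sIntegers S) (complIntegers v) :=
  (sIntegersToCompl hv).toAlgebra

theorem isScalarTower_valuationAlgebra {v : Place K} (hv : v ∉ S) :
    letI := valuationAlgebra hv
    IsScalarTower (sIntegers S) v.1 K :=
  letI := valuationAlgebra hv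
  .of_algebraMap_eq fun _ => rfl

theorem injective_baseChangeMap_valuation {v : Place K} (hv : v ∉ S)
    (hfrac : ∀ x ∈ v.1, ∃ a b : sIntegers S, v.1.valuation (b : K) = 1 ∧ x * b = a)
    {N : Type u} [CommRing N] [Algebra (sIntegers S) N]
    (hN : Function.Injective fun n : N => (1 : K) ⊗ₜ[sIntegers S] n) :
    letI := valuationAlgebra hv
    haveI := isScalarTower_valuationAlgebra hv
    Function.Injective (baseChangeMap (sIntegers S) v.1 K N) := by
  let := valuationAlgebra hv
  have := isScalarTower_valuationAlgebra hv
  let M : Submonoid (sIntegers S) :=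
    { carrier := {b | v.1.valuation (b : K) = 1}
      one_mem' := map_one _
      mul_mem' := fun {a b} ha hb => by
        change v.1.valuation ((a : K) * b) = 1
        rw [map_mul, show v.1.valuation (a : K) = 1 from ha,
          show v.1.valuation (b : K) = 1 from hb, one_mul] }
  refine injective_baseChangeMap_of_isUnit (M := M) (fun x => ?_) (fun b hb => ?_) hN
  · obtain ⟨a, b, hb, hab⟩ := hfrac x x.2
    exact ⟨b, hb, a, Subtype.ext (by rw [mul_comm]; exact hab)⟩
  · exact (ValuationSubring.valuation_eq_one_iff v.1 (sIntegersToValuation hv b)).mpr hb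

/-- The smooth generic fibre descends to a smooth algebra B₀ over a finitely generated subring K₀ of
K. The comparison isomorphism and its inverse involve finitely many scalars on generators. At every
place where these and the generators of K₀ are integral, N and B₀ become isomorphic over the
valuation ring. -/
theorem IsGlobalField.eventually_smooth (hK : IsGlobalField K)
    [IsFractionRing (sIntegers S) K] (N : Type u) [CommRing N] [Algebra (sIntegers S) N]
    [Algebra.FiniteType (sIntegers S) N]
    (hN : Function.Injective fun n : N => (1 : K) ⊗ₜ[sIntegers S] n)
    [Algebra.Smooth K (K ⊗[sIntegers S] N)] :
    ∀ᶠ v : Place K in cofinite, ∀ hv : v ∉ S,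
      letI := valuationAlgebra hv
      Algebra.Smooth v.1 (v.1 ⊗[sIntegers S] N) := by
  obtain ⟨K₀, B₀, _, _, ⟨G, hG⟩, _, ⟨e⟩⟩ :=
    Algebra.Smooth.exists_subalgebra_fg (sIntegers S) K (K ⊗[sIntegers S] N)
  obtain ⟨s, hs⟩ := ‹Algebra.FiniteType (sIntegers S) N›
  obtain ⟨t, ht⟩ := (inferInstance : Algebra.FiniteType K₀ B₀)
  choose F hF using fun n : N =>
    exists_finset_mem_range_baseChangeMap K₀ (e (1 ⊗ₜ n))
  choose F' hF' using fun b : B₀ =>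
    exists_finset_mem_range_baseChangeMap (sIntegers S) (e.symm (1 ⊗ₜ b))
  have hmem : ∀ E : Finset K, ∀ᶠ v : Place K in cofinite, ∀ x ∈ E, x ∈ v.1 := fun E => by
    rw [eventually_all_finset]
    exact fun x _ => hK.eventually_mem x
  have h1 : ∀ᶠ v : Place K in cofinite, ∀ n ∈ s, ∀ x ∈ F n, x ∈ v.1 := by
    rw [eventually_all_finset]
    exact fun n _ => hmem _
  have h2 : ∀ᶠ v : Place K in cofinite, ∀ b ∈ t, ∀ x ∈ F' b, x ∈ v.1 := by
    rw [eventually_all_finset]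
    exact fun n _ => hmem _
  filter_upwards [h1, h2, hmem G, hK.eventually_exists_frac S] with v h1 h2 h3 h4 hv
  let := valuationAlgebra hv
  have hK₀ : ∀ x ∈ K₀, x ∈ v.1 := by
    intro x hx
    rw [← hG] at hx
    induction hx using Algebra.adjoin_induction with
    | mem x hx => exact h3 x hx
    | algebraMap r => exact r.2 v hv
    | add x y _ _ hx hy => exact add_mem hx hy
    | mul x y _ _ hx hy => exact mul_mem hx hy
  let : Algebra K₀ v.1 :=
    ((algebraMap K₀ K).codRestrict v.1.toSubring fun x => hK₀ x x.2).toAlgebra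
  have : IsScalarTower K₀ v.1 K := .of_algebraMap_eq fun _ => rfl
  have : IsScalarTower (sIntegers S) v.1 K := .of_algebraMap_eq fun _ => rfl
  refine smooth_of_baseChange_equiv e hs ht (injective_baseChangeMap_valuation hv (h4 hv) hN)
    (injective_baseChangeMap_of_flat Subtype.val_injective) (fun n hn => ?_) (fun b hb => ?_)
  · exact hF n v.1 fun x hx => ⟨⟨x, h1 n hn x hx⟩, rfl⟩
  · exact hF' b v.1 fun x hx => ⟨⟨x, h2 b hb x hx⟩, rfl⟩

/-- Smoothness is stable under base change to 𝒪_v, which is factorial as a discrete valuation ring.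
Geometrically, the components of the divisor over 𝒪_v are disjoint. -/
theorem isLocallyDomain_complIntegers_tensor {v : Place K} (hv : v ∉ S)
    [IsDiscreteValuationRing v.1] {N : Type u} [CommRing N] [Algebra (sIntegers S) N]
    (h : letI := valuationAlgebra hv; Algebra.Smooth v.1 (v.1 ⊗[sIntegers S] N)) :
    letI := complAlgebra hv
    IsLocallyDomain (complIntegers v ⊗[sIntegers S] N) := by
  let := valuationAlgebra hv
  let := complAlgebra hv
  let : Algebra v.1 (complIntegers v) := (toComplIntegers v).toAlgebra
  have : IsScalarTower (sIntegers S) v.1 (complIntegers v) := .of_algebraMap_eq fun _ => rfl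
  have := isDiscreteValuationRing_complIntegers v
  have : Algebra.Smooth v.1 (v.1 ⊗[sIntegers S] N) := h
  have : Algebra.Smooth (complIntegers v) (complIntegers v ⊗[sIntegers S] N) :=
    Algebra.Smooth.of_equiv
      (Algebra.TensorProduct.cancelBaseChange (sIntegers S) v.1 (complIntegers v) (complIntegers v) N)
  exact .of_smooth (R := complIntegers v)

end SmoothPlaces

end SemiIntegral

end

noncomputable section

namespace SemiIntegral

/-! ### Minimal primes over extended ideals -/

open TensorProduct

theorem IsLocallyDomain.of_ringEquiv {T T' : Type*} [CommRing T] [CommRing T'] (e : T ≃+* T')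
    (hT : IsLocallyDomain T) : IsLocallyDomain T' := by
  intro p _ a b hab
  obtain ⟨s, hs, h⟩ := hT (p.comap e) (e.symm a) (e.symm b) (by rw [← map_mul, hab, map_zero])
  refine ⟨e s, hs, h.imp (fun h => ?_) fun h => ?_⟩ <;>
  · apply e.symm.injective
    rw [map_mul, e.symm_apply_apply, h, map_zero]

theorem mk_comap_mem_minimalPrimes {T : Type*} [CommRing T] {J c : Ideal T}
    (hc : c ∈ J.minimalPrimes) :
    c.map (Ideal.Quotient.mk J) ∈ minimalPrimes (T ⧸ J) ∧
      (c.map (Ideal.Quotient.mk J)).comap (Ideal.Quotient.mk J) = c := by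
  rw [Ideal.minimalPrimes_eq_comap] at hc
  obtain ⟨c', hc', rfl⟩ := hc
  rw [Ideal.map_comap_of_surjective _ Ideal.Quotient.mk_surjective]
  exact ⟨hc', rfl⟩

/-- If `T ⧸ J` is locally a domain, then a minimal prime over `J` and `J` itself have the same
extension under any homomorphism to a local ring whose closed point lies on the former. -/
theorem IsLocallyDomain.map_eq_map {T O : Type*} [CommRing T] [CommRing O] [IsLocalRing O]
    {J c : Ideal T} (hT : IsLocallyDomain (T ⧸ J)) (hc : c ∈ J.minimalPrimes) (φ : T →+* O)
    (h : c.map φ ≤ IsLocalRing.maximalIdeal O) : c.map φ = J.map φ := by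
  refine le_antisymm ?_ (Ideal.map_mono hc.1.2)
  rw [Ideal.map_le_iff_le_comap] at h ⊢
  intro a ha
  obtain ⟨hc1, hc2⟩ := mk_comap_mem_minimalPrimes hc
  let p := (IsLocalRing.maximalIdeal O).comap φ
  have hJp : J ≤ p := hc.1.2.trans h
  have hker : RingHom.ker (Ideal.Quotient.mk J) ≤ p := by rwa [Ideal.mk_ker]
  have : (p.map (Ideal.Quotient.mk J)).IsPrime :=
    Ideal.map_isPrime_of_surjective Ideal.Quotient.mk_surjective hker
  -- Modulo J, the element a of c is killed by some s outside the prime p under the closed point. As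
  -- φ s is a unit, φ a lies in the extension of J.
  obtain ⟨s, hs, hsa⟩ := hT.exists_mul_eq_zero hc1 (Ideal.map_mono h)
    (Ideal.mem_map_of_mem (Ideal.Quotient.mk J) ha)
  obtain ⟨s, rfl⟩ := Ideal.Quotient.mk_surjective s
  rw [← map_mul, Ideal.Quotient.eq_zero_iff_mem] at hsa
  have hsp : φ s ∉ IsLocalRing.maximalIdeal O := fun hs' =>
    hs (Ideal.mem_map_of_mem _ (show s ∈ p from hs'))
  have hu : IsUnit (φ s) := by simpa using hsp
  have := Ideal.mem_map_of_mem φ hsa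
  rw [map_mul] at this
  exact (Ideal.unit_mul_mem_iff_mem _ hu).mp this

/-- Going down for flat maps: a prime strictly between J and the contraction of q could be lifted
below q. Hence components of a flat base change dominate components of the original. -/
theorem comap_mem_minimalPrimes_of_flat {T T' : Type*} [CommRing T] [CommRing T'] (g : T →+* T')
    (hg : g.Flat) {J : Ideal T} {q : Ideal T'} (hq : q ∈ (J.map g).minimalPrimes) :
    q.comap g ∈ J.minimalPrimes := by
  let := g.toAlgebra
  have : Module.Flat T T' := hg
  have hqp : q.IsPrime := hq.1.1
  have hle : J ≤ q.comap g := Ideal.map_le_iff_le_comap.mp hq.1.2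
  obtain ⟨p, hp, hpq⟩ := Ideal.exists_minimalPrimes_le hle
  have : p.IsPrime := hp.1.1
  have : q.LiesOver (q.comap g) := ⟨rfl⟩
  obtain ⟨P, hP, hPp, hPl⟩ := Ideal.exists_ideal_le_liesOver_of_le (p := p) (q := q.comap g) q hpq
  have h1 : P.comap g = p := hPl.over.symm
  have h2 : q ≤ P := hq.2 ⟨hPp, Ideal.map_le_iff_le_comap.mpr (h1 ▸ hp.1.2)⟩ hP
  rwa [le_antisymm h2 hP, h1]

theorem flat_includeRight (R O A : Type*) [CommRing R] [CommRing O] [CommRing A] [Algebra R O]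
    [Algebra R A] [Module.Flat R O] :
    (Algebra.TensorProduct.includeRight : A →ₐ[R] O ⊗[R] A).toRingHom.Flat := by
  have h1 : (algebraMap A (A ⊗[R] O)).Flat := RingHom.flat_algebraMap_iff.mpr inferInstance
  have h2 := h1.comp (RingHom.Flat.of_bijective
    (f := (Algebra.TensorProduct.comm R A O).toRingEquiv.toRingHom)
    (Algebra.TensorProduct.comm R A O).bijective)
  convert h2 using 1
  ext x
  rfl

theorem comap_includeRight_of_mem_minimalPrimes {R O A : Type*} [CommRing R] [CommRing O]
    [CommRing A] [Algebra R O] [Algebra R A] [Module.Flat R O] {I : Ideal A} [I.IsPrime]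
    {q : Ideal (O ⊗[R] A)}
    (hq : q ∈ (I.map (Algebra.TensorProduct.includeRight : A →ₐ[R] O ⊗[R] A)).minimalPrimes) :
    q.comap (Algebra.TensorProduct.includeRight : A →ₐ[R] O ⊗[R] A) = I := by
  have := comap_mem_minimalPrimes_of_flat _ (flat_includeRight R O A) (J := I) (q := q) hq
  rw [Ideal.minimalPrimes_eq_subsingleton_self] at this
  exact this

theorem mem_map_includeRight_iff {R O A : Type*} [CommRing R] [CommRing O] [CommRing A]
    [Algebra R O] [Algebra R A] {I : Ideal A} {x : O ⊗[R] A} :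
    x ∈ I.map (Algebra.TensorProduct.includeRight : A →ₐ[R] O ⊗[R] A) ↔
      Algebra.TensorProduct.map (AlgHom.id R O) (Ideal.Quotient.mkₐ R I) x = 0 := by
  have := Algebra.TensorProduct.lTensor_ker (A := O) (Ideal.Quotient.mkₐ R I)
    (Ideal.Quotient.mkₐ_surjective R I)
  have hk : RingHom.ker (Ideal.Quotient.mkₐ R I) = I := Ideal.mk_ker
  rw [hk] at this
  rw [← this]
  rfl

/-- If `E ⊗ A/I → L ⊗ A/I` is injective, then elements of `D ⊗ A` that vanish on the subscheme of
`Spec (L ⊗ A)` defined by `I` map into the extension of `I` under `O`-points factoring through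
`Spec (E ⊗ A)`. -/
theorem lift_mem_map {R D E L O A : Type*} [CommRing R] [CommRing D] [CommRing E] [CommRing L]
    [CommRing O] [CommRing A] [Algebra R D] [Algebra R E] [Algebra R L] [Algebra R O] [Algebra R A]
    (f : D →ₐ[R] E) (g : E →ₐ[R] L) (t : E →ₐ[R] O) (χ : A →ₐ[R] O) {I : Ideal A}
    (hinj : Function.Injective (Algebra.TensorProduct.map g (AlgHom.id R (A ⧸ I))))
    {x : D ⊗[R] A}
    (hx : Algebra.TensorProduct.map (g.comp f) (AlgHom.id R A) x ∈
      I.map (Algebra.TensorProduct.includeRight : A →ₐ[R] L ⊗[R] A)) :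
    Algebra.TensorProduct.productMap (t.comp f) χ x ∈ I.map χ := by
  let y := Algebra.TensorProduct.map f (AlgHom.id R A) x
  have hy : y ∈ I.map (Algebra.TensorProduct.includeRight : A →ₐ[R] E ⊗[R] A) := by
    rw [mem_map_includeRight_iff] at hx ⊢
    apply hinj
    rw [map_zero, ← hx]
    simp only [y, ← AlgHom.comp_apply, ← Algebra.TensorProduct.map_comp]
    rfl
  have h1 : Algebra.TensorProduct.productMap (t.comp f) χ x =
      Algebra.TensorProduct.productMap t χ y := by
    simp only [y, ← AlgHom.comp_apply]
    congr 1
    apply Algebra.TensorProduct.ext' fun d a => ?_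
    rw [AlgHom.comp_apply, Algebra.TensorProduct.map_tmul,
      Algebra.TensorProduct.productMap_apply_tmul, Algebra.TensorProduct.productMap_apply_tmul]
    rfl
  rw [h1]
  have h2 := Ideal.mem_map_of_mem (Algebra.TensorProduct.productMap t χ) hy
  rwa [Ideal.map_mapₐ, Algebra.TensorProduct.productMap_right] at h2

end SemiIntegral

end

noncomputable section

namespace SemiIntegral

/-! ### Spreading out a geometric component -/

open TensorProduct Filter

/-- E ⊗_R N equals E ⊗_V (V ⊗_R N), so flatness after base change to V is enough. -/
theorem injective_map_of_flat {R V E L N : Type u} [CommRing R] [CommRing V] [CommRing E]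
    [CommRing L] [CommRing N] [Algebra R V] [Algebra V E] [Algebra R E] [IsScalarTower R V E]
    [Algebra V L] [Algebra R L] [IsScalarTower R V L] [Algebra R N] (g : E →ₐ[V] L)
    (hg : Function.Injective g) [Module.Flat V (V ⊗[R] N)] :
    Function.Injective (Algebra.TensorProduct.map (g.restrictScalars R) (AlgHom.id R N)) := by
  have h1 : Function.Injective (Algebra.TensorProduct.map g (AlgHom.id V (V ⊗[R] N))) :=
    Module.Flat.rTensor_preserves_injective_linearMap (M := V ⊗[R] N) g.toLinearMap hg
  let cE := Algebra.TensorProduct.cancelBaseChange R V V E N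
  let cL := Algebra.TensorProduct.cancelBaseChange R V V L N
  have h2 : ∀ z, cL (Algebra.TensorProduct.map g (AlgHom.id V (V ⊗[R] N)) z) =
      Algebra.TensorProduct.map (g.restrictScalars R) (AlgHom.id R N) (cE z) := by
    intro z
    induction z with
    | zero => simp
    | add z z' h h' => simp only [map_add, h, h']
    | tmul e t =>
      induction t with
      | zero => simp
      | add z z' h h' => simp only [map_add, tmul_add, h, h']
      | tmul x n => simp [cE, cL]
  intro a b hab
  obtain ⟨a, rfl⟩ := cE.surjective a
  obtain ⟨b, rfl⟩ := cE.surjective b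
  rw [← h2, ← h2] at hab
  rw [h1 (cL.injective hab)]

variable {K : Type u} [Field K] {S : Set (Place K)} {L : Type u} [Field L] [Algebra K L]

instance sIntegersOverAlgebra : Algebra (sIntegers S) (sIntegers (placesOver L S)) :=
  (sIntegersMap L S).toAlgebra

/-- The inclusion of the ring of `S`-integers of `L` into `L`, over the `S`-integers of `K`. -/
def sIntegersVal (L : Type u) [Field L] [Algebra K L] (S : Set (Place K)) :
    sIntegers (placesOver L S) →ₐ[sIntegers S] L :=
  { (sIntegers (placesOver L S)).subtype with commutes' := fun _ => rfl }

theorem exists_smul_mem_range_sIntegersVal [IsFractionRing (sIntegers S) K]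
    [Algebra.IsAlgebraic K L] (x : L) :
    ∃ c : sIntegers S, c ≠ 0 ∧ c • x ∈ (sIntegersVal L S).range := by
  have hz : IsAlgebraic (sIntegers S) x :=
    (IsFractionRing.isAlgebraic_iff (sIntegers S) K L).mpr (Algebra.IsAlgebraic.isAlgebraic _)
  obtain ⟨c, hc, hint⟩ := hz.exists_integral_multiple
  refine ⟨c, hc, ⟨⟨c • x, fun w hw => ?_⟩, rfl⟩⟩
  refine mem_valuationSubring_of_isIntegralElem w.1 _ (fun r => ?_) hint
  have := ((sIntegersMap L S) r).2 w hw
  exact this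

theorem exists_smul_mem_range_map_sIntegersVal [IsFractionRing (sIntegers S) K]
    [Algebra.IsAlgebraic K L] {A : Type u} [CommRing A] [Algebra (sIntegers S) A]
    (z : L ⊗[sIntegers S] A) :
    ∃ c : sIntegers S, c ≠ 0 ∧ ∃ y : sIntegers (placesOver L S) ⊗[sIntegers S] A,
      Algebra.TensorProduct.map (sIntegersVal L S) (AlgHom.id (sIntegers S) A) y = c • z := by
  induction z with
  | zero => exact ⟨1, one_ne_zero, 0, by simp⟩
  | tmul x a =>
    obtain ⟨c, hc, d, hd⟩ := exists_smul_mem_range_sIntegersVal (S := S) x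
    refine ⟨c, hc, d ⊗ₜ a, ?_⟩
    rw [Algebra.TensorProduct.map_tmul, smul_tmul', ← hd]
    rfl
  | add z z' h h' =>
    obtain ⟨c, hc, y, hy⟩ := h
    obtain ⟨c', hc', y', hy'⟩ := h'
    refine ⟨c * c', mul_ne_zero hc hc', c' • y + c • y', ?_⟩
    rw [map_add, map_smul, map_smul, hy, hy', smul_add, smul_smul, smul_smul, mul_comm c']

/-- A lift to T of the idempotent generating q modulo J. It vanishes on the component of q and is 1
on the other components. -/
theorem exists_idempotent_of_mem_minimalPrimes {T : Type u} (F : Type u) [Field F] [CommRing T]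
    [Algebra F T] [Algebra.FiniteType F T] {J q : Ideal T} [Algebra.Smooth F (T ⧸ J)]
    (hq : q ∈ J.minimalPrimes) :
    ∃ e ∈ q, e * (e - 1) ∈ J ∧ ∀ x ∈ q, x - e * x ∈ J := by
  obtain ⟨hc1, hc2⟩ := mk_comap_mem_minimalPrimes hq
  have : IsNoetherianRing (T ⧸ J) := Algebra.FiniteType.isNoetherianRing F _
  obtain ⟨e, he, hspan⟩ := (IsLocallyDomain.of_smooth (R := F) (T := T ⧸ J)).exists_idempotent hc1
    (IsNoetherian.noetherian _)
  obtain ⟨e, rfl⟩ := Ideal.Quotient.mk_surjective e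
  refine ⟨e, ?_, ?_, fun x hx => ?_⟩
  · rw [← hc2, Ideal.mem_comap, hspan]
    exact Ideal.mem_span_singleton_self _
  · rw [← Ideal.Quotient.eq_zero_iff_mem, map_mul, map_sub, mul_sub, he.eq, map_one, mul_one,
      sub_self]
  · have h1 := Ideal.mem_map_of_mem (Ideal.Quotient.mk J) hx
    rw [hspan, Ideal.mem_span_singleton] at h1
    obtain ⟨y, hy⟩ := h1
    rw [← Ideal.Quotient.eq_zero_iff_mem, map_sub, map_mul, hy, ← mul_assoc, he.eq, sub_self]

end SemiIntegral

end

noncomputable section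

namespace SemiIntegral

open TensorProduct Filter

theorem smooth_tensor_quotient {R K L A : Type u} [CommRing R] [CommRing K] [CommRing L]
    [CommRing A] [Algebra R K] [Algebra R L] [Algebra K L] [IsScalarTower R K L] [Algebra R A]
    {I : Ideal A} [Algebra.Smooth K (K ⊗[R] (A ⧸ I))] :
    Algebra.Smooth L
      (L ⊗[R] A ⧸ I.map (Algebra.TensorProduct.includeRight : A →ₐ[R] L ⊗[R] A)) :=
  .of_equiv ((Algebra.TensorProduct.cancelBaseChange R K L L (A ⧸ I)).trans
    (Algebra.TensorProduct.tensorQuotientEquiv L A L I))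

variable {K : Type u} [Field K] {S : Set (Place K)} {L : Type u} [Field L] [Algebra K L]

theorem isUnit_toComplIntegers (v : Place K) (x : v.1) (hx : v.1.valuation x.1 = 1) :
    IsUnit (toComplIntegers v x) :=
  ((ValuationSubring.valuation_eq_one_iff v.1 x).mpr hx).map _

theorem injective_map_of_liesOver {v : Place K} (hv : v ∉ S) {w : Place L} (h : w.LiesOver v)
    {N : Type u} [CommRing N] [Algebra (sIntegers S) N]
    (hN : letI := valuationAlgebra hv; Module.Flat v.1 (v.1 ⊗[sIntegers S] N)) :
    letI : Algebra (sIntegers S) w.1 :=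
      (sIntegersToValuation (notMem_placesOver hv h)).comp (sIntegersMap L S) |>.toAlgebra
    ∃ g : w.1 →ₐ[sIntegers S] L, (∀ x, g x = x.1) ∧
      Function.Injective (Algebra.TensorProduct.map g (AlgHom.id (sIntegers S) N)) := by
  let := valuationAlgebra hv
  let : Algebra (sIntegers S) w.1 :=
      (sIntegersToValuation (notMem_placesOver hv h)).comp (sIntegersMap L S) |>.toAlgebra
  let f : v.1 →+* w.1 := ((algebraMap K L).comp v.1.subtype).codRestrict w.1.toSubring
    fun x => (h.mem_iff x.1).mpr x.2
  let := f.toAlgebra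
  let : Algebra v.1 L := ((algebraMap K L).comp v.1.subtype).toAlgebra
  have : IsScalarTower (sIntegers S) v.1 w.1 := .of_algebraMap_eq fun _ => rfl
  have : IsScalarTower (sIntegers S) v.1 L := .of_algebraMap_eq fun _ => rfl
  let g : w.1 →ₐ[v.1] L := { w.1.subtype with commutes' := fun _ => rfl }
  exact ⟨g.restrictScalars _, fun _ => rfl, injective_map_of_flat g Subtype.val_injective⟩

/-- The intersection of the closure of a geometric component with an `𝒪_w`-point is either empty
or agrees with the intersection with the whole divisor. -/
theorem IsGlobalField.eventually_map_eq (hK : IsGlobalField K) [IsFractionRing (sIntegers S) K]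
    [Algebra.IsAlgebraic K L] {A : Type u} [CommRing A] [Algebra (sIntegers S) A]
    [Algebra.FiniteType (sIntegers S) A] {I : Ideal A}
    (hN : Function.Injective fun n : A ⧸ I => (1 : K) ⊗ₜ[sIntegers S] n)
    [Algebra.Smooth K (K ⊗[sIntegers S] (A ⧸ I))] {q : Ideal (L ⊗[sIntegers S] A)}
    (hq : q ∈ (I.map (Algebra.TensorProduct.includeRight :
      A →ₐ[sIntegers S] L ⊗[sIntegers S] A)).minimalPrimes) :
    ∀ᶠ v : Place K in cofinite, ∀ (hv : v ∉ S) (w : Place L) (h : w.LiesOver v)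
      (ψ : sIntegers (placesOver L S) ⊗[sIntegers S] A →+* complIntegers w),
      ψ.comp Algebra.TensorProduct.includeLeftRingHom = sIntegersToCompl (notMem_placesOver hv h) →
      (q.comap (Algebra.TensorProduct.map (sIntegersVal L S) (AlgHom.id (sIntegers S) A))).map ψ
          = ⊤ ∨
        (q.comap (Algebra.TensorProduct.map (sIntegersVal L S) (AlgHom.id (sIntegers S) A))).map ψ
          = I.map (ψ.comp (Algebra.TensorProduct.includeRight :
            A →ₐ[sIntegers S] sIntegers (placesOver L S) ⊗[sIntegers S] A)) := by
  set J := I.map (Algebra.TensorProduct.includeRight :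
      A →ₐ[sIntegers S] L ⊗[sIntegers S] A) with hJ
  have : Algebra.Smooth L (L ⊗[sIntegers S] A ⧸ J) := smooth_tensor_quotient (K := K)
  obtain ⟨e, heq, he1, he2⟩ := exists_idempotent_of_mem_minimalPrimes L hq
  -- The idempotent e acquires a denominator c from 𝒪_S, so that ce comes from z over the S-integers
  -- of L. Almost all places make c a unit.
  obtain ⟨c, hc, z, hz⟩ := exists_smul_mem_range_map_sIntegersVal e
  have hc0 : (c : K) ≠ 0 := fun h0 => hc (Subtype.ext h0)
  set i := Algebra.TensorProduct.map (sIntegersVal L S) (AlgHom.id (sIntegers S) A) with hi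
  filter_upwards [hK.eventually_smooth (A ⧸ I) hN, hK.eventually_mem (c : K)⁻¹] with v hsm hcv
    hv w h ψ hψ
  let : Algebra (sIntegers S) v.1 := valuationAlgebra hv
  have hsm' : Algebra.Smooth v.1 (v.1 ⊗[sIntegers S] (A ⧸ I)) := hsm hv
  have hflat : Module.Flat v.1 (v.1 ⊗[sIntegers S] (A ⧸ I)) := inferInstance
  let : Algebra (sIntegers S) w.1 :=
      (sIntegersToValuation (notMem_placesOver hv h)).comp (sIntegersMap L S) |>.toAlgebra
  obtain ⟨g, hg, hinj⟩ := injective_map_of_liesOver hv h hflat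
  let : Algebra (sIntegers S) (complIntegers w) :=
      (sIntegersToCompl (notMem_placesOver hv h)).comp (sIntegersMap L S) |>.toAlgebra
  let f : sIntegers (placesOver L S) →ₐ[sIntegers S] w.1 :=
    { sIntegersToValuation (notMem_placesOver hv h) with commutes' := fun _ => rfl }
  let t : w.1 →ₐ[sIntegers S] complIntegers w :=
    { toComplIntegers w with commutes' := fun _ => rfl }
  have hψl : ∀ d, ψ (d ⊗ₜ 1) = sIntegersToCompl (notMem_placesOver hv h) d := fun d =>
    DFunLike.congr_fun hψ d
  have hχc : ∀ r : sIntegers S, ψ (1 ⊗ₜ (algebraMap (sIntegers S) A r)) =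
      algebraMap (sIntegers S) (complIntegers w) r := fun r => by
    rw [Algebra.algebraMap_eq_smul_one, tmul_smul, smul_tmul', ← Algebra.algebraMap_eq_smul_one,
      hψl]
    rfl
  let χ : A →ₐ[sIntegers S] complIntegers w :=
    { ψ.comp (Algebra.TensorProduct.includeRight :
            A →ₐ[sIntegers S] sIntegers (placesOver L S) ⊗[sIntegers S] A).toRingHom with
      commutes' := hχc }
  have hψ' : ∀ x, Algebra.TensorProduct.productMap (t.comp f) χ x = ψ x := by
    intro x
    induction x with
    | zero => simp
    | add x y hx hy => rw [map_add, map_add, hx, hy]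
    | tmul d a =>
      rw [Algebra.TensorProduct.productMap_apply_tmul,
        show d ⊗ₜ[sIntegers S] a = d ⊗ₜ[sIntegers S] (1 : A) * (1 ⊗ₜ a) by simp, map_mul, hψl]
      rfl
  have hgf : g.comp f = sIntegersVal L S := AlgHom.ext fun d => hg _
  -- Relations modulo J over L already hold over the valuation ring of w, since the divisor there
  -- embeds in its generic fibre by flatness.
  have key : ∀ x, i x ∈ J → ψ x ∈ I.map χ := by
    intro x hx
    rw [← hψ']
    apply lift_mem_map f g t χ hinj
    rw [hgf]
    exact hx
  have hcu : IsUnit (ψ (algebraMap _ _ c)) := by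
    have h1 : (c : K) ∈ v.1 := c.2 v hv
    have h2 : IsUnit (sIntegersToValuation hv c) := by
      refine isUnit_iff_exists_inv.mpr ⟨⟨_, hcv⟩, Subtype.ext ?_⟩
      exact mul_inv_cancel₀ hc0
    have h3 := (h2.map (toComplIntegers v)).map (complIntegersMap h)
    convert h3 using 1
    rw [Algebra.TensorProduct.algebraMap_apply, hψl]
    apply Subtype.ext
    exact (complMap_toCompl h (c : K)).symm
  have hzq : z ∈ q.comap i := by
    rw [Ideal.mem_comap, hz]
    exact Submodule.smul_of_tower_mem q c heq
  have hχ : I.map (ψ.comp (Algebra.TensorProduct.includeRight :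
      A →ₐ[sIntegers S] sIntegers (placesOver L S) ⊗[sIntegers S] A)) = I.map χ := rfl
  have hle : I.map χ ≤ (q.comap i).map ψ := by
    rw [Ideal.map_le_iff_le_comap]
    intro a ha
    refine Ideal.mem_map_of_mem ψ ?_
    have h1 : (1 : L) ⊗ₜ[sIntegers S] a ∈ q := hq.1.2 (Ideal.mem_map_of_mem _ ha)
    rw [Ideal.mem_comap]
    simpa [hi] using h1
  -- The function z/c takes the value 0 or 1 at the closed point. If z is a unit there, the
  -- component is missed. Otherwise z - c is a unit, and z(z - c) ∈ J puts ψ z in the extension of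
  -- I; then cx - zx ∈ J does the same for every x in the ideal of the component.
  by_cases hzu : IsUnit (ψ z)
  · exact .inl (Ideal.eq_top_of_isUnit_mem _ (Ideal.mem_map_of_mem ψ hzq) hzu)
  right
  rw [hχ]
  refine le_antisymm ?_ hle
  have hz1 : ψ (z * (z - algebraMap _ _ c)) ∈ I.map χ := by
    apply key
    have : i (z * (z - algebraMap _ _ c)) = algebraMap _ _ (c * c) * (e * (e - 1)) := by
      rw [map_mul, map_sub, hz, AlgHom.commutes, Algebra.smul_def, map_mul]
      ring
    rw [this]
    exact J.mul_mem_left _ he1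
  have hzc : IsUnit (ψ z - ψ (algebraMap _ _ c)) := by
    by_contra hcon
    have h1 := (IsLocalRing.maximalIdeal (complIntegers w)).sub_mem
      ((IsLocalRing.mem_maximalIdeal _).mpr hzu) ((IsLocalRing.mem_maximalIdeal _).mpr hcon)
    rw [sub_sub_cancel] at h1
    exact (IsLocalRing.mem_maximalIdeal _).mp h1 hcu
  rw [map_mul, map_sub, Ideal.mul_unit_mem_iff_mem _ hzc] at hz1
  rw [Ideal.map_le_iff_le_comap]
  intro x hx
  have hx1 : ψ (algebraMap _ _ c * x - z * x) ∈ I.map χ := by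
    apply key
    have : i (algebraMap _ _ c * x - z * x) = algebraMap _ _ c * (i x - e * i x) := by
      rw [map_sub, map_mul, map_mul, hz, AlgHom.commutes, Algebra.smul_def]
      ring
    rw [this]
    exact J.mul_mem_left _ (he2 _ hx)
  rw [map_sub, map_mul, map_mul] at hx1
  have hx2 := (I.map χ).add_mem hx1 ((I.map χ).mul_mem_right (ψ x) hz1)
  rw [sub_add_cancel, Ideal.unit_mul_mem_iff_mem _ hcu] at hx2
  exact hx2

end SemiIntegral

end

noncomputable section

namespace SemiIntegral

/-! ### Places at which a geometric component meets an integral point -/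

open TensorProduct Filter

/-- By the inclusion of kernels, ker ρ generates a proper ideal in the image of g. A valuation ring
of Ω contains this image and has the ideal among its nonunits. -/
theorem exists_valuationSubring_of_ker_le {T Ω k : Type*} [CommRing T] [Field Ω] [CommRing k]
    [Nontrivial k] (g : T →+* Ω) (ρ : T →+* k) (h : RingHom.ker g ≤ RingHom.ker ρ) :
    ∃ U : ValuationSubring Ω, (∀ t, g t ∈ U) ∧ ∀ t, ρ t = 0 → U.valuation (g t) < 1 := by
  obtain ⟨U, hU, hU'⟩ := Ideal.image_subset_nonunits_valuationSubring
    ((RingHom.ker ρ).map g.rangeRestrict) (by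
      rw [Ne, Ideal.eq_top_iff_one, Ideal.mem_map_iff_of_surjective _ g.rangeRestrict_surjective]
      rintro ⟨t, ht, ht1⟩
      have h1 : 1 - t ∈ RingHom.ker g := by
        rw [RingHom.mem_ker, map_sub, map_one, sub_eq_zero]
        exact (congrArg Subtype.val ht1).symm
      have h2 := h h1
      rw [RingHom.mem_ker, map_sub, map_one, RingHom.mem_ker.mp ht, sub_zero] at h2
      exact one_ne_zero h2)
  exact ⟨U, fun t => hU ⟨t, rfl⟩, fun t ht => hU' ⟨_, Ideal.mem_map_of_mem _ ht, rfl⟩⟩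

variable {K : Type u} [Field K] {S : Set (Place K)} {L : Type u} [Field L] [Algebra K L]

theorem toComplIntegers_mem_maximalIdeal {v : Place K} {x : v.1} (hx : v.1.valuation x.1 < 1) :
    toComplIntegers v x ∈ IsLocalRing.maximalIdeal (complIntegers v) := by
  rw [complIntegers_mem_maximalIdeal]
  exact (valued_toCompl v x.1).trans_lt hx

theorem complIntegersMap_mem_maximalIdeal [Algebra.IsAlgebraic K L] {v : Place K} {w : Place L}
    (h : w.LiesOver v) {m : complIntegers v}
    (hm : m ∈ IsLocalRing.maximalIdeal (complIntegers v)) :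
    complIntegersMap h m ∈ IsLocalRing.maximalIdeal (complIntegers w) := by
  rw [complIntegers_mem_maximalIdeal] at hm
  obtain ⟨a, ha⟩ := exists_valued_eq v m
  rw [ha] at hm
  have hav : a ∈ v.1 := (ValuationSubring.valuation_le_one_iff v.1 a).mp hm.le
  obtain ⟨u, rfl⟩ : toComplIntegers v ⟨a, hav⟩ ∣ m := by
    rw [complIntegers_dvd_iff, ha]
    exact (valued_toCompl v a).ge
  rw [map_mul]
  refine Ideal.mul_mem_right _ _ ?_
  rw [complIntegers_mem_maximalIdeal]
  change Valued.v (complMap h (toCompl v a)) < 1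
  rw [complMap_toCompl, valued_toCompl, h.valuation_lt_one_iff]
  exact hm

set_option maxHeartbeats 800000 in
-- Over v, the generic point q of the component specialises to the reduction of P, because that
-- reduction lies on the divisor and q contracts into I. A valuation ring U of the residue field at
-- q realises the specialisation, and w is its restriction to L. This avoids any transitivity
-- argument on conjugate components.
theorem exists_liesOver_map_le [Algebra.IsAlgebraic K L] {v : Place K} (hv : v ∉ S)
    (hfrac : ∀ x ∈ v.1, ∃ a b : sIntegers S, v.1.valuation (b : K) = 1 ∧ x * b = a)
    {A : Type u} [CommRing A] [Algebra (sIntegers S) A] {I : Ideal A}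
    {q : Ideal (L ⊗[sIntegers S] A)} [q.IsPrime]
    (hqI : q.comap (Algebra.TensorProduct.includeRight :
      A →ₐ[sIntegers S] L ⊗[sIntegers S] A) ≤ I)
    (χ : A →+* complIntegers v) (hχ : χ.comp (algebraMap (sIntegers S) A) = sIntegersToCompl hv)
    (hI : I.map χ ≤ IsLocalRing.maximalIdeal (complIntegers v)) :
    ∃ (w : Place L) (h : w.LiesOver v),
      ∀ ψ : sIntegers (placesOver L S) ⊗[sIntegers S] A →+* complIntegers w,
      ψ.comp Algebra.TensorProduct.includeLeftRingHom = sIntegersToCompl (notMem_placesOver hv h) →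
      ψ.comp (Algebra.TensorProduct.includeRight :
        A →ₐ[sIntegers S] sIntegers (placesOver L S) ⊗[sIntegers S] A).toRingHom =
        (complIntegersMap h).comp χ →
      (q.comap (Algebra.TensorProduct.map (sIntegersVal L S) (AlgHom.id (sIntegers S) A))).map ψ
          ≤ IsLocalRing.maximalIdeal (complIntegers w) := by
  let := valuationAlgebra hv
  let γ : L ⊗[sIntegers S] A →+* q.ResidueField := algebraMap _ _
  have hγ : ∀ x, γ x = 0 ↔ x ∈ q := fun x => Ideal.algebraMap_residueField_eq_zero
  let vL : v.1 →ₐ[sIntegers S] L :=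
    { (algebraMap K L).comp v.1.subtype with commutes' := fun _ => rfl }
  let g : v.1 ⊗[sIntegers S] A →+* q.ResidueField :=
    γ.comp (Algebra.TensorProduct.map vL (AlgHom.id (sIntegers S) A)).toRingHom
  let : Algebra (sIntegers S) (complIntegers v) := complAlgebra hv
  let t : v.1 →ₐ[sIntegers S] complIntegers v :=
    { toComplIntegers v with commutes' := fun _ => rfl }
  let χ' : A →ₐ[sIntegers S] complIntegers v :=
    { χ with commutes' := fun r => DFunLike.congr_fun hχ r }
  let ρ : v.1 ⊗[sIntegers S] A →+* IsLocalRing.ResidueField (complIntegers v) :=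
    (IsLocalRing.residue _).comp (Algebra.TensorProduct.productMap t χ').toRingHom
  have hρ : ∀ x a, ρ (x ⊗ₜ a) = IsLocalRing.residue _ (toComplIntegers v x * χ a) := fun x a =>
    congrArg _ (Algebra.TensorProduct.productMap_apply_tmul t χ' x a)
  have hg : ∀ x a, g (x ⊗ₜ a) = γ (algebraMap K L x ⊗ₜ a) := fun x a => rfl
  let M : Submonoid (sIntegers S) :=
    { carrier := {b | v.1.valuation (b : K) = 1}
      one_mem' := map_one _
      mul_mem' := fun {a b} ha hb => by
        change v.1.valuation ((a : K) * b) = 1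
        rw [map_mul, show v.1.valuation (a : K) = 1 from ha,
          show v.1.valuation (b : K) = 1 from hb, one_mul] }
  have hM : ∀ x : v.1, ∃ b ∈ M, ∃ a : sIntegers S,
      algebraMap (sIntegers S) v.1 b * x = algebraMap (sIntegers S) v.1 a := fun x => by
    obtain ⟨a, b, hb, hab⟩ := hfrac x x.2
    exact ⟨b, hb, a, Subtype.ext (by rw [mul_comm]; exact hab)⟩
  -- Up to a unit an element of the kernel has the form 1 ⊗ a, where a lies in q ∩ A ⊆ I; the
  -- reduction of P kills I.
  have hker : RingHom.ker g ≤ RingHom.ker ρ := by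
    intro x hx
    rw [RingHom.mem_ker] at hx ⊢
    obtain ⟨b, hb, a, hba⟩ := exists_smul_eq_one_tmul hM x
    rw [Algebra.smul_def, Algebra.TensorProduct.algebraMap_apply] at hba
    have h1 : g (1 ⊗ₜ a) = 0 := by rw [← hba, map_mul, hx, mul_zero]
    rw [hg, OneMemClass.coe_one, map_one, hγ] at h1
    have h2 : a ∈ I := hqI h1
    have h3 : ρ (1 ⊗ₜ a) = 0 := by
      rw [hρ, map_one, one_mul, IsLocalRing.residue_eq_zero_iff]
      exact hI (Ideal.mem_map_of_mem χ h2)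
    rw [← hba, map_mul, hρ, map_one, mul_one, mul_eq_zero] at h3
    refine h3.resolve_left fun h0 => ?_
    rw [IsLocalRing.residue_eq_zero_iff] at h0
    exact h0 (isUnit_toComplIntegers v _ hb)
  obtain ⟨U, hU, hU'⟩ := exists_valuationSubring_of_ker_le g ρ hker
  let γL : L →+* q.ResidueField := γ.comp Algebra.TensorProduct.includeLeftRingHom
  let W : ValuationSubring L := U.comap γL
  have hWv : W.comap (algebraMap K L) = v.1 := by
    ext x
    constructor
    · intro hx
      by_contra hxv
      have hx' : x⁻¹ ∈ v.1 := (v.1.mem_or_inv_mem x).resolve_left hxv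
      have hlt : v.1.valuation x⁻¹ < 1 := by
        rw [map_inv₀]
        rw [← ValuationSubring.valuation_le_one_iff, not_le] at hxv
        exact inv_lt_one_of_one_lt₀ hxv
      have h1 : U.valuation (g ((⟨x⁻¹, hx'⟩ : v.1) ⊗ₜ 1)) < 1 := by
        apply hU'
        rw [hρ, map_one, mul_one, IsLocalRing.residue_eq_zero_iff]
        exact toComplIntegers_mem_maximalIdeal hlt
      have h2 : U.valuation (γL (algebraMap K L x)) ≤ 1 :=
        (ValuationSubring.valuation_le_one_iff _ _).mpr hx
      have h3 : U.valuation (γL (algebraMap K L x⁻¹)) < 1 := h1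
      have hx0 : x ≠ 0 := fun h0 => hxv (h0 ▸ zero_mem v.1)
      have h4 := mul_lt_one_of_nonneg_of_lt_one_right h2 zero_le h3
      rw [← map_mul, ← map_mul, ← map_mul, mul_inv_cancel₀ hx0, map_one, map_one, map_one] at h4
      exact lt_irrefl _ h4
    · intro hx
      exact hU ((⟨x, hx⟩ : v.1) ⊗ₜ 1)
  let w : Place L := ⟨W, fun h0 => v.2 (by rw [← hWv, h0]; rfl)⟩
  have h : w.LiesOver v := hWv
  have hwlt : ∀ y : w.1, U.valuation (γL y.1) < 1 → w.1.valuation y.1 < 1 := by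
    intro y hy
    refine lt_of_le_of_ne ((ValuationSubring.valuation_le_one_iff _ _).mpr y.2) fun h1 => ?_
    have hy0 : y.1 ≠ 0 := fun h0 => by simp [h0] at h1
    have h2 : y.1⁻¹ ∈ w.1 := by
      rw [← ValuationSubring.valuation_le_one_iff, map_inv₀, h1, inv_one]
    have h3 : U.valuation (γL y.1⁻¹) ≤ 1 := (ValuationSubring.valuation_le_one_iff _ _).mpr h2
    have h4 := mul_lt_one_of_nonneg_of_lt_one_right h3 zero_le hy
    rw [← map_mul, ← map_mul, inv_mul_cancel₀ hy0, map_one, map_one] at h4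
    exact lt_irrefl _ h4
  refine ⟨w, h, fun ψ hψl hψr => ?_⟩
  have hψl' : ∀ d, ψ (d ⊗ₜ 1) = sIntegersToCompl (notMem_placesOver hv h) d := fun d =>
    DFunLike.congr_fun hψl d
  have hψr' : ∀ a, ψ (1 ⊗ₜ a) = complIntegersMap h (χ a) := fun a =>
    DFunLike.congr_fun hψr a
  let i := Algebra.TensorProduct.map (sIntegersVal L S) (AlgHom.id (sIntegers S) A)
  -- Each x has a common approximation y in the valuation ring of w, modulo the maximal ideal of U
  -- at the generic point and modulo that of 𝒪_w along ψ. It exists because χ(a) is congruent to an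
  -- element of K. For x in q the first congruence forces y, and then ψ x, into the maximal ideal.
  have key : ∀ x, ∃ y : w.1, U.valuation (γ (i x) - γL y.1) < 1 ∧
      ψ x - toComplIntegers w y ∈ IsLocalRing.maximalIdeal (complIntegers w) := by
    intro x
    induction x with
    | zero => exact ⟨0, by simp, by simp⟩
    | add x x' hx hx' =>
      obtain ⟨y, h1, h2⟩ := hx
      obtain ⟨y', h1', h2'⟩ := hx'
      refine ⟨y + y', ?_, ?_⟩
      · rw [map_add, map_add, AddMemClass.coe_add, map_add, add_sub_add_comm]
        exact (Valuation.map_add_lt _ h1 h1')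
      · rw [map_add, map_add, add_sub_add_comm]
        exact add_mem h2 h2'
    | tmul d a =>
      obtain ⟨b, hb⟩ := exists_sub_toComplIntegers_mem_maximalIdeal v (χ a)
      have hdw : d.1 ∈ w.1 := d.2 w (notMem_placesOver hv h)
      have hbw : algebraMap K L b.1 ∈ w.1 := (h.mem_iff _).mpr b.2
      have hda : d ⊗ₜ[sIntegers S] a = d ⊗ₜ[sIntegers S] (1 : A) * (1 ⊗ₜ a) := by simp
      refine ⟨⟨d.1, hdw⟩ * ⟨_, hbw⟩, ?_, ?_⟩
      · have h1 : U.valuation (g (1 ⊗ₜ a - b ⊗ₜ 1)) < 1 := by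
          apply hU'
          rw [map_sub, hρ, hρ, map_one, map_one, one_mul, mul_one, ← map_sub,
            IsLocalRing.residue_eq_zero_iff]
          exact hb
        have h2 : U.valuation (γL d.1) ≤ 1 := (ValuationSubring.valuation_le_one_iff _ _).mpr hdw
        have h3 : γ (i (d ⊗ₜ a)) - γL (d.1 * algebraMap K L b.1) =
            γL d.1 * g (1 ⊗ₜ a - b ⊗ₜ 1) := by
          rw [hda, map_mul, map_mul, map_mul, map_sub, mul_sub, hg, hg, OneMemClass.coe_one,
            map_one]
          rfl
        have h4 := mul_lt_one_of_nonneg_of_lt_one_right h2 zero_le h1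
        rw [← map_mul, ← h3] at h4
        exact h4
      · have h1 : toComplIntegers w (⟨d.1, hdw⟩ * ⟨_, hbw⟩) =
            sIntegersToCompl (notMem_placesOver hv h) d * complIntegersMap h (toComplIntegers v b) := by
          rw [map_mul]
          congr 1
          exact Subtype.ext (complMap_toCompl h b.1).symm
        have h2 : ψ (d ⊗ₜ a) = sIntegersToCompl (notMem_placesOver hv h) d *
            complIntegersMap h (χ a) := by
          rw [hda, map_mul, hψl', hψr']
        have h3 := complIntegersMap_mem_maximalIdeal h hb
        rw [map_sub] at h3
        rw [h2, h1, ← mul_sub]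
        exact Ideal.mul_mem_left _ _ h3
  rw [Ideal.map_le_iff_le_comap]
  intro x hx
  obtain ⟨y, h1, h2⟩ := key x
  have h3 : γ (i x) = 0 := (hγ _).mpr hx
  rw [h3, zero_sub, Valuation.map_neg] at h1
  have h4 := toComplIntegers_mem_maximalIdeal (hwlt y h1)
  have h5 := add_mem h2 h4
  rwa [sub_add_cancel] at h5

end SemiIntegral

end

noncomputable section

namespace SemiIntegral

/-! ### Descent of a geometric component to a finite separable extension -/

open TensorProduct Filter

/-- Kb is purely inseparable over the separable closure of K in it. As p-powers are additive, a high
p-power of a tensor has all its scalars separable over K. -/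
theorem exists_pow_mem_range_map {R K Kb A : Type u} [CommRing R] [Field K] [Field Kb]
    [CommRing A] [Algebra R K] [Algebra R Kb] [Algebra K Kb] [IsScalarTower R K Kb]
    [Algebra.IsAlgebraic K Kb] [Algebra R A] [Nontrivial (Kb ⊗[R] A)] (z : Kb ⊗[R] A) (n : ℕ)
    [ExpChar K n] :
    ∃ (m : ℕ) (F : Finset Kb), (∀ x ∈ F, IsSeparable K x) ∧
      ∀ (L : Type u) [Field L] [Algebra R L] (f : L →ₐ[R] Kb), (∀ x ∈ F, x ∈ f.range) →
        z ^ n ^ m ∈ (Algebra.TensorProduct.map f (AlgHom.id R A)).range := by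
  classical
  have : ExpChar Kb n := expChar_of_injective_algebraMap (algebraMap K Kb).injective n
  have : ExpChar (Kb ⊗[R] A) n :=
    expChar_of_injective_algebraMap (algebraMap Kb (Kb ⊗[R] A)).injective n
  induction z with
  | zero =>
    refine ⟨0, ∅, by simp, fun L _ _ f _ => ?_⟩
    rw [pow_zero, pow_one]
    exact zero_mem _
  | tmul x a =>
    obtain ⟨m, y, hy⟩ := IsPurelyInseparable.pow_mem (separableClosure K Kb) n x
    refine ⟨m, {x ^ n ^ m}, ?_, fun L _ _ f h => ?_⟩
    · intro x' hx'
      rw [Finset.mem_singleton.mp hx', ← hy]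
      exact mem_separableClosure_iff.mp y.2
    · obtain ⟨t, ht⟩ := h _ (Finset.mem_singleton_self _)
      refine ⟨t ⊗ₜ (a ^ n ^ m), ?_⟩
      rw [Algebra.TensorProduct.tmul_pow]
      exact congrArg (· ⊗ₜ[R] (a ^ n ^ m)) ht
  | add z z' h h' =>
    obtain ⟨m, F, hF, h⟩ := h
    obtain ⟨m', F', hF', h'⟩ := h'
    refine ⟨m + m', F ∪ F', fun x hx => (Finset.mem_union.mp hx).elim (hF x) (hF' x),
      fun L _ _ f hf => ?_⟩
    rw [add_pow_expChar_pow]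
    refine add_mem ?_ ?_
    · rw [pow_add, pow_mul]
      exact pow_mem (h L f fun x hx => hf x (Finset.mem_union_left _ hx)) _
    · rw [add_comm m, pow_add, pow_mul]
      exact pow_mem (h' L f fun x hx => hf x (Finset.mem_union_right _ hx)) _

/-- Every power of the idempotent e still generates q modulo J. A suitable p-power of e is defined
over a finite separable extension, while J is defined over K. -/
theorem exists_finset_comap_map_eq {R K Kb A : Type u} [CommRing R] [Field K] [Field Kb]
    [CommRing A] [Algebra R K] [Algebra R Kb] [Algebra K Kb] [IsScalarTower R K Kb]
    [Algebra.IsAlgebraic K Kb] [Algebra R A] [Algebra.FiniteType R A] {I : Ideal A}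
    [Algebra.Smooth K (K ⊗[R] (A ⧸ I))] {q : Ideal (Kb ⊗[R] A)}
    (hq : q ∈ (I.map (Algebra.TensorProduct.includeRight : A →ₐ[R] Kb ⊗[R] A)).minimalPrimes) :
    ∃ F : Finset Kb, (∀ x ∈ F, IsSeparable K x) ∧
      ∀ (L : Type u) [Field L] [Algebra R L] (f : L →ₐ[R] Kb), (∀ x ∈ F, x ∈ f.range) →
        (q.comap (Algebra.TensorProduct.map f (AlgHom.id R A))).map
          (Algebra.TensorProduct.map f (AlgHom.id R A)) = q := by
  set J := I.map (Algebra.TensorProduct.includeRight : A →ₐ[R] Kb ⊗[R] A) with hJ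
  have : Algebra.Smooth Kb (Kb ⊗[R] A ⧸ J) := smooth_tensor_quotient (K := K)
  have hqp : q.IsPrime := hq.1.1
  have : Nontrivial (Kb ⊗[R] A) := ⟨0, 1, fun h => hqp.ne_top
    ((Ideal.eq_top_iff_one q).mpr (h ▸ q.zero_mem))⟩
  obtain ⟨e, heq, -, he2⟩ := exists_idempotent_of_mem_minimalPrimes Kb hq
  have hpow : ∀ (k : ℕ), ∀ x ∈ q, x - e ^ k * x ∈ J := by
    intro k
    induction k with
    | zero => intro x hx; simp
    | succ k ih =>
      intro x hx
      have h1 := J.add_mem (he2 x hx) (ih _ (q.mul_mem_left e hx))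
      rwa [sub_add_sub_cancel, ← mul_assoc, ← pow_succ] at h1
  obtain ⟨m, F, hF, h⟩ := exists_pow_mem_range_map (K := K) e (ringExpChar K)
  refine ⟨F, hF, fun L _ _ f hf => le_antisymm Ideal.map_comap_le fun x hx => ?_⟩
  obtain ⟨y, hy⟩ := h L f hf
  have hJle : J ≤ (q.comap (Algebra.TensorProduct.map f (AlgHom.id R A))).map
          (Algebra.TensorProduct.map f (AlgHom.id R A)) := by
    rw [hJ, Ideal.map_le_iff_le_comap]
    intro a ha
    have h1 : (Algebra.TensorProduct.map f (AlgHom.id R A)) (1 ⊗ₜ a) = 1 ⊗ₜ a := by simp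
    have h2 : (1 : Kb) ⊗ₜ[R] a ∈ q := hq.1.2 (Ideal.mem_map_of_mem _ ha)
    rw [Ideal.mem_comap, Algebra.TensorProduct.includeRight_apply, ← h1]
    exact Ideal.mem_map_of_mem _ (by rw [Ideal.mem_comap, h1]; exact h2)
  have h3 : e ^ ringExpChar K ^ m ∈ q :=
    Ideal.pow_mem_of_mem _ heq _ (pow_pos (expChar_pos K _) _)
  have h4 : e ^ ringExpChar K ^ m ∈ (q.comap (Algebra.TensorProduct.map f (AlgHom.id R A))).map
          (Algebra.TensorProduct.map f (AlgHom.id R A)) := by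
    rw [← hy] at h3 ⊢
    exact Ideal.mem_map_of_mem _ h3
  have h5 := add_mem (hJle (hpow (ringExpChar K ^ m) x hx)) (Ideal.mul_mem_right x _ h4)
  rwa [sub_add_cancel] at h5

end SemiIntegral

end

noncomputable section

namespace SemiIntegral

/-! ### Components on affine charts -/

section Components

variable {T : Type*} [CommRing T] {Z : Type*} [TopologicalSpace Z] {j : PrimeSpectrum T → Z}


theorem closure_image_preimage (hj : Topology.IsOpenEmbedding j) {C : Closeds Z} (hC : IsIrreducible (C : Set Z))
    (hne : (j ⁻¹' (C : Set Z)).Nonempty) : closure (j '' (j ⁻¹' (C : Set Z))) = C := by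
  have h1 := closure_image_preimage_of_isPreirreducible j hj.isOpenMap (C : Set Z)
    hne hC.2
  exact h1 C.isClosed

theorem vanishingIdeal_preimage_eq_top {C : Closeds Z} (h : ¬ (j ⁻¹' (C : Set Z)).Nonempty) :
    PrimeSpectrum.vanishingIdeal (j ⁻¹' (C : Set Z)) = ⊤ := by
  rw [Set.not_nonempty_iff_eq_empty.mp h, PrimeSpectrum.vanishingIdeal_empty]

theorem mem_vanishingIdeal_preimage_iff (hj : Topology.IsOpenEmbedding j) {C : Closeds Z} (x : PrimeSpectrum T) :
    PrimeSpectrum.vanishingIdeal (j ⁻¹' (C : Set Z)) ≤ x.asIdeal ↔ j x ∈ C := by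
  have h1 : IsClosed (j ⁻¹' (C : Set Z)) := C.isClosed.preimage hj.continuous
  have h2 := PrimeSpectrum.zeroLocus_vanishingIdeal_eq_closure (j ⁻¹' (C : Set Z))
  rw [h1.closure_eq] at h2
  exact (Set.ext_iff.mp h2 x : _ ↔ _)

/-- Irreducible closed sets meeting an open chart correspond to primes of the chart, by closure and
restriction, and this matches components with minimal primes; `isComponent_closure` is the converse.
-/
theorem IsComponent.mem_minimalPrimes {C D : Closeds Z} (h : IsComponent C D)
    (hj : Topology.IsOpenEmbedding j)
    {J : Ideal T} (hJ : ∀ x : PrimeSpectrum T, j x ∈ D ↔ J ≤ x.asIdeal)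
    (hne : (j ⁻¹' (C : Set Z)).Nonempty) :
    PrimeSpectrum.vanishingIdeal (j ⁻¹' (C : Set Z)) ∈ J.minimalPrimes := by
  have hirr : IsIrreducible (j ⁻¹' (C : Set Z)) := by
    obtain ⟨x, hx⟩ := hne
    exact ⟨⟨x, hx⟩, h.1.1.2.preimage hj⟩
  have hp := PrimeSpectrum.isIrreducible_iff_vanishingIdeal_isPrime.mp hirr
  refine ⟨⟨hp, ?_⟩, ?_⟩
  · let x : PrimeSpectrum T := ⟨_, hp⟩
    exact (hJ x).mp (h.1.2 ((mem_vanishingIdeal_preimage_iff hj x).mp le_rfl))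
  · rintro P ⟨hP, hJP⟩ hPle
    let y : PrimeSpectrum T := ⟨P, hP⟩
    let C' : Closeds Z := ⟨closure {j y}, isClosed_closure⟩
    have hC' : C' ≤ D := D.isClosed.closure_subset_iff.mpr
      (Set.singleton_subset_iff.mpr ((hJ y).mpr hJP))
    have hCC' : C ≤ C' := by
      change (C : Set Z) ⊆ closure {j y}
      rw [← closure_image_preimage hj h.1.1 hne]
      refine closure_minimal ?_ isClosed_closure
      rintro _ ⟨x, hx, rfl⟩
      have h1 : y ⤳ x := by
        rw [← PrimeSpectrum.le_iff_specializes]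
        exact hPle.trans ((mem_vanishingIdeal_preimage_iff hj x).mpr hx)
      exact (h1.map hj.continuous).mem_closure
    have h2 := h.2 ⟨isIrreducible_singleton.closure, hC'⟩ hCC'
    exact (mem_vanishingIdeal_preimage_iff hj y).mpr (h2 (subset_closure rfl))

theorem isComponent_closure (hj : Topology.IsOpenEmbedding j) {D : Closeds Z} {J : Ideal T}
    (hJ : ∀ x : PrimeSpectrum T, j x ∈ D ↔ J ≤ x.asIdeal) (x : PrimeSpectrum T)
    (hx : x.asIdeal ∈ J.minimalPrimes) :
    IsComponent ⟨closure {j x}, isClosed_closure⟩ D ∧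
      PrimeSpectrum.vanishingIdeal (j ⁻¹' closure {j x}) = x.asIdeal := by
  constructor
  · refine ⟨⟨isIrreducible_singleton.closure, D.isClosed.closure_subset_iff.mpr
      (Set.singleton_subset_iff.mpr ((hJ x).mpr hx.1.2))⟩, ?_⟩
    rintro C' ⟨hirr, hC'⟩ hle
    have hxC' : j x ∈ C' := hle (subset_closure rfl)
    have hne : (j ⁻¹' (C' : Set Z)).Nonempty := ⟨x, hxC'⟩
    have hirr' : IsIrreducible (j ⁻¹' (C' : Set Z)) :=
      ⟨hne, hirr.2.preimage hj⟩
    have hp := PrimeSpectrum.isIrreducible_iff_vanishingIdeal_isPrime.mp hirr'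
    have hJc : J ≤ PrimeSpectrum.vanishingIdeal (j ⁻¹' (C' : Set Z)) :=
      (hJ ⟨_, hp⟩).mp (hC' ((mem_vanishingIdeal_preimage_iff hj ⟨_, hp⟩).mp le_rfl))
    have h1 := hx.2 ⟨hp, hJc⟩ ((mem_vanishingIdeal_preimage_iff hj x).mpr hxC')
    change (C' : Set Z) ⊆ closure {j x}
    rw [← closure_image_preimage hj hirr hne]
    refine closure_minimal ?_ isClosed_closure
    rintro _ ⟨y, hy, rfl⟩
    have h2 : x ⤳ y := by
      rw [← PrimeSpectrum.le_iff_specializes]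
      exact h1.trans ((mem_vanishingIdeal_preimage_iff hj y).mpr hy)
    exact (h2.map hj.continuous).mem_closure
  · rw [hj.isOpenMap.preimage_closure_eq_closure_preimage hj.continuous,
      PrimeSpectrum.vanishingIdeal_closure]
    have : j ⁻¹' {j x} = {x} := by
      ext y
      exact ⟨fun h => hj.injective h, fun h => congrArg j h⟩
    rw [this]
    exact PrimeSpectrum.vanishingIdeal_singleton x

end Components

/-- An irreducible set inside a finite union of closed sets lies in one of them. The last hypothesis
says that this one can only be E i. -/
theorem IsComponent.of_iUnion {Z : Type*} [TopologicalSpace Z] {ι : Type*} {s : Set ι}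
    (hs : s.Finite) {E : ι → Closeds Z} {U C : Closeds Z}
    (hU : (U : Set Z) = ⋃ i ∈ s, E i) {i : ι} (hi : i ∈ s) (hC : IsComponent C (E i))
    (h : ∀ k ∈ s, C ≤ E k → E k = E i) : IsComponent C U := by
  refine ⟨⟨hC.1.1, fun x hx => ?_⟩, ?_⟩
  · have : x ∈ (U : Set Z) := by
      rw [hU]
      exact Set.mem_biUnion hi (hC.1.2 hx)
    exact this
  · rintro C' ⟨hirr, hle⟩ hCC'
    obtain ⟨k, hk, hk'⟩ : ∃ k ∈ s, (C' : Set Z) ⊆ E k := by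
      have h1 := isIrreducible_iff_sUnion_isClosed.mp hirr
        ((hs.image fun i => (E i : Set Z)).toFinset) (by
          intro z hz
          obtain ⟨k, -, rfl⟩ := (Set.Finite.mem_toFinset _).mp hz
          exact (E k).isClosed) (by
          intro x hx
          have : x ∈ (U : Set Z) := hle hx
          rw [hU] at this
          obtain ⟨k, hk, hxk⟩ := Set.mem_iUnion₂.mp this
          exact ⟨E k, by simpa using ⟨k, hk, rfl⟩, hxk⟩)
      obtain ⟨z, hz, hCz⟩ := h1
      obtain ⟨k, hk, rfl⟩ := (Set.Finite.mem_toFinset _).mp hz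
      exact ⟨k, hk, hCz⟩
    have h2 : E k = E i := h k hk (hCC'.trans hk')
    exact hC.2 ⟨hirr, h2 ▸ hk'⟩ hCC'

theorem finite_isComponent {Z : Type*} [TopologicalSpace Z] [NoetherianSpace Z] (D : Closeds Z) :
    {C | IsComponent C D}.Finite := by
  obtain ⟨s, hs, hirr, rfl⟩ := NoetherianSpace.exists_finite_set_closeds_irreducible D
  refine hs.subset fun C hC => ?_
  obtain ⟨z, hz, hCz⟩ : ∃ z ∈ s, C ≤ z := by
    obtain ⟨z, hz, hCz⟩ := isIrreducible_iff_sUnion_isClosed.mp hC.1.1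
      ((hs.image fun E : Closeds Z => (E : Set Z)).toFinset) (by
        intro z hz
        obtain ⟨k, -, rfl⟩ := (Set.Finite.mem_toFinset _).mp hz
        exact k.isClosed) (by
        have h2 : (C : Set Z) ⊆ closure (⋃₀ ((↑) '' s)) := hC.1.2
        rw [Set.Finite.coe_toFinset]
        refine h2.trans (IsClosed.closure_eq ?_).le
        rw [Set.sUnion_image]
        exact hs.isClosed_biUnion fun k _ => k.isClosed)
    obtain ⟨k, hk, rfl⟩ := (Set.Finite.mem_toFinset _).mp hz
    exact ⟨k, hk, hCz⟩
  have h3 := hC.2 ⟨hirr z hz, le_sSup hz⟩ hCz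
  rwa [le_antisymm hCz h3]

end SemiIntegral

end

noncomputable section

namespace SemiIntegral

/-! ### Affine charts of base changes -/

open Scheme TensorProduct

theorem le_of_forall_pullIdeal_le {Y : Scheme.{u}} {κ : Type*} {A : κ → CommRingCat.{u}}
    (j : ∀ i, Spec (A i) ⟶ Y) [∀ i, IsOpenImmersion (j i)]
    (hj : ∀ y : Y, ∃ i, y ∈ Set.range (j i)) {I J : Y.IdealSheafData}
    (h : ∀ i, pullIdeal (j i) I ≤ pullIdeal (j i) J) : I ≤ J := by
  refine IdealSheafData.le_of_iSup_eq_top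
    (fun i => ⟨(j i) ''ᵁ ⊤, (isAffineOpen_top _).image_of_isOpenImmersion (j i)⟩) ?_ fun i => ?_
  · rw [eq_top_iff]
    intro y _
    obtain ⟨i, x, hx⟩ := hj y
    exact Opens.mem_iSup.mpr ⟨i, x, trivial, hx⟩
  · have h1 : I.comap (j i) ≤ J.comap (j i) := (specIdeal _).le_iff_le.mp (h i)
    have h2 := h1 ⟨⊤, isAffineOpen_top _⟩
    rw [IdealSheafData.ideal_comap_of_isOpenImmersion,
      IdealSheafData.ideal_comap_of_isOpenImmersion] at h2
    exact (Ideal.comap_le_comap_iff_of_surjective _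
      (ConcreteCategory.bijective_of_isIso ((j i).appIso ⊤).inv).surjective _ _).mp h2

theorem preimage_closure_image {T T' Z Z' : Type*} [TopologicalSpace T] [TopologicalSpace Z]
    {j : T → Z} (hj : Topology.IsOpenEmbedding j) {j' : T' → Z'} {r : Z' → Z} {φ : T' → T}
    (hc : ∀ x, r (j' x) = j (φ x)) (hr : ∀ z, r z ∈ Set.range j → z ∈ Set.range j')
    (C : Set Z') : j ⁻¹' closure (r '' C) = closure (φ '' (j' ⁻¹' C)) := by
  rw [hj.isOpenMap.preimage_closure_eq_closure_preimage hj.continuous]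
  congr 1
  ext x
  constructor
  · rintro ⟨z, hz, hzx⟩
    obtain ⟨x', rfl⟩ := hr z (hzx ▸ ⟨x, rfl⟩)
    exact ⟨x', hz, hj.injective (by rw [← hc, hzx])⟩
  · rintro ⟨x', hx', rfl⟩
    exact ⟨j' x', hx', hc x'⟩

theorem vanishingIdeal_comap_image {A B : Type*} [CommRing A] [CommRing B] (φ : A →+* B)
    (C : Set (PrimeSpectrum B)) :
    PrimeSpectrum.vanishingIdeal (PrimeSpectrum.comap φ '' C) =
      (PrimeSpectrum.vanishingIdeal C).comap φ := by
  ext a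
  simp only [PrimeSpectrum.mem_vanishingIdeal, Set.forall_mem_image, Ideal.mem_comap]
  rfl

/-- The image of a reduced closed subscheme is the closure of its point set with reduced structure,
and on charts this is contraction of ideals. The condition `hr` says that j' covers the whole
preimage of the chart j. -/
theorem pullIdeal_map_vanishingIdeal {A A' : CommRingCat.{u}} {Z Z' : Scheme.{u}}
    {j : Spec A ⟶ Z} [IsOpenImmersion j] {j' : Spec A' ⟶ Z'} {r : Z' ⟶ Z} {φ : A ⟶ A'}
    (hc : j' ≫ r = Spec.map φ ≫ j) (hr : ∀ z, r z ∈ Set.range j → z ∈ Set.range j')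
    (C : Closeds Z') :
    pullIdeal j ((IdealSheafData.vanishingIdeal C).map r) =
      (PrimeSpectrum.vanishingIdeal (j' ⁻¹' (C : Set Z'))).comap φ.hom := by
  have h1 : j ⁻¹' closure (r '' (C : Set Z')) = closure (Spec.map φ '' (j' ⁻¹' (C : Set Z'))) :=
    preimage_closure_image j.isOpenEmbedding (fun x => by
      rw [← Hom.comp_apply, hc, Hom.comp_apply]) hr _
  rw [IdealSheafData.map_vanishingIdeal, pullIdeal_vanishingIdeal]
  refine (congrArg PrimeSpectrum.vanishingIdeal h1).trans ?_
  exact (PrimeSpectrum.vanishingIdeal_closure _).trans (vanishingIdeal_comap_image φ.hom _)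

section Chart

variable {R : Type u} [CommRing R] {Y : Scheme.{u}} {s : Y ⟶ Spec (.of R)} {A : Type u}
  [CommRing A] [Algebra R A] {j : Spec (.of A) ⟶ Y}
  (hj : j ≫ s = Spec.map (CommRingCat.ofHom (algebraMap R A)))
  {R' : Type u} [CommRing R'] [Algebra R R'] {Z : Scheme.{u}} {p : Z ⟶ Y}
  {t : Z ⟶ Spec (.of R')}
  (hZ : IsPullback p t s (Spec.map (CommRingCat.ofHom (algebraMap R R'))))

theorem isPullback_spec_tensor (R R' A : Type u) [CommRing R] [CommRing R'] [CommRing A]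
    [Algebra R R'] [Algebra R A] :
    IsPullback
      (Spec.map (CommRingCat.ofHom
        (Algebra.TensorProduct.includeRight : A →ₐ[R] R' ⊗[R] A).toRingHom))
      (Spec.map (CommRingCat.ofHom (Algebra.TensorProduct.includeLeftRingHom : R' →+* R' ⊗[R] A)))
      (Spec.map (CommRingCat.ofHom (algebraMap R A)))
      (Spec.map (CommRingCat.ofHom (algebraMap R R'))) :=
  (isPullback_SpecMap_of_isPushout _ _ _ _ (CommRingCat.isPushout_tensorProduct R R' A)).flip

/-- The affine chart `Spec (R' ⊗ A)` of a base change of `Y` to `R'`, for a chart `Spec A` of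
`Y`. -/
def chartMap : Spec (.of (R' ⊗[R] A)) ⟶ Z :=
  hZ.lift (Spec.map (CommRingCat.ofHom
      (Algebra.TensorProduct.includeRight : A →ₐ[R] R' ⊗[R] A).toRingHom) ≫ j)
    (Spec.map (CommRingCat.ofHom Algebra.TensorProduct.includeLeftRingHom)) (by
      rw [Category.assoc, hj, (isPullback_spec_tensor R R' A).w])

theorem chartMap_fst : chartMap hj hZ ≫ p = Spec.map (CommRingCat.ofHom
      (Algebra.TensorProduct.includeRight : A →ₐ[R] R' ⊗[R] A).toRingHom) ≫ j :=
  hZ.lift_fst _ _ _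

theorem chartMap_snd : chartMap hj hZ ≫ t =
    Spec.map (CommRingCat.ofHom Algebra.TensorProduct.includeLeftRingHom) :=
  hZ.lift_snd _ _ _

theorem isPullback_chartMap : IsPullback (chartMap hj hZ) (Spec.map (CommRingCat.ofHom
      (Algebra.TensorProduct.includeRight : A →ₐ[R] R' ⊗[R] A).toRingHom)) p j := by
  refine IsPullback.of_right ?_ (chartMap_fst hj hZ) hZ.flip
  rw [chartMap_snd, hj]
  exact (isPullback_spec_tensor R R' A).flip

instance isOpenImmersion_chartMap [IsOpenImmersion j] : IsOpenImmersion (chartMap hj hZ) :=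
  MorphismProperty.of_isPullback (isPullback_chartMap hj hZ).flip inferInstance

theorem mem_range_chartMap {z : Z} (h : p z ∈ Set.range j) :
    z ∈ Set.range (chartMap hj hZ) := by
  have h1 := (isPullback_chartMap hj hZ).isoPullback_hom_fst
  have h2 : z ∈ Set.range (pullback.fst p j) := by
    rw [Pullback.range_fst]
    exact h
  rw [← h1]
  obtain ⟨x, rfl⟩ := h2
  refine ⟨(isPullback_chartMap hj hZ).isoPullback.inv x, ?_⟩
  rw [← Hom.comp_apply, Iso.inv_hom_id_assoc]

theorem chartMap_comp {R'' : Type u} [CommRing R''] [Algebra R R''] {Z' : Scheme.{u}}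
    {p' : Z' ⟶ Y} {t' : Z' ⟶ Spec (.of R'')}
    (hZ' : IsPullback p' t' s (Spec.map (CommRingCat.ofHom (algebraMap R R''))))
    (f : R' →ₐ[R] R'') {r : Z' ⟶ Z} (hr : r ≫ p = p')
    (hr' : r ≫ t = t' ≫ Spec.map (CommRingCat.ofHom f.toRingHom)) :
    chartMap hj hZ' ≫ r = Spec.map (CommRingCat.ofHom
      (Algebra.TensorProduct.map f (AlgHom.id R A)).toRingHom) ≫ chartMap hj hZ := by
  apply hZ.hom_ext
  · rw [Category.assoc, hr, chartMap_fst, Category.assoc, chartMap_fst, ← Category.assoc,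
      ← Spec.map_comp, ← CommRingCat.ofHom_comp]
    congr 3
    ext a
    simp
  · rw [Category.assoc, hr', ← Category.assoc, chartMap_snd, Category.assoc, chartMap_snd,
      ← Spec.map_comp, ← Spec.map_comp, ← CommRingCat.ofHom_comp, ← CommRingCat.ofHom_comp]
    congr 2

/-- The only open neighbourhood of the closed point of a local scheme is the whole scheme. -/
theorem exists_eq_specMap_comp {T : CommRingCat.{u}} (i : Spec T ⟶ Z) [IsOpenImmersion i]
    {O : Type u} [CommRing O] [IsLocalRing O] (y : Spec (.of O) ⟶ Z)
    (hy : y (IsLocalRing.closedPoint O) ∈ Set.range i) :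
    ∃ φ : T ⟶ .of O, y = Spec.map φ ≫ i := by
  have h1 : Set.range y ⊆ Set.range i := by
    have h2 : y ⁻¹ᵁ i.opensRange = ⊤ :=
      (IsLocalRing.closedPoint_mem_iff (R := O) (y ⁻¹ᵁ i.opensRange)).mp hy
    rintro _ ⟨x, rfl⟩
    have : x ∈ y ⁻¹ᵁ i.opensRange := h2 ▸ trivial
    exact this
  refine ⟨Spec.preimage (IsOpenImmersion.lift i y h1), ?_⟩
  rw [Spec.map_preimage, IsOpenImmersion.lift_fac]

end Chart

end SemiIntegral

end

/-! ### Affine charts of a model and closures of the divisors -/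

noncomputable section

namespace SemiIntegral

open Scheme TensorProduct

theorem exists_isOpenImmersion_subscheme {B : CommRingCat.{u}} {Y : Scheme.{u}} (j : Spec B ⟶ Y)
    [IsOpenImmersion j] (Z : Y.IdealSheafData) :
    ∃ g : Spec (.of (B ⧸ pullIdeal j Z)) ⟶ Z.subscheme, IsOpenImmersion g ∧
      g ≫ Z.subschemeι =
        Spec.map (CommRingCat.ofHom (Ideal.Quotient.mk (pullIdeal j Z))) ≫ j := by
  let f : Spec (.of (B ⧸ pullIdeal j Z)) ⟶ Spec B :=
    Spec.map (CommRingCat.ofHom (Ideal.Quotient.mk (pullIdeal j Z)))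
  have hf : IsClosedImmersion f :=
    IsClosedImmersion.spec_of_surjective _ Ideal.Quotient.mk_surjective
  have hker : f.ker = Z.comap j := by
    apply (specIdeal B).injective
    rw [specIdeal_ker]
    exact Ideal.mk_ker
  have h : (Z.comap j).subschemeι.ker = f.ker := by rw [IdealSheafData.ker_subschemeι, hker]
  have := IsClosedImmersion.isIso_lift (Z.comap j).subschemeι f h
  refine ⟨IsClosedImmersion.lift (Z.comap j).subschemeι f h.le ≫ (Z.comapIso j).hom ≫
    pullback.snd _ _, inferInstance, ?_⟩
  rw [Category.assoc, Category.assoc, ← pullback.condition, IdealSheafData.comapIso_hom_fst_assoc,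
    IsClosedImmersion.lift_fac_assoc]

theorem mem_support_iff_pullIdeal_le {B : CommRingCat.{u}} {Y : Scheme.{u}} (j : Spec B ⟶ Y)
    (Z : Y.IdealSheafData) (x : PrimeSpectrum B) :
    j x ∈ Z.support ↔ pullIdeal j Z ≤ x.asIdeal := by
  have h := coe_support_eq_zeroLocus_specIdeal (Z.comap j)
  rw [IdealSheafData.support_comap] at h
  exact (Set.ext_iff.mp h x : _)

variable {K : Type u} [Field K] {ι : Type w} {X : CampanaOrbifold K ι} {S : Set (Place K)}

/-- An affine open chart of a model. -/
structure Model.Chart (M : Model X S) where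
  /-- The coordinate ring. -/
  A : Type u
  [commRing : CommRing A]
  [algebra : Algebra (sIntegers S) A]
  [finiteType : Algebra.FiniteType (sIntegers S) A]
  /-- The inclusion. -/
  j : Spec (.of A) ⟶ M.Y
  [isOpenImmersion : IsOpenImmersion j]
  j_str : j ≫ M.str = Spec.map (CommRingCat.ofHom (algebraMap (sIntegers S) A))

attribute [instance] Model.Chart.commRing Model.Chart.algebra Model.Chart.finiteType
  Model.Chart.isOpenImmersion

namespace Model

variable (M : Model X S)

theorem exists_chart (y : M.Y) : ∃ c : M.Chart, y ∈ Set.range c.j := by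
  have := M.isProper
  obtain ⟨U, hU, hyU⟩ : ∃ U : M.Y.Opens, IsAffineOpen U ∧ y ∈ U := by
    obtain ⟨U, hU, hy, -⟩ := exists_isAffineOpen_mem_and_subset (x := y) (U := ⊤) trivial
    exact ⟨U, hU, hy⟩
  let φ := Spec.preimage (hU.fromSpec ≫ M.str)
  have hφ : Spec.map φ = hU.fromSpec ≫ M.str := Spec.map_preimage _
  let : Algebra (sIntegers S) Γ(M.Y, U) := φ.hom.toAlgebra
  have hft : φ.hom.FiniteType := by
    have h1 : LocallyOfFiniteType (Spec.map φ) := by rw [hφ]; infer_instance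
    exact HasRingHomProperty.Spec_iff.mp h1
  have : Algebra.FiniteType (sIntegers S) Γ(M.Y, U) := hft
  refine ⟨⟨Γ(M.Y, U), hU.fromSpec, hφ.symm⟩, ?_⟩
  rw [hU.range_fromSpec]
  exact hyU

theorem exists_finite_charts [CompactSpace M.Y] :
    ∃ s : Set M.Chart, s.Finite ∧ ∀ y, ∃ c ∈ s, y ∈ Set.range c.j := by
  choose c hc using M.exists_chart
  obtain ⟨t, ht⟩ := isCompact_univ.elim_finite_subcover (fun y => Set.range (c y).j)
    (fun y => (c y).j.isOpenEmbedding.isOpen_range) (fun y _ => Set.mem_iUnion.mpr ⟨y, hc y⟩)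
  refine ⟨c '' t, t.finite_toSet.image c, fun y => ?_⟩
  obtain ⟨i, hi, hy⟩ := Set.mem_iUnion₂.mp (ht (Set.mem_univ y))
  exact ⟨c i, ⟨i, hi, rfl⟩, hy⟩

end Model

instance (M : Model X S) : CompactSpace M.Y := by
  have := M.isProper
  exact QuasiCompact.compactSpace_of_compactSpace M.str

end SemiIntegral

end

noncomputable section

namespace SemiIntegral

open Scheme TensorProduct

variable {K : Type u} [Field K] {ι : Type w} {X : CampanaOrbifold K ι} {S : Set (Place K)}

namespace Model

variable (M : Model X S)

theorem isPullback_overFst (L : Type u) [Field L] [Algebra K L] :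
    IsPullback (X.overFst L ≫ M.gen)
      (pullback.snd X.str (Spec.map (CommRingCat.ofHom (algebraMap K L)))) M.str
      (Spec.map (CommRingCat.ofHom (algebraMap (sIntegers S) L))) := by
  have h := (IsPullback.of_hasPullback X.str
    (Spec.map (CommRingCat.ofHom (algebraMap K L)))).flip.paste_vert M.isPullback.flip
  rw [← Spec.map_comp, ← CommRingCat.ofHom_comp] at h
  exact h.flip

namespace Chart

variable {M} (c : M.Chart)

/-- The affine chart of the generic fibre. -/
def gen : Spec (.of (K ⊗[sIntegers S] c.A)) ⟶ X.X :=
  chartMap (R' := K) c.j_str M.isPullback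

instance : IsOpenImmersion c.gen := isOpenImmersion_chartMap (R' := K) c.j_str M.isPullback

theorem gen_comp_gen : c.gen ≫ M.gen = Spec.map (CommRingCat.ofHom
    (Algebra.TensorProduct.includeRight :
      c.A →ₐ[sIntegers S] K ⊗[sIntegers S] c.A).toRingHom) ≫ c.j :=
  chartMap_fst (R' := K) c.j_str M.isPullback

theorem gen_comp_str : c.gen ≫ X.str = Spec.map (CommRingCat.ofHom
    (Algebra.TensorProduct.includeLeftRingHom : K →+* K ⊗[sIntegers S] c.A)) :=
  chartMap_snd (R' := K) c.j_str M.isPullback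

/-- The ideal of `𝒟_α` on a chart. -/
def ideal (α : ι) : Ideal c.A := pullIdeal c.j (M.ideal α)

theorem mem_support_iff (α : ι) (x : PrimeSpectrum c.A) :
    c.j x ∈ (M.ideal α).support ↔ c.ideal α ≤ x.asIdeal :=
  mem_support_iff_pullIdeal_le c.j _ x

/-- The ideal of `D_α` on a chart of the generic fibre. -/
def genIdeal (α : ι) : Ideal (K ⊗[sIntegers S] c.A) :=
  PrimeSpectrum.vanishingIdeal (c.gen ⁻¹' (X.D α : Set X.X))

theorem comap_genIdeal (α : ι) : (c.genIdeal α).comap (Algebra.TensorProduct.includeRight :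
    c.A →ₐ[sIntegers S] K ⊗[sIntegers S] c.A) = c.ideal α :=
  (pullIdeal_map_vanishingIdeal c.gen_comp_gen
    (fun _ h => mem_range_chartMap (R' := K) c.j_str M.isPullback h) (X.D α)).symm

theorem gen_mem_iff (α : ι) (x : PrimeSpectrum (K ⊗[sIntegers S] c.A)) :
    c.gen x ∈ X.D α ↔ c.genIdeal α ≤ x.asIdeal :=
  (mem_vanishingIdeal_preimage_iff c.gen.isOpenEmbedding x).symm

theorem genIdeal_isPrime_or_eq_top (α : ι) : (c.genIdeal α).IsPrime ∨ c.genIdeal α = ⊤ := by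
  by_cases h : (c.gen ⁻¹' (X.D α : Set X.X)).Nonempty
  · left
    exact PrimeSpectrum.isIrreducible_iff_vanishingIdeal_isPrime.mp
      ⟨h, (X.irreducible α).2.preimage c.gen.isOpenEmbedding⟩
  · exact .inr (vanishingIdeal_preimage_eq_top h)

/-- Contraction followed by extension is the identity, because the generic fibre is a localization
of the chart. -/
theorem map_ideal [IsFractionRing (sIntegers S) K] (α : ι) :
    (c.ideal α).map (Algebra.TensorProduct.includeRight :
      c.A →ₐ[sIntegers S] K ⊗[sIntegers S] c.A) = c.genIdeal α := by
  rw [← comap_genIdeal]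
  refine le_antisymm Ideal.map_comap_le fun x hx => ?_
  obtain ⟨b, hb, a, hba⟩ := exists_smul_eq_one_tmul (R := sIntegers S) (V := K)
    (M := nonZeroDivisors (sIntegers S)) (fun x => by
      obtain ⟨a, b, hb, rfl⟩ := IsFractionRing.div_surjective (A := sIntegers S) x
      refine ⟨b, hb, a, ?_⟩
      rw [mul_div_cancel₀]
      exact IsFractionRing.to_map_ne_zero_of_mem_nonZeroDivisors hb) x
  have hu : IsUnit (algebraMap (sIntegers S) (K ⊗[sIntegers S] c.A) b) := by
    rw [IsScalarTower.algebraMap_apply (sIntegers S) K]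
    exact (isUnit_iff_ne_zero.mpr (IsFractionRing.to_map_ne_zero_of_mem_nonZeroDivisors hb)).map _
  rw [Algebra.smul_def] at hba
  have h1 : a ∈ (c.genIdeal α).comap (Algebra.TensorProduct.includeRight :
      c.A →ₐ[sIntegers S] K ⊗[sIntegers S] c.A) := by
    rw [Ideal.mem_comap, Algebra.TensorProduct.includeRight_apply, ← hba]
    exact Ideal.mul_mem_left _ _ hx
  have h2 := Ideal.mem_map_of_mem (Algebra.TensorProduct.includeRight :
      c.A →ₐ[sIntegers S] K ⊗[sIntegers S] c.A) h1
  rw [Algebra.TensorProduct.includeRight_apply, ← hba] at h2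
  exact (Ideal.unit_mul_mem_iff_mem _ hu).mp h2

theorem ideal_isPrime {α : ι} (h : c.ideal α ≠ ⊤) : (c.ideal α).IsPrime := by
  rw [← comap_genIdeal] at h ⊢
  obtain h1 | h1 := c.genIdeal_isPrime_or_eq_top α
  · exact Ideal.comap_isPrime _ _
  · rw [h1, Ideal.comap_top] at h
    exact absurd rfl h

/-- The ideal of the closure is contracted from the generic fibre, so the closure has no vertical
part. -/
theorem injective_one_tmul (α : ι) :
    Function.Injective fun n : c.A ⧸ c.ideal α => (1 : K) ⊗ₜ[sIntegers S] n := by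
  change Function.Injective (Algebra.TensorProduct.includeRight :
      (c.A ⧸ c.ideal α) →ₐ[sIntegers S] K ⊗[sIntegers S] (c.A ⧸ c.ideal α))
  rw [injective_iff_map_eq_zero]
  intro n hn
  obtain ⟨a, rfl⟩ := Ideal.Quotient.mk_surjective n
  rw [Ideal.Quotient.eq_zero_iff_mem]
  have h1 : (1 : K) ⊗ₜ[sIntegers S] a ∈ (c.ideal α).map (Algebra.TensorProduct.includeRight :
      c.A →ₐ[sIntegers S] K ⊗[sIntegers S] c.A) := by
    rw [mem_map_includeRight_iff, Algebra.TensorProduct.map_tmul]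
    exact hn
  have h2 : (c.ideal α).map (Algebra.TensorProduct.includeRight :
      c.A →ₐ[sIntegers S] K ⊗[sIntegers S] c.A) ≤ c.genIdeal α := by
    rw [← comap_genIdeal]
    exact Ideal.map_comap_le
  rw [← comap_genIdeal]
  exact h2 h1

theorem smooth [IsFractionRing (sIntegers S) K] (hD : X.SmoothComponents) (α : ι) :
    Algebra.Smooth K (K ⊗[sIntegers S] (c.A ⧸ c.ideal α)) := by
  have hJ : pullIdeal c.gen (X.ideal α) = c.genIdeal α := pullIdeal_vanishingIdeal c.gen (X.D α)
  obtain ⟨g, hg, hg'⟩ := exists_isOpenImmersion_subscheme c.gen (X.ideal α)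
  have h1 : Smooth ((X.ideal α).subschemeι ≫ X.str) := hD α
  have h2 : Smooth (g ≫ (X.ideal α).subschemeι ≫ X.str) := inferInstance
  rw [← Category.assoc, hg', Category.assoc, gen_comp_str, ← Spec.map_comp] at h2
  have h3 := HasRingHomProperty.Spec_iff.mp h2
  have h4 : Algebra.Smooth K (K ⊗[sIntegers S] c.A ⧸ pullIdeal c.gen (X.ideal α)) :=
    RingHom.smooth_algebraMap.mp h3
  rw [hJ, ← map_ideal] at h4
  exact .of_equiv (Algebra.TensorProduct.tensorQuotientEquiv K c.A K (c.ideal α)).symm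

/-- An inclusion D_α ⊆ D_β of prime divisors is an equality: a strict specialisation between their
generic points would give them different codimensions. -/
theorem eq_of_ideal_le [IsFractionRing (sIntegers S) K] {α β : ι} (hα : c.ideal α ≠ ⊤)
    (h : c.ideal β ≤ c.ideal α) : β = α := by
  have hp : (c.genIdeal α).IsPrime := (c.genIdeal_isPrime_or_eq_top α).resolve_right fun h1 => by
    rw [← comap_genIdeal, h1, Ideal.comap_top] at hα
    exact hα rfl
  have h1 : c.genIdeal β ≤ c.genIdeal α := by
    rw [← map_ideal, ← map_ideal]
    exact Ideal.map_mono h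
  let x : PrimeSpectrum (K ⊗[sIntegers S] c.A) := ⟨_, hp⟩
  have hxα : c.gen x ∈ X.D α := (c.gen_mem_iff α x).mpr le_rfl
  have hxβ : c.gen x ∈ X.D β := (c.gen_mem_iff β x).mpr h1
  have hgen : IsGenericPoint (c.gen x) (X.D α : Set X.X) := by
    refine (IsClosed.closure_subset_iff (X.D α).isClosed |>.mpr
      (Set.singleton_subset_iff.mpr hxα)).antisymm ?_
    have := closure_image_preimage c.gen.isOpenEmbedding (X.irreducible α) ⟨x, hxα⟩
    rw [← this]
    refine closure_minimal ?_ isClosed_closure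
    rintro _ ⟨y, hy, rfl⟩
    have h2 : x ⤳ y := (PrimeSpectrum.le_iff_specializes _ _).mp ((c.gen_mem_iff α y).mp hy)
    exact (h2.map c.gen.continuous).mem_closure
  obtain ⟨y, hy⟩ := QuasiSober.sober (X.irreducible β) (X.D β).isClosed
  have hyx : y ⤳ c.gen x := hy.specializes hxβ
  have hle : c.gen x ≤ y := hyx
  have hxy : y = c.gen x := by
    by_contra hne
    have hlt : c.gen x < y := lt_of_le_not_ge hle fun h2 => hne (hyx.antisymm h2).eq
    have h3 := Order.coheight_strictAnti hlt (by
      rw [X.codim_one β y hy]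
      exact ENat.one_lt_top)
    rw [X.codim_one β y hy, X.codim_one α _ hgen] at h3
    exact lt_irrefl _ h3
  apply X.D_injective
  apply SetLike.coe_injective
  rw [← hgen.def, ← hy.def, hxy]

end Chart

end Model

end SemiIntegral

end

/-! ### Integral points on charts -/

noncomputable section

namespace SemiIntegral

open Scheme TensorProduct

variable {K : Type u} [Field K] {ι : Type w} {X : CampanaOrbifold K ι} {S : Set (Place K)}

/-- The valuation ring of v is a localization of 𝒪_S, and 𝒪_v is torsion-free over that discrete
valuation ring. -/
theorem flat_complIntegers {v : Place K} (hv : v ∉ S) [IsDiscreteValuationRing v.1]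
    (hfrac : ∀ x ∈ v.1, ∃ a b : sIntegers S, v.1.valuation (b : K) = 1 ∧ x * b = a) :
    letI := complAlgebra hv
    Module.Flat (sIntegers S) (complIntegers v) := by
  let := valuationAlgebra hv
  let := complAlgebra hv
  let := (toComplIntegers v).toAlgebra
  have : IsScalarTower (sIntegers S) v.1 (complIntegers v) := .of_algebraMap_eq fun _ => rfl
  let N : Submonoid (sIntegers S) :=
    { carrier := {b | v.1.valuation (b : K) = 1}
      one_mem' := map_one _
      mul_mem' := fun {a b} ha hb => by
        change v.1.valuation ((a : K) * b) = 1
        rw [map_mul, show v.1.valuation (a : K) = 1 from ha,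
          show v.1.valuation (b : K) = 1 from hb, one_mul] }
  have : IsLocalization N v.1 := by
    refine ⟨fun b => ?_, fun x => ?_, fun {a b} hab => ?_⟩
    · exact (ValuationSubring.valuation_eq_one_iff v.1 (sIntegersToValuation hv b)).mpr b.2
    · obtain ⟨a, b, hb, hab⟩ := hfrac x x.2
      exact ⟨⟨a, b, hb⟩, Subtype.ext hab⟩
    · exact ⟨1, by rw [Subtype.ext (congrArg (fun x : v.1 => (x : K)) hab) (a1 := a) (a2 := b)]⟩
  have h1 : Module.Flat (sIntegers S) v.1 := IsLocalization.flat _ N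
  have hinj : Function.Injective (algebraMap v.1 (complIntegers v)) := fun a b hab =>
    Subtype.ext ((toCompl v).injective (congrArg Subtype.val hab))
  have : FaithfulSMul v.1 (complIntegers v) := (faithfulSMul_iff_algebraMap_injective _ _).mpr hinj
  have h2 : Module.Flat v.1 (complIntegers v) := inferInstance
  exact Module.Flat.trans (sIntegers S) v.1 (complIntegers v)

instance (v : Place K) : FaithfulSMul (complIntegers v) (Compl v) :=
  (faithfulSMul_iff_algebraMap_injective _ _).mpr Subtype.val_injective

theorem apply_eq_of_comp_eq {W Y Y' Z : Scheme.{u}} {f : W ⟶ Y} {g : Y ⟶ Z} {f' : W ⟶ Y'}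
    {g' : Y' ⟶ Z} (h : f ≫ g = f' ≫ g') (x : W) : g (f x) = g' (f' x) := by
  rw [← Hom.comp_apply, h, Hom.comp_apply]

theorem le_maximalIdeal_of_idealMult_ne_zero {v : Place K} [IsDiscreteValuationRing v.1]
    {J : Ideal (complIntegers v)} (h : idealMult J ≠ 0) :
    J ≤ IsLocalRing.maximalIdeal (complIntegers v) := by
  have := isDiscreteValuationRing_complIntegers v
  exact IsLocalRing.le_maximalIdeal fun h1 => h (idealMult_eq_zero_iff.mpr h1)

namespace Model

variable (M : Model X S) {v : Place K} (hv : v ∉ S)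

theorem multDivisor_eq (P : X.LocalPoint v) (α : ι) [IsDiscreteValuationRing v.1] :
    M.multDivisor hv P α = idealMult (pullIdeal (M.extend hv P) (M.ideal α)) := by
  have := isDiscreteValuationRing_complIntegers v
  rw [multDivisor, mult, intMult_eq_idealMult, pullIdeal_comap, integralPoint, pullback.lift_fst]

theorem mult_eq (P : X.LocalPoint v) (Z : (M.atPlace hv).IdealSheafData)
    [IsDiscreteValuationRing v.1] :
    M.mult hv P Z = idealMult (pullIdeal (M.integralPoint hv P) Z) := by
  have := isDiscreteValuationRing_complIntegers v
  rw [mult, intMult_eq_idealMult]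

namespace Chart

variable {M} (c : M.Chart)

/-- The affine chart of the base change of the model to `𝒪_v`. -/
def atPlace : letI := complAlgebra hv
    Spec (.of (complIntegers v ⊗[sIntegers S] c.A)) ⟶ M.atPlace hv :=
  letI := complAlgebra hv
  chartMap c.j_str (IsPullback.of_hasPullback M.str
    (Spec.map (CommRingCat.ofHom (algebraMap (sIntegers S) (complIntegers v)))))

instance : IsOpenImmersion (c.atPlace hv) :=
  letI := complAlgebra hv
  isOpenImmersion_chartMap c.j_str _

theorem atPlace_fst : letI := complAlgebra hv
    c.atPlace hv ≫ M.atPlaceFst hv = Spec.map (CommRingCat.ofHom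
      (Algebra.TensorProduct.includeRight :
        c.A →ₐ[sIntegers S] complIntegers v ⊗[sIntegers S] c.A).toRingHom) ≫ c.j :=
  letI := complAlgebra hv
  chartMap_fst c.j_str _

theorem atPlace_snd : letI := complAlgebra hv
    c.atPlace hv ≫ pullback.snd _ _ = Spec.map (CommRingCat.ofHom
      (Algebra.TensorProduct.includeLeftRingHom :
        complIntegers v →+* complIntegers v ⊗[sIntegers S] c.A)) :=
  letI := complAlgebra hv
  chartMap_snd c.j_str _

theorem atPlace_mem_iff (α : ι) (x : letI := complAlgebra hv
      PrimeSpectrum (complIntegers v ⊗[sIntegers S] c.A)) :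
    letI := complAlgebra hv
    c.atPlace hv x ∈ (M.ideal α).support.preimage (M.atPlaceFst hv).continuous ↔
      (c.ideal α).map (Algebra.TensorProduct.includeRight :
        c.A →ₐ[sIntegers S] complIntegers v ⊗[sIntegers S] c.A) ≤ x.asIdeal := by
  let := complAlgebra hv
  have h1 : M.atPlaceFst hv (c.atPlace hv x) = c.j (Spec.map (CommRingCat.ofHom
      (Algebra.TensorProduct.includeRight :
        c.A →ₐ[sIntegers S] complIntegers v ⊗[sIntegers S] c.A).toRingHom) x) :=
    apply_eq_of_comp_eq (c.atPlace_fst hv) x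
  change M.atPlaceFst hv (c.atPlace hv x) ∈ (M.ideal α).support ↔ _
  rw [h1, Ideal.map_le_iff_le_comap]
  exact c.mem_support_iff α _

theorem exists_point (P : X.LocalPoint v)
    (h : M.extend hv P (IsLocalRing.closedPoint (complIntegers v)) ∈ Set.range c.j) :
    ∃ χ : c.A →+* complIntegers v, M.extend hv P = Spec.map (CommRingCat.ofHom χ) ≫ c.j ∧
      χ.comp (algebraMap (sIntegers S) c.A) = sIntegersToCompl hv := by
  obtain ⟨χ, hχ⟩ := exists_eq_specMap_comp c.j (M.extend hv P) h
  refine ⟨χ.hom, hχ, ?_⟩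
  have h1 := M.extend_str hv P
  rw [hχ, Category.assoc, c.j_str, ← Spec.map_comp] at h1
  exact congrArg CommRingCat.Hom.hom (Spec.map_injective h1)

theorem exists_atPlace_point (P : X.LocalPoint v) {χ : c.A →+* complIntegers v}
    (hχ : M.extend hv P = Spec.map (CommRingCat.ofHom χ) ≫ c.j)
    (hχ' : χ.comp (algebraMap (sIntegers S) c.A) = sIntegersToCompl hv) :
    letI := complAlgebra hv
    ∃ φ : complIntegers v ⊗[sIntegers S] c.A →+* complIntegers v,
      M.integralPoint hv P = Spec.map (CommRingCat.ofHom φ) ≫ c.atPlace hv ∧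
      φ.comp (Algebra.TensorProduct.includeRight :
        c.A →ₐ[sIntegers S] complIntegers v ⊗[sIntegers S] c.A).toRingHom = χ := by
  let := complAlgebra hv
  let χ' : c.A →ₐ[sIntegers S] complIntegers v :=
    { χ with commutes' := fun r => DFunLike.congr_fun hχ' r }
  let φ := Algebra.TensorProduct.productMap (AlgHom.id (sIntegers S) (complIntegers v)) χ'
  have h1 : φ.toRingHom.comp (Algebra.TensorProduct.includeRight :
        c.A →ₐ[sIntegers S] complIntegers v ⊗[sIntegers S] c.A).toRingHom = χ := by
    ext a
    simp [φ, χ']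
  have h2 : φ.toRingHom.comp (Algebra.TensorProduct.includeLeftRingHom :
        complIntegers v →+* complIntegers v ⊗[sIntegers S] c.A) = RingHom.id _ := by
    ext a
    simp [φ]
  refine ⟨φ.toRingHom, ?_, h1⟩
  apply pullback.hom_ext
  · rw [integralPoint, pullback.lift_fst, Category.assoc, atPlace_fst, ← Category.assoc,
      ← Spec.map_comp, ← CommRingCat.ofHom_comp, h1, hχ]
  · rw [integralPoint, pullback.lift_snd, Category.assoc, atPlace_snd, ← Spec.map_comp,
      ← CommRingCat.ofHom_comp, h2]
    exact (Spec.map_id _).symm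

end Chart

end Model

end SemiIntegral

end

/-! ### Comparison of strong points with ordinary points -/

noncomputable section

namespace SemiIntegral

open Scheme TensorProduct

variable {K : Type u} [Field K] {ι : Type w} {X : CampanaOrbifold K ι} {S : Set (Place K)}

theorem Kind.admissible_zero (k : Kind) (m : ℕ) : k.Admissible m 0 := by
  cases k
  · exact .inl rfl
  · exact .inr ⟨0, rfl, dvd_zero m⟩

/-- Weight 1 imposes no condition. This settles the divisors that do not enter 𝒟_red. -/
theorem Kind.admissible_one (k : Kind) (n : ℕ∞) : k.Admissible 1 n := by
  cases k
  · by_cases h : n = 0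
    · exact .inl h
    · exact .inr (.inr (by exact_mod_cast Order.one_le_iff_pos.mpr (pos_iff_ne_zero.mpr h)))
  · cases n with
    | top => exact .inl rfl
    | coe n => exact .inr ⟨n, rfl, one_dvd n⟩

theorem isLocallyDomain_quotient {v : Place K} (hv : v ∉ S) [IsDiscreteValuationRing v.1]
    {A : Type u} [CommRing A] [Algebra (sIntegers S) A] {I : Ideal A}
    (h : letI := valuationAlgebra hv; Algebra.Smooth v.1 (v.1 ⊗[sIntegers S] (A ⧸ I))) :
    letI := complAlgebra hv
    IsLocallyDomain (complIntegers v ⊗[sIntegers S] A ⧸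
      I.map (Algebra.TensorProduct.includeRight :
        A →ₐ[sIntegers S] complIntegers v ⊗[sIntegers S] A)) :=
  letI := complAlgebra hv
  (isLocallyDomain_complIntegers_tensor hv h).of_ringEquiv
    (Algebra.TensorProduct.tensorQuotientEquiv (complIntegers v) A (complIntegers v) I).toRingEquiv

namespace Model

variable (M : Model X S) {v : Place K} (hv : v ∉ S)

theorem coe_red_preimage {Z : Scheme.{u}} (f : Z ⟶ M.Y) :
    (M.red.preimage f.continuous : Set Z) = ⋃ α ∈ {α | X.m α ≠ 1},
      ((M.ideal α).support.preimage f.continuous : Set Z) :=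
  Set.preimage_iUnion₂

variable {M}

/-- If the reduction of P lies on C, then C agrees with 𝒟_α near it, as components are disjoint.
Otherwise the ideal of C becomes the unit ideal along P. -/
theorem mult_eq_zero_or_eq_multDivisor [IsDiscreteValuationRing v.1] (c : M.Chart) {α : ι}
    (hsm : letI := valuationAlgebra hv
      Algebra.Smooth v.1 (v.1 ⊗[sIntegers S] (c.A ⧸ c.ideal α)))
    {P : X.LocalPoint v}
    (hP : M.extend hv P (IsLocalRing.closedPoint (complIntegers v)) ∈ Set.range c.j)
    {C : Closeds (M.atPlace hv)} (hC : M.IsLocalComponent hv α C) :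
    M.mult hv P (.vanishingIdeal C) = 0 ∨
      M.mult hv P (.vanishingIdeal C) = M.multDivisor hv P α := by
  let := complAlgebra hv
  have := isDiscreteValuationRing_complIntegers v
  obtain ⟨χ, hχ, hχ'⟩ := c.exists_point hv P hP
  obtain ⟨φ, hφ, hφ'⟩ := c.exists_atPlace_point hv P hχ hχ'
  rw [mult_eq, multDivisor_eq, hχ, hφ, pullIdeal_comp, pullIdeal_comp, pullIdeal_vanishingIdeal]
  by_cases hne : (c.atPlace hv ⁻¹' (C : Set (M.atPlace hv))).Nonempty
  · have hmin := hC.2.mem_minimalPrimes (c.atPlace hv).isOpenEmbedding (c.atPlace_mem_iff hv α) hne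
    by_cases hle : (PrimeSpectrum.vanishingIdeal
        (c.atPlace hv ⁻¹' (C : Set (M.atPlace hv)))).map φ ≤
          IsLocalRing.maximalIdeal (complIntegers v)
    · right
      refine congrArg idealMult (((isLocallyDomain_quotient hv hsm).map_eq_map hmin φ hle).trans ?_)
      rw [← hφ']
      exact Ideal.map_map _ _
    · left
      rw [idealMult_eq_zero_iff]
      by_contra h1
      exact hle (IsLocalRing.le_maximalIdeal h1)
  · left
    rw [idealMult_eq_zero_iff]
    have h1 := vanishingIdeal_preimage_eq_top hne
    refine (congrArg (Ideal.map φ) h1).trans (Ideal.map_top _)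

/-- The component is the one through the reduction of P: a minimal prime below the contraction of
the maximal ideal of 𝒪_v. By flatness it contracts to the ideal of 𝒟_α, so it lies on no other 𝒟_β
and is a component of 𝒟_red too. -/
theorem exists_mult_eq_multDivisor [IsFractionRing (sIntegers S) K] [IsDiscreteValuationRing v.1]
    (hfrac : ∀ x ∈ v.1, ∃ a b : sIntegers S, v.1.valuation (b : K) = 1 ∧ x * b = a)
    (c : M.Chart) {α : ι} (hα : X.m α ≠ 1)
    (hsm : letI := valuationAlgebra hv
      Algebra.Smooth v.1 (v.1 ⊗[sIntegers S] (c.A ⧸ c.ideal α)))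
    {P : X.LocalPoint v}
    (hP : M.extend hv P (IsLocalRing.closedPoint (complIntegers v)) ∈ Set.range c.j)
    (h0 : M.multDivisor hv P α ≠ 0) :
    ∃ C, M.IsLocalComponent hv α C ∧
      M.mult hv P (.vanishingIdeal C) = M.multDivisor hv P α := by
  let := complAlgebra hv
  have := isDiscreteValuationRing_complIntegers v
  obtain ⟨χ, hχ, hχ'⟩ := c.exists_point hv P hP
  obtain ⟨φ, hφ, hφ'⟩ := c.exists_atPlace_point hv P hχ hχ'
  have hmd : M.multDivisor hv P α = idealMult ((c.ideal α).map χ) := by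
    rw [multDivisor_eq, hχ, pullIdeal_comp]
    rfl
  rw [hmd] at h0 ⊢
  have hχm := le_maximalIdeal_of_idealMult_ne_zero h0
  have hI : c.ideal α ≠ ⊤ := fun h1 => by
    rw [h1, Ideal.map_top, idealMult_top] at h0
    exact h0 rfl
  have hIp := c.ideal_isPrime hI
  set J := (c.ideal α).map (Algebra.TensorProduct.includeRight :
        c.A →ₐ[sIntegers S] complIntegers v ⊗[sIntegers S] c.A) with hJ
  have hJφ : J.map φ = (c.ideal α).map χ := by
    rw [← hφ']
    exact Ideal.map_map _ _
  obtain ⟨q, hq, hqφ⟩ := Ideal.exists_minimalPrimes_le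
    (Ideal.map_le_iff_le_comap.mp (hJφ.trans_le hχm))
  have hqp : q.IsPrime := hq.1.1
  let x : PrimeSpectrum (complIntegers v ⊗[sIntegers S] c.A) := ⟨q, hqp⟩
  obtain ⟨hC, hCq⟩ := isComponent_closure (c.atPlace hv).isOpenEmbedding
    (c.atPlace_mem_iff hv α) x hq
  have hflat := flat_complIntegers hv hfrac
  refine ⟨_, ⟨?_, hC⟩, ?_⟩
  · refine IsComponent.of_iUnion X.finite_m (M.coe_red_preimage (M.atPlaceFst hv)) hα hC
      fun β _ hle => ?_
    have h1 := Ideal.map_le_iff_le_comap.mp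
      ((c.atPlace_mem_iff hv β x).mp (hle (subset_closure rfl)))
    have h2 := comap_includeRight_of_mem_minimalPrimes hq
    rw [c.eq_of_ideal_le hI (h1.trans h2.le)]
  · rw [mult_eq, hφ, pullIdeal_comp, pullIdeal_vanishingIdeal, ← hJφ]
    refine congrArg idealMult ((congrArg (Ideal.map φ) hCq).trans ?_)
    exact (isLocallyDomain_quotient hv hsm).map_eq_map hq φ (Ideal.map_le_iff_le_comap.mpr hqφ)

theorem strongPoints_eq_points [IsFractionRing (sIntegers S) K] [IsDiscreteValuationRing v.1]
    (hfrac : ∀ x ∈ v.1, ∃ a b : sIntegers S, v.1.valuation (b : K) = 1 ∧ x * b = a)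
    {s : Set M.Chart} (hs : ∀ y, ∃ c ∈ s, y ∈ Set.range c.j)
    (hsm : ∀ c ∈ s, ∀ α, X.m α ≠ 1 → letI := valuationAlgebra hv
      Algebra.Smooth v.1 (v.1 ⊗[sIntegers S] (c.A ⧸ c.ideal α))) (k : Kind) :
    M.strongPoints hv k = M.points hv k := by
  ext P
  refine and_congr_right fun _ => forall₃_congr fun α m hm => ?_
  by_cases hα : X.m α = 1
  · have : m = 1 := by exact_mod_cast hm.symm.trans hα
    subst this
    exact iff_of_true (fun _ _ => k.admissible_one _) (k.admissible_one _)
  obtain ⟨c, hc, hP⟩ := hs (M.extend hv P (IsLocalRing.closedPoint (complIntegers v)))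
  constructor
  · intro h
    by_cases h0 : M.multDivisor hv P α = 0
    · rw [h0]
      exact k.admissible_zero m
    · obtain ⟨C, hC, hC'⟩ := exists_mult_eq_multDivisor hv hfrac c hα (hsm c hc α hα) hP h0
      rw [← hC']
      exact h C hC
  · intro h C hC
    obtain h1 | h1 := mult_eq_zero_or_eq_multDivisor hv c (hsm c hc α hα) hP hC
    · rw [h1]
      exact k.admissible_zero m
    · rw [h1]
      exact h

end Model

end SemiIntegral

end

noncomputable section

namespace SemiIntegral

open Scheme TensorProduct

/-! ### Charts of base changes to extension fields -/

theorem flat_tensorProduct_map {R L L' A : Type u} [CommRing R] [Field L] [Field L'] [CommRing A]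
    [Algebra R L] [Algebra R L'] [Algebra L L'] [IsScalarTower R L L'] [Algebra R A]
    (f : L →ₐ[R] L') (hf : ∀ x, f x = algebraMap L L' x) :
    (Algebra.TensorProduct.map f (AlgHom.id R A)).toRingHom.Flat := by
  have h1 := flat_includeRight L L' (L ⊗[R] A)
  have h2 := h1.comp (RingHom.Flat.of_bijective
    (f := (Algebra.TensorProduct.cancelBaseChange R L L L' A).toRingEquiv.toRingHom)
    (Algebra.TensorProduct.cancelBaseChange R L L L' A).bijective)
  convert h2 using 1
  refine RingHom.ext fun z => ?_
  induction z with
  | zero => simp only [map_zero]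
  | add z z' h h' => simp only [map_add, h, h']
  | tmul x a =>
    have h3 : (Algebra.TensorProduct.cancelBaseChange R L L L' A) (1 ⊗ₜ (x ⊗ₜ a)) =
        (x • (1 : L')) ⊗ₜ a := Algebra.TensorProduct.cancelBaseChange_tmul ..
    have h4 : Algebra.TensorProduct.map f (AlgHom.id R A) (x ⊗ₜ a) = (x • (1 : L')) ⊗ₜ a := by
      rw [Algebra.TensorProduct.map_tmul, hf, Algebra.smul_def, mul_one]
      rfl
    exact h4.trans h3.symm

variable {K : Type u} [Field K] {ι : Type w} {X : CampanaOrbifold K ι} {S : Set (Place K)}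

/-- The inclusion of extensions of `K`, over the `S`-integers. -/
def fieldMap (S : Set (Place K)) (L L' : Type u) [Field L] [Field L'] [Algebra K L] [Algebra K L']
    [Algebra L L'] [IsScalarTower K L L'] : L →ₐ[sIntegers S] L' :=
  { algebraMap L L' with
    commutes' := fun r => (IsScalarTower.algebraMap_apply K L L' (r : K)).symm }

namespace Model.Chart

variable {M : Model X S} (c : M.Chart)

/-- The affine chart of `X_L`. -/
def overField (L : Type u) [Field L] [Algebra K L] :
    Spec (.of (L ⊗[sIntegers S] c.A)) ⟶ X.baseChange L :=
  chartMap c.j_str (M.isPullback_overFst L)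

instance (L : Type u) [Field L] [Algebra K L] : IsOpenImmersion (c.overField L) :=
  isOpenImmersion_chartMap c.j_str _

theorem mem_range_overField {L : Type u} [Field L] [Algebra K L] {z : X.baseChange L}
    (h : M.gen (X.overFst L z) ∈ Set.range c.j) : z ∈ Set.range (c.overField L) :=
  mem_range_chartMap c.j_str (M.isPullback_overFst L) (by rwa [Hom.comp_apply])

theorem gen_overFst_overField (L : Type u) [Field L] [Algebra K L] (x) :
    M.gen (X.overFst L (c.overField L x)) ∈ Set.range c.j := by
  have h := apply_eq_of_comp_eq (chartMap_fst c.j_str (M.isPullback_overFst L)) x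
  rw [Hom.comp_apply] at h
  exact ⟨_, h.symm⟩

theorem overField_overMap (L L' : Type u) [Field L] [Field L'] [Algebra K L] [Algebra K L']
    [Algebra L L'] [IsScalarTower K L L'] :
    c.overField L' ≫ X.overMap L L' = Spec.map (CommRingCat.ofHom
      (Algebra.TensorProduct.map (fieldMap S L L') (AlgHom.id (sIntegers S) c.A)).toRingHom) ≫
        c.overField L :=
  chartMap_comp c.j_str (M.isPullback_overFst L) (M.isPullback_overFst L') (fieldMap S L L')
    (by rw [← Category.assoc]; exact congrArg (· ≫ M.gen) (pullback.lift_fst _ _ _))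
    (pullback.lift_snd _ _ _)

theorem overField_overFst (L : Type u) [Field L] [Algebra K L] :
    c.overField L ≫ X.overFst L = Spec.map (CommRingCat.ofHom
      (Algebra.TensorProduct.map (fieldMap S K L) (AlgHom.id (sIntegers S) c.A)).toRingHom) ≫
        c.gen :=
  chartMap_comp (R' := K) c.j_str M.isPullback (M.isPullback_overFst L) (fieldMap S K L) rfl
    pullback.condition

theorem overField_mem_iff [IsFractionRing (sIntegers S) K] (L : Type u) [Field L] [Algebra K L] (α : ι)
    (x : PrimeSpectrum (L ⊗[sIntegers S] c.A)) :
    c.overField L x ∈ (X.D α).preimage (X.overFst L).continuous ↔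
      (c.ideal α).map (Algebra.TensorProduct.includeRight :
        c.A →ₐ[sIntegers S] L ⊗[sIntegers S] c.A) ≤ x.asIdeal := by
  have h1 := apply_eq_of_comp_eq (c.overField_overFst L) x
  change X.overFst L (c.overField L x) ∈ X.D α ↔ _
  rw [h1]
  refine (c.gen_mem_iff α _).trans ?_
  rw [← map_ideal, Ideal.map_le_iff_le_comap, Ideal.map_le_iff_le_comap]
  have h2 : ∀ a : c.A, (Algebra.TensorProduct.map (fieldMap S K L) (AlgHom.id (sIntegers S) c.A))
      (1 ⊗ₜ a) = 1 ⊗ₜ a := fun a => by simp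
  refine forall₂_congr fun a _ => ?_
  change Algebra.TensorProduct.map (fieldMap S K L) (AlgHom.id (sIntegers S) c.A) (1 ⊗ₜ a) ∈
    x.asIdeal ↔ (1 : L) ⊗ₜ a ∈ x.asIdeal
  rw [h2]

/-- The affine chart of the base change of the model to the `S`-integers of `L`. -/
def overIntegers (L : Type u) [Field L] [Algebra K L] :
    Spec (.of (sIntegers (placesOver L S) ⊗[sIntegers S] c.A)) ⟶ M.baseChange L :=
  chartMap c.j_str (IsPullback.of_hasPullback M.str
    (Spec.map (CommRingCat.ofHom (algebraMap (sIntegers S) (sIntegers (placesOver L S))))))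

instance (L : Type u) [Field L] [Algebra K L] : IsOpenImmersion (c.overIntegers L) :=
  isOpenImmersion_chartMap c.j_str _

theorem overField_overGen (L : Type u) [Field L] [Algebra K L] :
    c.overField L ≫ M.overGen L = Spec.map (CommRingCat.ofHom
      (Algebra.TensorProduct.map (sIntegersVal L S) (AlgHom.id (sIntegers S) c.A)).toRingHom) ≫
        c.overIntegers L :=
  chartMap_comp c.j_str (IsPullback.of_hasPullback M.str
    (Spec.map (CommRingCat.ofHom (algebraMap (sIntegers S) (sIntegers (placesOver L S))))))
    (M.isPullback_overFst L) (sIntegersVal L S)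
    (pullback.lift_fst _ _ _) (pullback.lift_snd _ _ _)

variable {L L' : Type u} [Field L] [Field L'] [Algebra K L] [Algebra K L'] [Algebra L L']
  [IsScalarTower K L L']

theorem pullIdeal_overField_map (C : Closeds (X.baseChange L')) :
    pullIdeal (c.overField L) ((IdealSheafData.vanishingIdeal C).map (X.overMap L L')) =
      (PrimeSpectrum.vanishingIdeal (c.overField L' ⁻¹' (C : Set (X.baseChange L')))).comap
        (Algebra.TensorProduct.map (fieldMap S L L') (AlgHom.id (sIntegers S) c.A)) := by
  refine pullIdeal_map_vanishingIdeal (c.overField_overMap L L') (fun z hz => ?_) C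
  obtain ⟨x, hx⟩ := hz
  apply c.mem_range_overField
  have h1 : X.overMap L L' ≫ X.overFst L = X.overFst L' := pullback.lift_fst _ _ _
  rw [← h1, Hom.comp_apply, ← hx]
  exact c.gen_overFst_overField L x

/-- The image in X_L and the closure in the model over the S-integers of L are both contractions on
charts. The closure can thus be computed directly from the component upstairs. -/
theorem pullIdeal_overIntegers_map (C : Closeds (X.baseChange L')) :
    pullIdeal (c.overIntegers L) (((IdealSheafData.vanishingIdeal C).map (X.overMap L L')).map
      (M.overGen L)) =
      ((PrimeSpectrum.vanishingIdeal (c.overField L' ⁻¹' (C : Set (X.baseChange L')))).comap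
        (Algebra.TensorProduct.map (fieldMap S L L') (AlgHom.id (sIntegers S) c.A))).comap
        (Algebra.TensorProduct.map (sIntegersVal L S) (AlgHom.id (sIntegers S) c.A)) := by
  rw [← pullIdeal_overField_map, IdealSheafData.map_vanishingIdeal, pullIdeal_vanishingIdeal]
  refine pullIdeal_map_vanishingIdeal (c.overField_overGen L) (fun z hz => ?_) _
  apply c.mem_range_overField
  obtain ⟨x, hx⟩ := hz
  have h1 : M.overGen L ≫ pullback.fst _ _ = X.overFst L ≫ M.gen := pullback.lift_fst _ _ _
  have h2 := apply_eq_of_comp_eq h1 z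
  rw [← h2, ← hx]
  have h3 := apply_eq_of_comp_eq (chartMap_fst c.j_str (IsPullback.of_hasPullback M.str
    (Spec.map (CommRingCat.ofHom (algebraMap (sIntegers S) (sIntegers (placesOver L S))))))) x
  exact ⟨_, h3.symm⟩

end Model.Chart

end SemiIntegral

end

noncomputable section

namespace SemiIntegral

open Scheme TensorProduct

/-! ### Fields of definition of geometric components -/

variable {K : Type u} [Field K] {ι : Type w} {X : CampanaOrbifold K ι} {S : Set (Place K)}

namespace Model

variable {M : Model X S}

theorem Chart.component_mem_minimalPrimes [IsFractionRing (sIntegers S) K] (c : M.Chart)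
    {L' : Type u} [Field L'] [Algebra K L'] {α : ι} {C : Closeds (X.baseChange L')}
    (hC : IsComponent C ((X.D α).preimage (X.overFst L').continuous))
    (hne : (c.overField L' ⁻¹' (C : Set (X.baseChange L'))).Nonempty) :
    PrimeSpectrum.vanishingIdeal (c.overField L' ⁻¹' (C : Set (X.baseChange L')))
      ∈ ((c.ideal α).map (Algebra.TensorProduct.includeRight :
        c.A →ₐ[sIntegers S] L' ⊗[sIntegers S] c.A)).minimalPrimes :=
  hC.mem_minimalPrimes (c.overField L').isOpenEmbedding (c.overField_mem_iff L' α) hne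

theorem Chart.exists_finset [IsFractionRing (sIntegers S) K] (hD : X.SmoothComponents)
    (c : M.Chart) {L' : Type u} [Field L'] [Algebra K L'] [Algebra.IsAlgebraic K L'] {α : ι}
    {C : Closeds (X.baseChange L')}
    (hC : IsComponent C ((X.D α).preimage (X.overFst L').continuous)) :
    ∃ F : Finset L', (∀ x ∈ F, IsSeparable K x) ∧
      ∀ (L : Type u) [Field L] [Algebra K L] [Algebra L L'] [IsScalarTower K L L'],
        (∀ x ∈ F, x ∈ (algebraMap L L').range) →
        pullIdeal (c.overField L')
          (((IdealSheafData.vanishingIdeal C).map (X.overMap L L')).comap (X.overMap L L')) =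
        pullIdeal (c.overField L') (.vanishingIdeal C) := by
  have := c.smooth hD α
  have key : ∃ F : Finset L', (∀ x ∈ F, IsSeparable K x) ∧
      ∀ (L : Type u) [Field L] [Algebra K L] [Algebra L L'] [IsScalarTower K L L'],
        (∀ x ∈ F, x ∈ (algebraMap L L').range) →
        ((PrimeSpectrum.vanishingIdeal
          (c.overField L' ⁻¹' (C : Set (X.baseChange L')))).comap
          (Algebra.TensorProduct.map (fieldMap S L L') (AlgHom.id (sIntegers S) c.A))).map
          (Algebra.TensorProduct.map (fieldMap S L L') (AlgHom.id (sIntegers S) c.A)) =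
        PrimeSpectrum.vanishingIdeal (c.overField L' ⁻¹' (C : Set (X.baseChange L'))) := by
    by_cases hne : (c.overField L' ⁻¹' (C : Set (X.baseChange L'))).Nonempty
    · obtain ⟨F, hF, h⟩ := exists_finset_comap_map_eq (K := K)
        (c.component_mem_minimalPrimes hC hne)
      exact ⟨F, hF, fun L _ _ _ _ hL => h L (fieldMap S L L') hL⟩
    · refine ⟨∅, by simp, fun L _ _ _ _ _ => ?_⟩
      have h1 := vanishingIdeal_preimage_eq_top hne
      have h2 : ∀ q : Ideal (L' ⊗[sIntegers S] c.A), q = ⊤ →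
          (q.comap (Algebra.TensorProduct.map (fieldMap S L L') (AlgHom.id (sIntegers S) c.A))).map
          (Algebra.TensorProduct.map (fieldMap S L L') (AlgHom.id (sIntegers S) c.A)) = q := by
        rintro q rfl
        rw [Ideal.comap_top, Ideal.map_top]
      exact h2 _ h1
  obtain ⟨F, hF, h⟩ := key
  refine ⟨F, hF, fun L _ _ _ _ hL => ?_⟩
  rw [pullIdeal_comap, c.overField_overMap, pullIdeal_comp, c.pullIdeal_overField_map,
    pullIdeal_vanishingIdeal]
  exact h L hL

/-- The separable elements needed on the finitely many charts generate a field L over which the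
component is defined. Being an intersection of such fields, `fieldOfDef` lies inside L. -/
theorem fieldOfDef_finite [IsFractionRing (sIntegers S) K] (hD : X.SmoothComponents)
    {s : Set M.Chart} (hs : s.Finite) (hcov : ∀ y, ∃ c ∈ s, y ∈ Set.range c.j)
    {α : ι} {C : Closeds (X.baseChange (AlgebraicClosure K))} (hC : X.IsGeomComponent α C) :
    FiniteDimensional K (X.fieldOfDef C) ∧ Algebra.IsSeparable K (X.fieldOfDef C) := by
  choose F hF h using fun c : M.Chart => c.exists_finset hD hC.2
  let T : Set (AlgebraicClosure K) := ⋃ c ∈ s, (F c : Set (AlgebraicClosure K))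
  have hT : T.Finite := hs.biUnion fun c _ => (F c).finite_toSet
  have hTs : ∀ x ∈ T, IsSeparable K x := by
    intro x hx
    obtain ⟨c, -, hx⟩ := Set.mem_iUnion₂.mp hx
    exact hF c x hx
  let L := IntermediateField.adjoin K T
  have h1 : FiniteDimensional K L := by
    have : Finite T := hT
    exact IntermediateField.finiteDimensional_adjoin fun x _ => Algebra.IsIntegral.isIntegral x
  have h2 : Algebra.IsSeparable K L := (IntermediateField.isSeparable_adjoin_iff_isSeparable _ _).mpr hTs
  have hdef : X.IsDefinedOver C L := by
    refine ⟨(IdealSheafData.vanishingIdeal C).map (X.overMap L (AlgebraicClosure K)),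
      le_antisymm (IdealSheafData.comap_map_le _ _) ?_⟩
    refine le_of_forall_pullIdeal_le (κ := s) (fun c => c.1.overField (AlgebraicClosure K))
      (fun y => ?_) fun c => ?_
    · obtain ⟨c, hc, hy⟩ := hcov (M.gen (X.overFst _ y))
      exact ⟨⟨c, hc⟩, c.mem_range_overField hy⟩
    · exact (h c.1 L fun x hx => ⟨⟨x, IntermediateField.subset_adjoin K T
        (Set.mem_iUnion₂.mpr ⟨c.1, c.2, hx⟩)⟩, rfl⟩).ge
  have hle : X.fieldOfDef C ≤ L := sInf_le hdef
  exact ⟨FiniteDimensional.of_injective (IntermediateField.inclusion hle).toLinearMap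
    (IntermediateField.inclusion hle).injective,
    Algebra.IsSeparable.of_algHom K L (IntermediateField.inclusion hle)⟩

end Model

theorem finite_setOf_isGeomComponent (X : CampanaOrbifold K ι) :
    {C | ∃ α, X.IsGeomComponent α C}.Finite := by
  have h1 : LocallyOfFiniteType (pullback.snd X.str (Spec.map (CommRingCat.ofHom
    (algebraMap K (AlgebraicClosure K))))) := inferInstance
  have h2 : IsLocallyNoetherian (X.baseChange (AlgebraicClosure K)) :=
    LocallyOfFiniteType.isLocallyNoetherian (pullback.snd X.str (Spec.map (CommRingCat.ofHom
    (algebraMap K (AlgebraicClosure K)))))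
  have h3 : CompactSpace (X.baseChange (AlgebraicClosure K)) :=
    QuasiCompact.compactSpace_of_compactSpace (pullback.snd X.str (Spec.map (CommRingCat.ofHom
    (algebraMap K (AlgebraicClosure K)))))
  have h4 : IsNoetherian (X.baseChange (AlgebraicClosure K)) := ⟨⟩
  exact (finite_isComponent _).subset fun C ⟨α, hC⟩ => hC.1

end SemiIntegral

end

noncomputable section

namespace SemiIntegral

open Scheme TensorProduct Filter

/-! ### Geometric points -/

variable {K : Type u} [Field K] {ι : Type w} {X : CampanaOrbifold K ι} {S : Set (Place K)}

namespace Model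

variable {M : Model X S} {L L' : Type u} [Field L] [Field L'] [Algebra K L] [Algebra K L']
  [Algebra L L'] [IsScalarTower K L L']

/-- By flatness the image of a component is a component of (D_α)_L for every intermediate L. So it
is never needed that the image over `fieldOfDef` pulls back to exactly the original component. -/
theorem Chart.component_comap_mem_minimalPrimes [IsFractionRing (sIntegers S) K] (c : M.Chart)
    {α : ι} {C : Closeds (X.baseChange L')}
    (hC : IsComponent C ((X.D α).preimage (X.overFst L').continuous))
    (hne : (c.overField L' ⁻¹' (C : Set (X.baseChange L'))).Nonempty) :
    (PrimeSpectrum.vanishingIdeal (c.overField L' ⁻¹' (C : Set (X.baseChange L')))).comap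
        (Algebra.TensorProduct.map (fieldMap S L L') (AlgHom.id (sIntegers S) c.A))
      ∈ ((c.ideal α).map (Algebra.TensorProduct.includeRight :
        c.A →ₐ[sIntegers S] L ⊗[sIntegers S] c.A)).minimalPrimes := by
  have : IsScalarTower (sIntegers S) L L' :=
    .of_algebraMap_eq fun r => (fieldMap S L L').commutes r |>.symm
  refine comap_mem_minimalPrimes_of_flat
    (Algebra.TensorProduct.map (fieldMap S L L') (AlgHom.id (sIntegers S) c.A)).toRingHom
    (flat_tensorProduct_map (fieldMap S L L') fun _ => rfl) ?_
  have hmap : ((c.ideal α).map (Algebra.TensorProduct.includeRight :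
      c.A →ₐ[sIntegers S] L ⊗[sIntegers S] c.A)).map
      (Algebra.TensorProduct.map (fieldMap S L L') (AlgHom.id (sIntegers S) c.A)).toRingHom =
      (c.ideal α).map (Algebra.TensorProduct.includeRight :
        c.A →ₐ[sIntegers S] L' ⊗[sIntegers S] c.A) := by
    refine (Ideal.map_map (Algebra.TensorProduct.includeRight :
      c.A →ₐ[sIntegers S] L ⊗[sIntegers S] c.A).toRingHom _).trans
      (congrArg (fun g => Ideal.map g (c.ideal α)) (RingHom.ext fun a => ?_) :
        _ = Ideal.map (Algebra.TensorProduct.includeRight :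
        c.A →ₐ[sIntegers S] L' ⊗[sIntegers S] c.A).toRingHom (c.ideal α))
    change Algebra.TensorProduct.map (fieldMap S L L') (AlgHom.id (sIntegers S) c.A) (1 ⊗ₜ a) =
      1 ⊗ₜ a
    simp
  rw [hmap]
  exact c.component_mem_minimalPrimes hC hne

theorem Chart.eventually_map_pullIdeal (hK : IsGlobalField K) [IsFractionRing (sIntegers S) K]
    (hD : X.SmoothComponents) [Algebra.IsAlgebraic K L] (c : M.Chart) {α : ι}
    {C : Closeds (X.baseChange L')}
    (hC : IsComponent C ((X.D α).preimage (X.overFst L').continuous)) :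
    ∀ᶠ v : Place K in cofinite, ∀ (hv : v ∉ S) (w : Place L) (h : w.LiesOver v)
      (ψ : sIntegers (placesOver L S) ⊗[sIntegers S] c.A →+* complIntegers w),
      ψ.comp Algebra.TensorProduct.includeLeftRingHom = sIntegersToCompl (notMem_placesOver hv h) →
      (pullIdeal (c.overIntegers L) (((IdealSheafData.vanishingIdeal C).map (X.overMap L L')).map
        (M.overGen L))).map ψ = ⊤ ∨
      (pullIdeal (c.overIntegers L) (((IdealSheafData.vanishingIdeal C).map (X.overMap L L')).map
        (M.overGen L))).map ψ = (c.ideal α).map (ψ.comp (Algebra.TensorProduct.includeRight :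
            c.A →ₐ[sIntegers S] sIntegers (placesOver L S) ⊗[sIntegers S] c.A)) := by
  simp_rw [c.pullIdeal_overIntegers_map]
  by_cases hne : (c.overField L' ⁻¹' (C : Set (X.baseChange L'))).Nonempty
  · have := c.smooth hD α
    exact hK.eventually_map_eq (c.injective_one_tmul α)
      (c.component_comap_mem_minimalPrimes (L := L) hC hne)
  · refine .of_forall fun v hv w h ψ _ => .inl ?_
    have h1 := vanishingIdeal_preimage_eq_top hne
    have h2 : ∀ q : Ideal (L' ⊗[sIntegers S] c.A), q = ⊤ →
        ((q.comap (Algebra.TensorProduct.map (fieldMap S L L')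
          (AlgHom.id (sIntegers S) c.A))).comap
          (Algebra.TensorProduct.map (sIntegersVal L S) (AlgHom.id (sIntegers S) c.A))).map ψ
          = ⊤ := by
      rintro q rfl
      rw [Ideal.comap_top, Ideal.comap_top, Ideal.map_top]
    exact h2 _ h1

variable {v : Place K} (hv : v ∉ S) {w : Place L} (h : w.LiesOver v)

theorem overMult_eq [Algebra.IsAlgebraic K L] [IsDiscreteValuationRing w.1] (P : X.LocalPoint v)
    (Z : (M.baseChange L).IdealSheafData) :
    M.overMult hv h P Z =
      idealMult (pullIdeal (M.overIntegralPoint hv h P ≫ pullback.fst _ _) Z) := by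
  have := isDiscreteValuationRing_complIntegers w
  rw [overMult, intMult_eq_idealMult, pullIdeal_comap]

theorem Chart.exists_overIntegers_point [Algebra.IsAlgebraic K L] (c : M.Chart)
    (P : X.LocalPoint v) {χ : c.A →+* complIntegers v}
    (hχ : M.extend hv P = Spec.map (CommRingCat.ofHom χ) ≫ c.j)
    (hχ' : χ.comp (algebraMap (sIntegers S) c.A) = sIntegersToCompl hv) :
    ∃ ψ : sIntegers (placesOver L S) ⊗[sIntegers S] c.A →+* complIntegers w,
      M.overIntegralPoint hv h P ≫ pullback.fst _ _ =
        Spec.map (CommRingCat.ofHom ψ) ≫ c.overIntegers L ∧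
      ψ.comp Algebra.TensorProduct.includeLeftRingHom =
        sIntegersToCompl (notMem_placesOver hv h) ∧
      ψ.comp (Algebra.TensorProduct.includeRight : c.A →ₐ[sIntegers S]
        sIntegers (placesOver L S) ⊗[sIntegers S] c.A).toRingHom = (complIntegersMap h).comp χ := by
  let : Algebra (sIntegers S) (complIntegers w) :=
      (sIntegersToCompl (notMem_placesOver hv h)).comp (sIntegersMap L S) |>.toAlgebra
  let χ' : c.A →ₐ[sIntegers S] complIntegers w :=
    { (complIntegersMap h).comp χ with
      commutes' := fun r => by
        have h1 : χ (algebraMap (sIntegers S) c.A r) = sIntegersToCompl hv r :=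
          DFunLike.congr_fun hχ' r
        change complIntegersMap h (χ (algebraMap (sIntegers S) c.A r)) = _
        rw [h1]
        exact Subtype.ext (complMap_toCompl h (r : K)) }
  let t : sIntegers (placesOver L S) →ₐ[sIntegers S] complIntegers w :=
    { sIntegersToCompl (notMem_placesOver hv h) with commutes' := fun _ => rfl }
  let ψ := Algebra.TensorProduct.productMap t χ'
  have h1 : ψ.toRingHom.comp Algebra.TensorProduct.includeLeftRingHom =
      sIntegersToCompl (notMem_placesOver hv h) := RingHom.ext fun d => by
    change ψ (d ⊗ₜ 1) = _
    rw [Algebra.TensorProduct.productMap_apply_tmul, map_one, mul_one]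
    rfl
  have h2 : ψ.toRingHom.comp (Algebra.TensorProduct.includeRight : c.A →ₐ[sIntegers S]
      sIntegers (placesOver L S) ⊗[sIntegers S] c.A).toRingHom = (complIntegersMap h).comp χ :=
    RingHom.ext fun a => by
    change ψ (1 ⊗ₜ a) = _
    rw [Algebra.TensorProduct.productMap_apply_tmul, map_one, one_mul]
    rfl
  refine ⟨ψ.toRingHom, ?_, h1, h2⟩
  have hfst : c.overIntegers L ≫ pullback.fst _ _ = _ := chartMap_fst c.j_str _
  have hsnd : c.overIntegers L ≫ pullback.snd _ _ = _ := chartMap_snd c.j_str _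
  rw [overIntegralPoint, pullback.lift_fst]
  apply pullback.hom_ext
  · rw [pullback.lift_fst, Category.assoc, hfst, ← Category.assoc, ← Spec.map_comp,
      ← CommRingCat.ofHom_comp, h2, hχ, CommRingCat.ofHom_comp, Spec.map_comp, Category.assoc]
  · rw [pullback.lift_snd, Category.assoc, hsnd, ← Spec.map_comp, ← CommRingCat.ofHom_comp, h1]

end Model

end SemiIntegral

end

noncomputable section

namespace SemiIntegral

open Scheme TensorProduct

variable {K : Type u} [Field K] {ι : Type w} {X : CampanaOrbifold K ι} {S : Set (Place K)}

theorem flat_of_sIntegers [IsFractionRing (sIntegers S) K] (L : Type u) [Field L] [Algebra K L] :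
    Module.Flat (sIntegers S) L := by
  have h1 : Module.Flat (sIntegers S) K := IsLocalization.flat _ (nonZeroDivisors (sIntegers S))
  exact Module.Flat.trans (sIntegers S) K L

theorem map_includeRight_ne_top {L A : Type u} [Field L] [Algebra K L] [CommRing A]
    [Algebra (sIntegers S) A] {I : Ideal A} (hI : I ≠ ⊤)
    (hinj : Function.Injective fun n : A ⧸ I => (1 : K) ⊗ₜ[sIntegers S] n) :
    I.map (Algebra.TensorProduct.includeRight : A →ₐ[sIntegers S] L ⊗[sIntegers S] A) ≠ ⊤ := by
  have : Nontrivial (A ⧸ I) := Ideal.Quotient.nontrivial_iff.mpr hI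
  have : Nontrivial (K ⊗[sIntegers S] (A ⧸ I)) := hinj.nontrivial
  have h1 : Nontrivial (L ⊗[K] (K ⊗[sIntegers S] (A ⧸ I))) := inferInstance
  have e := (Algebra.TensorProduct.cancelBaseChange (sIntegers S) K L L (A ⧸ I)).trans
    (Algebra.TensorProduct.tensorQuotientEquiv L A L I)
  exact Ideal.Quotient.nontrivial_iff.mp (e.injective.nontrivial)

namespace Model

variable {M : Model X S} {v : Place K} (hv : v ∉ S)

section

variable {L L' : Type u} [Field L] [Field L'] [Algebra K L] [Algebra K L']
  [Algebra L L'] [IsScalarTower K L L'] [Algebra.IsAlgebraic K L] {w : Place L} (h : w.LiesOver v)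

/-- Both multiplicities are expressed over 𝒪_w. For 𝒟_α this is legitimate because w is unramified
over v. -/
theorem Chart.exists_overMult_eq [IsDiscreteValuationRing v.1] [IsDiscreteValuationRing w.1]
    (hunr : (IsLocalRing.maximalIdeal (complIntegers v)).map (complIntegersMap h) =
      IsLocalRing.maximalIdeal (complIntegers w)) (c : M.Chart) {α : ι}
    (P : X.LocalPoint v) {χ : c.A →+* complIntegers v}
    (hχ : M.extend hv P = Spec.map (CommRingCat.ofHom χ) ≫ c.j)
    (hχ' : χ.comp (algebraMap (sIntegers S) c.A) = sIntegersToCompl hv)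
    (Z : (M.baseChange L).IdealSheafData) :
    ∃ ψ : sIntegers (placesOver L S) ⊗[sIntegers S] c.A →+* complIntegers w,
      ψ.comp Algebra.TensorProduct.includeLeftRingHom =
        sIntegersToCompl (notMem_placesOver hv h) ∧
      ψ.comp (Algebra.TensorProduct.includeRight : c.A →ₐ[sIntegers S]
        sIntegers (placesOver L S) ⊗[sIntegers S] c.A).toRingHom = (complIntegersMap h).comp χ ∧
      M.overMult hv h P Z = idealMult ((pullIdeal (c.overIntegers L) Z).map ψ) ∧
      M.multDivisor hv P α = idealMult ((c.ideal α).map (ψ.comp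
        (Algebra.TensorProduct.includeRight :
            c.A →ₐ[sIntegers S] sIntegers (placesOver L S) ⊗[sIntegers S] c.A))) := by
  have := isDiscreteValuationRing_complIntegers v
  have := isDiscreteValuationRing_complIntegers w
  obtain ⟨ψ, h1, h2, h3⟩ := c.exists_overIntegers_point hv h P hχ hχ'
  refine ⟨ψ, h2, h3, ?_, ?_⟩
  · rw [overMult_eq, h1, pullIdeal_comp]
    rfl
  · rw [multDivisor_eq, hχ, pullIdeal_comp]
    refine (idealMult_map (complIntegersMap h) hunr _).symm.trans (congrArg idealMult ?_)
    refine (Ideal.map_map χ (complIntegersMap h)).trans ?_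
    exact congrArg (fun g => Ideal.map g (c.ideal α)) h3.symm

theorem overMult_eq_zero_or_eq_multDivisor [IsDiscreteValuationRing v.1]
    [IsDiscreteValuationRing w.1]
    (hunr : (IsLocalRing.maximalIdeal (complIntegers v)).map (complIntegersMap h) =
      IsLocalRing.maximalIdeal (complIntegers w)) (c : M.Chart) {α : ι}
    {P : X.LocalPoint v}
    (hP : M.extend hv P (IsLocalRing.closedPoint (complIntegers v)) ∈ Set.range c.j)
    {Z : (M.baseChange L).IdealSheafData}
    (hZ : ∀ ψ : sIntegers (placesOver L S) ⊗[sIntegers S] c.A →+* complIntegers w,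
      ψ.comp Algebra.TensorProduct.includeLeftRingHom = sIntegersToCompl (notMem_placesOver hv h) →
      (pullIdeal (c.overIntegers L) Z).map ψ = ⊤ ∨
      (pullIdeal (c.overIntegers L) Z).map ψ =
        (c.ideal α).map (ψ.comp (Algebra.TensorProduct.includeRight :
            c.A →ₐ[sIntegers S] sIntegers (placesOver L S) ⊗[sIntegers S] c.A))) :
    M.overMult hv h P Z = 0 ∨ M.overMult hv h P Z = M.multDivisor hv P α := by
  have := isDiscreteValuationRing_complIntegers w
  obtain ⟨χ, hχ, hχ'⟩ := c.exists_point hv P hP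
  obtain ⟨ψ, h1, -, h2, h3⟩ := c.exists_overMult_eq hv h hunr (α := α) P hχ hχ' Z
  rw [h2, h3]
  exact (hZ ψ h1).imp (fun h4 => idealMult_eq_zero_iff.mpr h4) (congrArg idealMult)

end

theorem coe_red_preimage_overFst (X : CampanaOrbifold K ι) (L' : Type u) [Field L'] [Algebra K L'] :
    (X.red.preimage (X.overFst L').continuous : Set (X.baseChange L')) =
      ⋃ α ∈ {α | X.m α ≠ 1}, ((X.D α).preimage (X.overFst L').continuous :
        Set (X.baseChange L')) :=
  Set.preimage_iUnion₂

/-- The component C comes before L because L will be the field of definition of C. Any component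
meeting the chart serves, since the place w is then adapted to it. -/
theorem exists_isComponent_overMult_eq [IsFractionRing (sIntegers S) K]
    [IsDiscreteValuationRing v.1]
    (hfrac : ∀ x ∈ v.1, ∃ a b : sIntegers S, v.1.valuation (b : K) = 1 ∧ x * b = a)
    (L' : Type u) [Field L'] [Algebra K L']
    (c : M.Chart) {α : ι} (hα : X.m α ≠ 1) {P : X.LocalPoint v}
    (hP : M.extend hv P (IsLocalRing.closedPoint (complIntegers v)) ∈ Set.range c.j)
    (h0 : M.multDivisor hv P α ≠ 0) :
    ∃ C : Closeds (X.baseChange L'),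
      IsComponent C (X.red.preimage (X.overFst L').continuous) ∧
      IsComponent C ((X.D α).preimage (X.overFst L').continuous) ∧
      ∀ (L : Type u) [Field L] [Algebra K L] [Algebra L L'] [IsScalarTower K L L']
        [Algebra.IsAlgebraic K L], ∃ (w : Place L) (h : w.LiesOver v),
        IsDiscreteValuationRing w.1 →
        (IsLocalRing.maximalIdeal (complIntegers v)).map (complIntegersMap h) =
          IsLocalRing.maximalIdeal (complIntegers w) →
        (∀ ψ : sIntegers (placesOver L S) ⊗[sIntegers S] c.A →+* complIntegers w,
          ψ.comp Algebra.TensorProduct.includeLeftRingHom =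
            sIntegersToCompl (notMem_placesOver hv h) →
          (pullIdeal (c.overIntegers L) (((IdealSheafData.vanishingIdeal C).map
            (X.overMap L L')).map (M.overGen L))).map ψ = ⊤ ∨
          (pullIdeal (c.overIntegers L) (((IdealSheafData.vanishingIdeal C).map
            (X.overMap L L')).map (M.overGen L))).map ψ =
            (c.ideal α).map (ψ.comp (Algebra.TensorProduct.includeRight :
              c.A →ₐ[sIntegers S] sIntegers (placesOver L S) ⊗[sIntegers S] c.A))) →
        M.overMult hv h P (((IdealSheafData.vanishingIdeal C).map
            (X.overMap L L')).map (M.overGen L)) = M.multDivisor hv P α := by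
  have := isDiscreteValuationRing_complIntegers v
  obtain ⟨χ, hχ, hχ'⟩ := c.exists_point hv P hP
  have hmd : M.multDivisor hv P α = idealMult ((c.ideal α).map χ) := by
    rw [multDivisor_eq, hχ, pullIdeal_comp]
    rfl
  have hχm := le_maximalIdeal_of_idealMult_ne_zero (hmd ▸ h0)
  have hI : c.ideal α ≠ ⊤ := fun h1 => by
    rw [hmd, h1, Ideal.map_top, idealMult_top] at h0
    exact h0 rfl
  have hIp := c.ideal_isPrime hI
  have hflat := flat_of_sIntegers (S := S) L'
  obtain ⟨p, hp, hpJ⟩ := Ideal.exists_le_maximal _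
    (map_includeRight_ne_top (L := L') hI (c.injective_one_tmul α))
  obtain ⟨q, hq, -⟩ := Ideal.exists_minimalPrimes_le hpJ
  have hqp : q.IsPrime := hq.1.1
  let x : PrimeSpectrum (L' ⊗[sIntegers S] c.A) := ⟨q, hqp⟩
  obtain ⟨hC, hCq⟩ := isComponent_closure (c.overField L').isOpenEmbedding
    (c.overField_mem_iff L' α) x hq
  have hqI := comap_includeRight_of_mem_minimalPrimes hq
  refine ⟨_, ?_, hC, fun L _ _ _ _ _ => ?_⟩
  · refine IsComponent.of_iUnion X.finite_m (coe_red_preimage_overFst X L') hα hC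
      fun β _ hle => ?_
    have h1 := Ideal.map_le_iff_le_comap.mp
      ((c.overField_mem_iff L' β x).mp (hle (subset_closure rfl)))
    rw [c.eq_of_ideal_le hI (h1.trans hqI.le)]
  · let qL := q.comap (Algebra.TensorProduct.map (fieldMap S L L') (AlgHom.id (sIntegers S) c.A))
    have hqLp : qL.IsPrime := Ideal.comap_isPrime _ _
    have hqLI : qL.comap (Algebra.TensorProduct.includeRight :
        c.A →ₐ[sIntegers S] L ⊗[sIntegers S] c.A) ≤ c.ideal α := by
      rw [← hqI]
      intro a ha
      have h1 : Algebra.TensorProduct.map (fieldMap S L L') (AlgHom.id (sIntegers S) c.A)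
        (1 ⊗ₜ a) = 1 ⊗ₜ a := by simp
      change (1 : L') ⊗ₜ[sIntegers S] a ∈ q
      rw [← h1]
      exact ha
    obtain ⟨w, h, hw⟩ := exists_liesOver_map_le hv hfrac hqLI χ hχ' hχm
    refine ⟨w, h, fun _ hunr hZ => ?_⟩
    obtain ⟨ψ, h1, h2, h3, h4⟩ := c.exists_overMult_eq hv h hunr (α := α) P hχ hχ'
      (((IdealSheafData.vanishingIdeal ⟨closure {c.overField L' x}, isClosed_closure⟩).map
            (X.overMap L L')).map (M.overGen L))
    rw [h3, h4]
    -- Of the two alternatives, the unit ideal is impossible: w was chosen so that the ideal of the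
    -- component lands in the maximal ideal.
    refine congrArg idealMult ((hZ ψ h1).resolve_left fun h5 => ?_)
    have h6 := hw ψ h1 h2
    rw [c.pullIdeal_overIntegers_map] at h5
    have h7 : ∀ q' : Ideal (L' ⊗[sIntegers S] c.A), q' = q → ((q'.comap
        (Algebra.TensorProduct.map (fieldMap S L L') (AlgHom.id (sIntegers S) c.A))).comap
        (Algebra.TensorProduct.map (sIntegersVal L S) (AlgHom.id (sIntegers S) c.A))).map ψ ≠ ⊤ := by
      rintro q' rfl h8
      exact (IsLocalRing.maximalIdeal.isMaximal _).ne_top (top_le_iff.mp (h8.ge.trans h6))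
    exact h7 _ hCq h5

end Model

end SemiIntegral

end

/-! ### Comparison of geometric points and conclusion -/

noncomputable section

namespace SemiIntegral

open Scheme TensorProduct Filter

variable {K : Type u} [Field K] {ι : Type w} {X : CampanaOrbifold K ι} {S : Set (Place K)}

namespace Model

variable {M : Model X S} {v : Place K} (hv : v ∉ S)

theorem geometricPoints_eq_points [IsFractionRing (sIntegers S) K] [IsDiscreteValuationRing v.1]
    (hfrac : ∀ x ∈ v.1, ∃ a b : sIntegers S, v.1.valuation (b : K) = 1 ∧ x * b = a)
    {s : Set M.Chart} (hs : ∀ y, ∃ c ∈ s, y ∈ Set.range c.j)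
    (hunr : ∀ α C, X.IsGeomComponent α C → ∀ (w : Place (X.fieldOfDef C)) (h : w.LiesOver v),
      IsDiscreteValuationRing w.1 ∧
      (IsLocalRing.maximalIdeal (complIntegers v)).map (complIntegersMap h) =
        IsLocalRing.maximalIdeal (complIntegers w))
    (hmap : ∀ c ∈ s, ∀ α, X.m α ≠ 1 → ∀ C, X.IsGeomComponent α C →
      ∀ (w : Place (X.fieldOfDef C)) (h : w.LiesOver v)
      (ψ : sIntegers (placesOver (X.fieldOfDef C) S) ⊗[sIntegers S] c.A →+* complIntegers w),
      ψ.comp Algebra.TensorProduct.includeLeftRingHom = sIntegersToCompl (notMem_placesOver hv h) →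
      (pullIdeal (c.overIntegers (X.fieldOfDef C)) (M.geomIdeal C)).map ψ = ⊤ ∨
      (pullIdeal (c.overIntegers (X.fieldOfDef C)) (M.geomIdeal C)).map ψ =
        (c.ideal α).map (ψ.comp (Algebra.TensorProduct.includeRight : c.A →ₐ[sIntegers S]
          sIntegers (placesOver (X.fieldOfDef C) S) ⊗[sIntegers S] c.A))) (k : Kind) :
    M.geometricPoints hv k = M.points hv k := by
  ext P
  refine and_congr_right fun _ => forall₃_congr fun α m hm => ?_
  by_cases hα : X.m α = 1
  · have : m = 1 := by exact_mod_cast hm.symm.trans hα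
    subst this
    exact iff_of_true (fun _ _ _ _ => k.admissible_one _) (k.admissible_one _)
  obtain ⟨c, hc, hP⟩ := hs (M.extend hv P (IsLocalRing.closedPoint (complIntegers v)))
  constructor
  · intro H
    by_cases h0 : M.multDivisor hv P α = 0
    · rw [h0]
      exact k.admissible_zero m
    · obtain ⟨C, hC, hC', h⟩ := exists_isComponent_overMult_eq hv hfrac (AlgebraicClosure K) c hα
        hP h0
      obtain ⟨w, hw, h⟩ := h (X.fieldOfDef C)
      obtain ⟨h1, h2⟩ := hunr α C ⟨hC, hC'⟩ w hw
      have h3 : M.overMult hv hw P (M.geomIdeal C) = M.multDivisor hv P α :=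
        h h1 h2 (hmap c hc α hα C ⟨hC, hC'⟩ w hw)
      rw [← h3]
      exact H C ⟨hC, hC'⟩ w hw
  · intro H C hC w hw
    obtain ⟨h1, h2⟩ := hunr α C hC w hw
    obtain h3 | h3 := overMult_eq_zero_or_eq_multDivisor hv hw h2 c hP (hmap c hc α hα C hC w hw)
    · rw [h3]
      exact k.admissible_zero m
    · rw [h3]
      exact H

/-- There are finitely many charts, weights different from 1 and geometric components, so the
finitely many places excluded for each can be discarded together. -/
theorem eventually_points_eq (M : Model X S) (hK : IsGlobalField K)
    [IsFractionRing (sIntegers S) K] (hD : X.SmoothComponents) :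
    ∀ᶠ v : Place K in cofinite, ∀ (hv : v ∉ S) (k : Kind),
      M.geometricPoints hv k = M.strongPoints hv k ∧ M.strongPoints hv k = M.points hv k := by
  obtain ⟨s, hs, hcov⟩ := M.exists_finite_charts
  have hsm : ∀ᶠ v : Place K in cofinite, ∀ c ∈ s, ∀ α ∈ {α | X.m α ≠ 1}, ∀ hv : v ∉ S,
      letI := valuationAlgebra hv
      Algebra.Smooth v.1 (v.1 ⊗[sIntegers S] (c.A ⧸ c.ideal α)) :=
    (eventually_all_finite hs).mpr fun c _ => (eventually_all_finite X.finite_m).mpr fun α _ =>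
      have := c.smooth hD α
      hK.eventually_smooth (c.A ⧸ c.ideal α) (c.injective_one_tmul α)
  have hfin := finite_setOf_isGeomComponent X
  have hunr : ∀ᶠ v : Place K in cofinite, ∀ C ∈ {C | ∃ α, X.IsGeomComponent α C},
      ∃ π : K, π ≠ 0 ∧ v.1.valuation π < 1 ∧
      (∀ a : K, v.1.valuation a < 1 → v.1.valuation a ≤ v.1.valuation π) ∧
      ∀ w : Place (X.fieldOfDef C), w.LiesOver v → IsDiscreteValuationRing w.1 ∧
        ∀ x : X.fieldOfDef C, w.1.valuation x < 1 →
          w.1.valuation x ≤ w.1.valuation (algebraMap K (X.fieldOfDef C) π) :=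
    (eventually_all_finite hfin).mpr fun C ⟨α, hC⟩ => by
      obtain ⟨h1, h2⟩ := fieldOfDef_finite hD hs hcov hC
      exact hK.eventually_exists_uniformizer
  have hmap : ∀ᶠ v : Place K in cofinite, ∀ c ∈ s, ∀ α ∈ {α | X.m α ≠ 1},
      ∀ C ∈ {C | ∃ α, X.IsGeomComponent α C}, X.IsGeomComponent α C → ∀ (hv : v ∉ S)
      (w : Place (X.fieldOfDef C)) (h : w.LiesOver v)
      (ψ : sIntegers (placesOver (X.fieldOfDef C) S) ⊗[sIntegers S] c.A →+* complIntegers w),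
      ψ.comp Algebra.TensorProduct.includeLeftRingHom = sIntegersToCompl (notMem_placesOver hv h) →
      (pullIdeal (c.overIntegers (X.fieldOfDef C)) (M.geomIdeal C)).map ψ = ⊤ ∨
      (pullIdeal (c.overIntegers (X.fieldOfDef C)) (M.geomIdeal C)).map ψ =
        (c.ideal α).map (ψ.comp (Algebra.TensorProduct.includeRight : c.A →ₐ[sIntegers S]
          sIntegers (placesOver (X.fieldOfDef C) S) ⊗[sIntegers S] c.A)) :=
    (eventually_all_finite hs).mpr fun c _ => (eventually_all_finite X.finite_m).mpr fun α _ =>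
      (eventually_all_finite hfin).mpr fun C _ => by
        by_cases hC : X.IsGeomComponent α C
        · exact (c.eventually_map_pullIdeal (L := X.fieldOfDef C) hK hD hC.2).mono fun v h _ => h
        · exact .of_forall fun v h => absurd h hC
  filter_upwards [hK.eventually_isDiscreteValuationRing, hK.eventually_exists_frac S, hsm, hunr,
    hmap] with v hdvr hfrac hsm hunr hmap hv k
  have h1 := strongPoints_eq_points hv (hfrac hv) hcov (fun c hc α hα => hsm c hc α hα hv) k
  have h2 := geometricPoints_eq_points hv (hfrac hv) hcov (fun α C hC w h => by
      obtain ⟨π, -, hlt, hmax, hw⟩ := hunr C ⟨α, hC⟩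
      exact ⟨(hw w h).1, map_maximalIdeal_complIntegersMap h hlt hmax (hw w h).2⟩)
    (fun c hc α hα C hC => hmap c hc α hα C ⟨α, hC⟩ hC hv) k
  exact ⟨h2.trans h1.symm, h1⟩

end Model

end SemiIntegral

end

theorem corollary2 {K : Type u} [Field K] (hK : SemiIntegral.IsGlobalField K) {ι : Type w}
    (X : SemiIntegral.CampanaOrbifold K ι) (S : Set (SemiIntegral.Place K)) (hS : S.Finite)
    (hS' : CharZero K ∨ S.Nonempty) (M : SemiIntegral.Model X S) (hD : X.SmoothComponents) :
    {v : {v : SemiIntegral.Place K // v ∉ S} | ¬ ∀ k : SemiIntegral.Kind,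
      M.geometricPoints v.2 k = M.strongPoints v.2 k ∧
        M.strongPoints v.2 k = M.points v.2 k}.Finite := by
  have := hK.isFractionRing_sIntegers hS'
  have h : {v : SemiIntegral.Place K | ¬ ∀ (hv : v ∉ S) (k : SemiIntegral.Kind),
      M.geometricPoints hv k = M.strongPoints hv k ∧
        M.strongPoints hv k = M.points hv k}.Finite := M.eventually_points_eq hK hD
  refine (h.preimage Subtype.val_injective.injOn).subset fun v hv h => hv fun k => h v.2 k
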